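/- All C*-algebras below are separable, and morphisms are $*$-homomorphisms (algebras and morphisms need not be unital). Ideals are closed and two-sided. **Definitions.** A morphism $\varphi\colon A\to B$ is *projective* if for every C*-algebra $C$, every ideal $J\lhd C$ with quotient map $\pi\colon C\to C/J$ and every morphism $\sigma\colon B\to C/J$ there is a morphism $\psi\colon A\to C$ with $\pi\circ\psi=\sigma\circ\varphi$. It is *semiprojective* if for every C*-algebra $C$, every increasing sequence of ideals $J_1\subseteq J_2\subseteq\dots$ of $C$ and every morphism $\sigma\colon B\to C/\overline{\bigcup_k J_k}$ there are an index $k$ and a morphism $\psi\colon A\to C/J_k$ with $\pi_k\circ\psi=\sigma\circ\varphi$, where $\pi_k\colon C/J_k\to C/\overline{\bigcup_k J_k}$ is the quotient map. It is *weakly projective* (resp. *weakly semiprojective*) if in the same situation, for every $\varepsilon>0$ and every finite set $F\subset A$, there is a $\psi$ (resp. a $k$ and a $\psi$) with $\|\pi(\psi(x))-\sigma(\varphi(x))\|<\varepsilon$ (resp. $\|\pi_k(\psi(x))-\sigma(\varphi(x))\|<\varepsilon$) for all $x\in F$. A C*-algebra $A$ has one of these four properties if $\mathrm{id}_A$ has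 it. Two morphisms $A\to B$ are *homotopic*, written $\simeq$, if they are joined by a path $(\varphi_t)_{t\in[0,1]}$ of morphisms such that $t\mapsto\varphi_t(a)$ is norm continuous for each $a\in A$. A *shape system* for $A$ is a sequence $A_1\xrightarrow{\gamma_1}A_2\xrightarrow{\gamma_2}\cdots$ of C*-algebras with semiprojective connecting morphisms and with inductive limit $A$. For $k<l$ let $\gamma_{l,k}=\gamma_{l-1}\circ\dots\circ\gamma_k\colon A_k\to A_l$. Two sequences $(A_k,\gamma_k)$ and $(B_n,\theta_n)$ are *equivalent* if there are indices $k_1<n_1<k_2<n_2<\cdots$ and morphisms $\alpha_i\colon A_{k_i}\to B_{n_i}$, $\beta_i\colon B_{n_i}\to A_{k_{i+1}}$ such that $\beta_i\circ\alpha_i\simeq\gamma_{k_{i+1},k_i}$ and $\alpha_{i+1}\circ\beta_i\simeq\theta_{n_{i+1},n_i}$ for all $i$. $A$ has *trivial shape* if some shape system for $A$ is equivalent to some shape system for the zero C*-algebra. **Theorem.** Let $A$ be a separable C*-algebra. Then: 1. $A$ is projective if and only if $A$ is semiprojective and has trivial shape. 2. $A$ is weakly projective if and only if $A$ is weakly semiprojective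 and has trivial shape. -/

import Mathlib

open Filter Topology

universe u

namespace CStarShape

section Morphisms

/-- `S` is the kernel of the surjective *-homomorphism `π : C → Q`. By the first isomorphism
theorem for C*-algebras, this says that `Q` together with `π` is the quotient of `C` by the
ideal `S`. -/
structure IsQuotientBy {C Q : Type u} [NonUnitalCStarAlgebra C] [NonUnitalCStarAlgebra Q]
    (S : Set C) (π : C →⋆ₙₐ[ℂ] Q) : Prop where
  surjective : Function.Surjective π
  mem_iff : ∀ c : C, c ∈ S ↔ π c = 0

variable {A B : Type u} [NonUnitalCStarAlgebra A] [NonUnitalCStarAlgebra B]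

/-- `φ : A → B` is projective: for every separable `C`, closed ideal `J` of `C` with quotient
map `π : C → C/J`, and `σ : B → C/J`, the morphism `σ ∘ φ` lifts along `π`. -/
def ProjectiveHom (φ : A →⋆ₙₐ[ℂ] B) : Prop :=
  ∀ (C Q : Type u) [NonUnitalCStarAlgebra C] [TopologicalSpace.SeparableSpace C]
    [NonUnitalCStarAlgebra Q] (J : TwoSidedIdeal C) (π : C →⋆ₙₐ[ℂ] Q),
    IsClosed (J : Set C) → IsQuotientBy (J : Set C) π →
    ∀ σ : B →⋆ₙₐ[ℂ] Q, ∃ ψ : A →⋆ₙₐ[ℂ] C, π.comp ψ = σ.comp φ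

/-- `φ : A → B` is weakly projective: as for projectivity, but lifts are only required up to
`ε` on a given finite set `F`. -/
def WeaklyProjectiveHom (φ : A →⋆ₙₐ[ℂ] B) : Prop :=
  ∀ (C Q : Type u) [NonUnitalCStarAlgebra C] [TopologicalSpace.SeparableSpace C]
    [NonUnitalCStarAlgebra Q] (J : TwoSidedIdeal C) (π : C →⋆ₙₐ[ℂ] Q),
    IsClosed (J : Set C) → IsQuotientBy (J : Set C) π →
    ∀ (σ : B →⋆ₙₐ[ℂ] Q) (ε : ℝ) (F : Finset A), 0 < ε →
      ∃ ψ : A →⋆ₙₐ[ℂ] C, ∀ a ∈ F, ‖π (ψ a) - σ (φ a)‖ < ε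

/-- `φ : A → B` is semiprojective. Here `ρ k : C → C/J_k` and `π : C → C/J`, with `J` the
closure of `⋃ k, J k`, are the quotient maps, and `p k : C/J_k → C/J` is the induced map. -/
def SemiprojectiveHom (φ : A →⋆ₙₐ[ℂ] B) : Prop :=
  ∀ (C : Type u) [NonUnitalCStarAlgebra C] [TopologicalSpace.SeparableSpace C]
    (J : ℕ → TwoSidedIdeal C), (∀ k, IsClosed (J k : Set C)) → Monotone J →
  ∀ (D : ℕ → Type u) [∀ k, NonUnitalCStarAlgebra (D k)] (Q : Type u) [NonUnitalCStarAlgebra Q]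
    (ρ : ∀ k, C →⋆ₙₐ[ℂ] D k) (π : C →⋆ₙₐ[ℂ] Q) (p : ∀ k, D k →⋆ₙₐ[ℂ] Q),
    (∀ k, IsQuotientBy (J k : Set C) (ρ k)) →
    IsQuotientBy (closure (⋃ k, (J k : Set C))) π →
    (∀ k, (p k).comp (ρ k) = π) →
    ∀ σ : B →⋆ₙₐ[ℂ] Q, ∃ (k : ℕ) (ψ : A →⋆ₙₐ[ℂ] D k), (p k).comp ψ = σ.comp φ

/-- `φ : A → B` is weakly semiprojective: as for semiprojectivity, but lifts are only required
up to `ε` on a given finite set `F`. -/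
def WeaklySemiprojectiveHom (φ : A →⋆ₙₐ[ℂ] B) : Prop :=
  ∀ (C : Type u) [NonUnitalCStarAlgebra C] [TopologicalSpace.SeparableSpace C]
    (J : ℕ → TwoSidedIdeal C), (∀ k, IsClosed (J k : Set C)) → Monotone J →
  ∀ (D : ℕ → Type u) [∀ k, NonUnitalCStarAlgebra (D k)] (Q : Type u) [NonUnitalCStarAlgebra Q]
    (ρ : ∀ k, C →⋆ₙₐ[ℂ] D k) (π : C →⋆ₙₐ[ℂ] Q) (p : ∀ k, D k →⋆ₙₐ[ℂ] Q),
    (∀ k, IsQuotientBy (J k : Set C) (ρ k)) →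
    IsQuotientBy (closure (⋃ k, (J k : Set C))) π →
    (∀ k, (p k).comp (ρ k) = π) →
    ∀ (σ : B →⋆ₙₐ[ℂ] Q) (ε : ℝ) (F : Finset A), 0 < ε →
      ∃ (k : ℕ) (ψ : A →⋆ₙₐ[ℂ] D k), ∀ a ∈ F, ‖p k (ψ a) - σ (φ a)‖ < ε

/-- Homotopy of *-homomorphisms: a point-norm continuous path of *-homomorphisms. -/
def Homotopic (φ ψ : A →⋆ₙₐ[ℂ] B) : Prop :=
  ∃ H : unitInterval → (A →⋆ₙₐ[ℂ] B),
    (∀ a, Continuous fun t => H t a) ∧ H 0 = φ ∧ H 1 = ψ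

end Morphisms

section Algebras

variable (A : Type u) [NonUnitalCStarAlgebra A]

def IsProjective : Prop := ProjectiveHom (NonUnitalStarAlgHom.id ℂ A)

def IsWeaklyProjective : Prop := WeaklyProjectiveHom (NonUnitalStarAlgHom.id ℂ A)

def IsSemiprojective : Prop := SemiprojectiveHom (NonUnitalStarAlgHom.id ℂ A)

def IsWeaklySemiprojective : Prop := WeaklySemiprojectiveHom (NonUnitalStarAlgHom.id ℂ A)

end Algebras

/-- A sequential inductive system of separable C*-algebras. -/
structure InductiveSystem where
  obj : ℕ → Type u
  [cstar : ∀ k, NonUnitalCStarAlgebra (obj k)]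
  [separable : ∀ k, TopologicalSpace.SeparableSpace (obj k)]
  map : ∀ k, obj k →⋆ₙₐ[ℂ] obj (k + 1)

attribute [instance] InductiveSystem.cstar InductiveSystem.separable

namespace InductiveSystem

/-- The composed connecting morphism `obj k → obj l` for `k ≤ l`. -/
def trans (S : InductiveSystem.{u}) {k l : ℕ} (h : k ≤ l) : S.obj k →⋆ₙₐ[ℂ] S.obj l :=
  Nat.leRecOn (C := fun n => S.obj k →⋆ₙₐ[ℂ] S.obj n) h (fun {n} f => (S.map n).comp f)
    (NonUnitalStarAlgHom.id ℂ (S.obj k))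

/-- `A` with the morphisms `ι k : obj k → A` is the C*-algebraic inductive limit of `S`, i.e.
the completion of the algebraic direct limit, divided by its null space, for the seminorm
given by `lim_n ‖trans (k ≤ n) a‖` on the class of `a : obj k`. -/
structure IsLimit (S : InductiveSystem.{u}) (A : Type u) [NonUnitalCStarAlgebra A]
    (ι : ∀ k, S.obj k →⋆ₙₐ[ℂ] A) : Prop where
  compat : ∀ k, (ι (k + 1)).comp (S.map k) = ι k
  dense : Dense (⋃ k, Set.range (ι k))
  norm_tendsto : ∀ (k : ℕ) (a : S.obj k),
    Tendsto (fun n : ℕ => ‖S.trans (Nat.le_add_right k n) a‖) atTop (𝓝 ‖ι k a‖)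

/-- A shape system for `A`: limit `A` and semiprojective connecting morphisms. -/
def IsShapeSystem (S : InductiveSystem.{u}) (A : Type u) [NonUnitalCStarAlgebra A] : Prop :=
  (∃ ι : ∀ k, S.obj k →⋆ₙₐ[ℂ] A, S.IsLimit A ι) ∧ ∀ k, SemiprojectiveHom (S.map k)

/-- Equivalence of inductive systems: a homotopy-commutative intertwining along indices
`k 0 < n 0 < k 1 < n 1 < ⋯`. -/
def Equivalent (S T : InductiveSystem.{u}) : Prop :=
  ∃ (k n : ℕ → ℕ) (hkn : ∀ i, k i < n i) (hnk : ∀ i, n i < k (i + 1))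
    (α : ∀ i, S.obj (k i) →⋆ₙₐ[ℂ] T.obj (n i))
    (β : ∀ i, T.obj (n i) →⋆ₙₐ[ℂ] S.obj (k (i + 1))),
    (∀ i, Homotopic ((β i).comp (α i)) (S.trans ((hkn i).trans (hnk i)).le)) ∧
    ∀ i, Homotopic ((α (i + 1)).comp (β i)) (T.trans ((hnk i).trans (hkn (i + 1))).le)

end InductiveSystem

/-- Shape equivalence: some shape systems of `A` and `B` are equivalent. -/
def ShapeEquivalent (A B : Type u) [NonUnitalCStarAlgebra A] [NonUnitalCStarAlgebra B] : Prop :=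
  ∃ S T : InductiveSystem.{u}, S.IsShapeSystem A ∧ T.IsShapeSystem B ∧ S.Equivalent T

/-- The zero C*-algebra. -/
noncomputable instance instPUnit : NonUnitalCStarAlgebra PUnit.{u + 1} where
  star := id
  star_involutive _ := rfl
  star_mul _ _ := rfl
  star_add _ _ := rfl
  norm_mul_self_le _ := by simp
  star_smul _ _ := rfl

/-- Trivial shape: shape equivalence to the zero C*-algebra. -/
def HasTrivialShape (A : Type u) [NonUnitalCStarAlgebra A] : Prop :=
  ShapeEquivalent A PUnit.{u + 1}

end CStarShape

/-! The engine is the passage from asymptotic morphisms to honest ones,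
`LiftsUpTo.exists_lift_of_asymptotic`. Let `R` be a subalgebra of `(∏ C n) × G` with `limsup ‖x n‖ ≤
K ‖g‖` for every `(x, g)` in `R`. In its closure `E` the kernel of the projection to `G` consists of
null sequences, so it is the closure of the increasing union of the ideals of those `(x, 0)` for
which `x` vanishes from `k` on. A semiprojective map followed by a map into the image of `E` in `G`
therefore lifts to `E` modulo one of these ideals, and a coordinate `n ≥ k` gives a morphism into `C
n`. The weak version works in the same way. Four choices of `R` are used.

Trivial shape gives lifts. In a shape system of zero the connecting maps are eventually
null-homotopic, where `R` consists of null sequences of paths (`exists_nullHomotopic_of_zero`); an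
equivalent system inherits this. A semiprojective map followed by a null-homotopic one is projective
(`SemiprojectiveHom.projectiveHom_comp`): for a quasicentral approximate unit `u n` of the ideal and
`T n = 1 - u n`, the sequences `f(T n) c` with `f 0 = 0` lie asymptotically over the paths `f ⊗ π c`
in the quotient, and `f(T n) c` lifts the endpoint `f(1) π c` exactly. A weakly semiprojective `A`
maps approximately into some algebra of its shape system (`exists_approx_section`), from where
morphisms lift, so `A` is weakly projective. If `A` is semiprojective, a sequence of approximate
lifts can be corrected to an exact one (`IsWeaklyProjective.isProjective`).

Conversely, write `A` as a quotient of the universal algebra `UnivAlg` on a sequence of selfadjoint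
contractions, and let `r j` be dense in the kernel. Imposing `‖r j‖ ≤ 1/(k+1)` for `j ≤ k` defines
`Stage r k`, and these algebras form a shape system for `A`. If `A` is weakly projective, it maps
approximately back into `UnivAlg`, so a late connecting map is homotopic to one that factors through
`UnivAlg`. Since `UnivAlg` is contractible, that map is null-homotopic
(`exists_stage_nullHomotopic`), and the system is equivalent to the zero system. -/

open scoped ENNReal

namespace CStarShape

/-! ### Norm-controlled preimages under *-homomorphisms -/

section Lifting

variable {C D : Type*} [NonUnitalCStarAlgebra C] [NonUnitalCStarAlgebra D]

lemma continuous_hom (f : C →⋆ₙₐ[ℂ] D) : Continuous f :=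
  AddMonoidHomClass.continuous_of_bound f 1 fun c => by
    simpa using NonUnitalStarAlgHom.norm_apply_le f c

/-- Symmetrize any preimage and truncate it at `±r` by functional calculus. The truncation is the
identity on the spectrum of `y`, so the image does not change. No constant is lost, which the limits
of quotient norms below depend on. -/
lemma exists_selfAdjoint_preimage (f : C →⋆ₙₐ[ℂ] D) {y : D} (hy : y ∈ Set.range f)
    (hsa : IsSelfAdjoint y) {r : ℝ} (hr : ‖y‖ ≤ r) :
    ∃ c : C, IsSelfAdjoint c ∧ ‖c‖ ≤ r ∧ f c = y := by
  obtain ⟨c₀, rfl⟩ := hy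
  have hr0 : 0 ≤ r := (norm_nonneg _).trans hr
  set c₁ : C := ((1 / 2 : ℝ) : ℂ) • (c₀ + star c₀) with hc₁
  have hc₁sa : IsSelfAdjoint c₁ := by
    rw [isSelfAdjoint_iff, hc₁, star_smul, star_add, star_star, add_comm]
    simp
  have hfc : f c₁ = f c₀ := by
    rw [hc₁, map_smul, map_add, map_star, hsa.star_eq, ← two_smul ℂ (f c₀), smul_smul]
    norm_num
  have hcont : Continuous (fun t : ℝ => max (-r) (min r t)) := by fun_prop
  refine ⟨cfcₙ (fun t : ℝ => max (-r) (min r t)) c₁, cfcₙ_predicate _ _, ?_, ?_⟩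
  · refine norm_cfcₙ_le fun x _ => ?_
    rw [Real.norm_eq_abs, abs_le]
    exact ⟨le_max_left _ _, max_le (by linarith) (min_le_left _ _)⟩
  · rw [NonUnitalStarAlgHom.map_cfcₙ f _ c₁ hcont.continuousOn (by simp [hr0]) (continuous_hom f)
      hc₁sa (hc₁sa.map f), hfc]
    conv_rhs => rw [← cfcₙ_id ℝ (f c₀) hsa]
    refine cfcₙ_congr fun x hx => ?_
    have : ‖x‖ ≤ ‖f c₀‖ := NonUnitalIsometricContinuousFunctionalCalculus.norm_quasispectrum_le _ hx hsa
    have h2 := abs_le.1 (this.trans hr)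
    simp [h2.1, h2.2]

/-- The factor 2 comes from lifting the real and imaginary parts separately. -/
lemma exists_preimage_norm_le (f : C →⋆ₙₐ[ℂ] D) {y : D} (hy : y ∈ Set.range f) :
    ∃ c : C, f c = y ∧ ‖c‖ ≤ 2 * ‖y‖ := by
  have hre : ((realPart y : D)) ∈ Set.range f := by
    obtain ⟨c, rfl⟩ := hy
    exact ⟨realPart c, by
      simp only [realPart_apply_coe, RCLike.real_smul_eq_coe_smul (K := ℂ), map_smul, map_add, map_star]⟩
  have him : ((imaginaryPart y : D)) ∈ Set.range f := by
    obtain ⟨c, rfl⟩ := hy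
    exact ⟨imaginaryPart c, by
      simp only [imaginaryPart_apply_coe, RCLike.real_smul_eq_coe_smul (K := ℂ), map_smul, map_sub,
        map_star]⟩
  obtain ⟨a, -, ha, hfa⟩ := exists_selfAdjoint_preimage f hre (realPart y).2 (realPart.norm_le y)
  obtain ⟨b, -, hb, hfb⟩ := exists_selfAdjoint_preimage f him (imaginaryPart y).2
    (imaginaryPart.norm_le y)
  refine ⟨a + Complex.I • b, ?_, ?_⟩
  · rw [map_add, map_smul, hfa, hfb, realPart_add_I_smul_imaginaryPart]
  · refine (norm_add_le _ _).trans ?_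
    rw [norm_smul, Complex.norm_I]
    linarith

/-- Preimages with a uniform norm bound can be summed along a convergent series in the complete
domain. -/
lemma isClosed_range (f : C →⋆ₙₐ[ℂ] D) : IsClosed (Set.range f) := by
  let g : NormedAddGroupHom C D :=
    { toFun := f, map_add' := map_add f, bound' := ⟨1, fun c => by
        simpa using NonUnitalStarAlgHom.norm_apply_le f c⟩ }
  have h : g.SurjectiveOnWith (AddMonoidHom.range g.toAddMonoidHom) 2 := fun y hy =>
    exists_preimage_norm_le f hy
  have h2 := controlled_closure_of_complete (by norm_num) one_pos h
  refine isClosed_of_closure_subset fun y hy => ?_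
  obtain ⟨c, hc, -⟩ := h2 y hy
  exact ⟨c, hc⟩

/-- An element whose image is small is close to the kernel. -/
lemma exists_mem_ker_norm_sub_le (f : C →⋆ₙₐ[ℂ] D) (c : C) {ε : ℝ} (hc : ‖f c‖ ≤ ε) :
    ∃ d : C, f d = 0 ∧ ‖c - d‖ ≤ 2 * ε := by
  obtain ⟨e, he, hn⟩ := exists_preimage_norm_le f ⟨c, rfl⟩
  exact ⟨c - e, by simp [he], by simpa using hn.trans (by linarith)⟩

end Lifting

/-! ### Separable closed subalgebras -/

section Separability

variable {C : Type*} [NonUnitalCStarAlgebra C]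

lemma countable_subsemigroup_closure {M : Type*} [Semigroup M] {s : Set M} (hs : s.Countable) :
    (Subsemigroup.closure s : Set M).Countable := by
  have := hs.to_subtype
  have h2 : (Subsemigroup.closure s : Set M) ⊆
      Set.range (fun w : FreeSemigroup s => FreeSemigroup.lift (fun x : s => (x : M)) w) := by
    intro x hx
    induction hx using Subsemigroup.closure_induction with
    | mem x hx => exact ⟨FreeSemigroup.of ⟨x, hx⟩, by simp⟩
    | mul x y _ _ hx hy =>
      obtain ⟨a, rfl⟩ := hx
      obtain ⟨b, rfl⟩ := hy
      exact ⟨a * b, by simp⟩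
  have : Countable (FreeSemigroup s) := by
    have : Function.Injective (fun w : FreeSemigroup s => (w.head, w.tail)) := by
      rintro ⟨a, b⟩ ⟨c, d⟩ h
      simp_all
    exact this.countable
  exact (Set.countable_range _).mono h2

/-- The closed subalgebra generated by a set. -/
def generated (s : Set C) : NonUnitalStarSubalgebra ℂ C :=
  (NonUnitalStarAlgebra.adjoin ℂ s).topologicalClosure

instance isClosed_generated (s : Set C) : IsClosed (generated s : Set C) :=
  NonUnitalStarSubalgebra.isClosed_topologicalClosure _

lemma subset_generated (s : Set C) : s ⊆ generated s := fun _ hx =>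
  NonUnitalStarSubalgebra.le_topologicalClosure _ (NonUnitalStarAlgebra.subset_adjoin ℂ s hx)

lemma generated_le {s : Set C} {S : NonUnitalStarSubalgebra ℂ C} (hS : IsClosed (S : Set C))
    (h : s ⊆ S) : generated s ≤ S :=
  NonUnitalStarSubalgebra.topologicalClosure_minimal _ (NonUnitalStarAlgebra.adjoin_le h) hS

lemma separableSpace_generated {s : Set C} (hs : s.Countable) :
    TopologicalSpace.SeparableSpace (generated s) := by
  have h1 : TopologicalSpace.IsSeparable (NonUnitalStarAlgebra.adjoin ℂ s : Set C) := by
    have h2 := congrArg (fun p : Submodule ℂ C => (p : Set C))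
      (NonUnitalStarAlgebra.adjoin_eq_span s)
    have h3 : (NonUnitalStarAlgebra.adjoin ℂ s : Set C) =
      Submodule.span ℂ (Subsemigroup.closure (s ∪ star s) : Set C) := h2
    rw [h3]
    refine TopologicalSpace.IsSeparable.span ?_
    refine (countable_subsemigroup_closure (hs.union ?_)).isSeparable
    rw [← Set.image_star]
    exact hs.image _
  exact h1.closure.separableSpace

end Separability

/-! ### Lifting without separability or surjectivity assumptions -/

section Semiprojective

variable {A B : Type u} [NonUnitalCStarAlgebra A] [NonUnitalCStarAlgebra B]

/-- Liftings along increasing sequences of ideals exist, with errors on `S` of norm in `N`. This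
covers semiprojectivity and weak semiprojectivity. -/
def LiftsUpTo (φ : A →⋆ₙₐ[ℂ] B) (S : Set A) (N : Set ℝ) : Prop :=
  ∀ (C : Type u) [NonUnitalCStarAlgebra C] [TopologicalSpace.SeparableSpace C]
    (J : ℕ → TwoSidedIdeal C), (∀ k, IsClosed (J k : Set C)) → Monotone J →
  ∀ (D : ℕ → Type u) [∀ k, NonUnitalCStarAlgebra (D k)] (Q : Type u) [NonUnitalCStarAlgebra Q]
    (ρ : ∀ k, C →⋆ₙₐ[ℂ] D k) (π : C →⋆ₙₐ[ℂ] Q) (p : ∀ k, D k →⋆ₙₐ[ℂ] Q),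
    (∀ k, IsQuotientBy (J k : Set C) (ρ k)) →
    IsQuotientBy (closure (⋃ k, (J k : Set C))) π →
    (∀ k, (p k).comp (ρ k) = π) →
    ∀ σ : B →⋆ₙₐ[ℂ] Q, ∃ (k : ℕ) (ψ : A →⋆ₙₐ[ℂ] D k), ∀ a ∈ S, ‖p k (ψ a) - σ (φ a)‖ ∈ N

lemma SemiprojectiveHom.liftsUpTo {φ : A →⋆ₙₐ[ℂ] B} (h : SemiprojectiveHom φ) :
    LiftsUpTo φ Set.univ {0} := by
  intro C _ _ J hJ hm D _ Q _ ρ π p hρ hπ hp σ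
  obtain ⟨k, ψ, hψ⟩ := h C J hJ hm D Q ρ π p hρ hπ hp σ
  refine ⟨k, ψ, fun a _ => ?_⟩
  have : p k (ψ a) = σ (φ a) := DFunLike.congr_fun hψ a
  simp [this]

lemma WeaklySemiprojectiveHom.liftsUpTo {φ : A →⋆ₙₐ[ℂ] B} (h : WeaklySemiprojectiveHom φ)
    (F : Finset A) {ε : ℝ} (hε : 0 < ε) : LiftsUpTo φ F (Set.Iio ε) := by
  intro C _ _ J hJ hm D _ Q _ ρ π p hρ hπ hp σ
  obtain ⟨k, ψ, hψ⟩ := h C J hJ hm D Q ρ π p hρ hπ hp σ ε F hε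
  exact ⟨k, ψ, fun a ha => hψ a ha⟩

lemma isClosed_ker {C D : Type*} [NonUnitalCStarAlgebra C] [NonUnitalCStarAlgebra D]
    (f : C →⋆ₙₐ[ℂ] D) : IsClosed (TwoSidedIdeal.ker f : Set C) := by
  have : (TwoSidedIdeal.ker f : Set C) = f ⁻¹' {0} := by
    ext x; simp [TwoSidedIdeal.mem_ker]
  rw [this]
  exact isClosed_singleton.preimage (continuous_hom f)

lemma isQuotientBy_ker {C D : Type u} [NonUnitalCStarAlgebra C] [NonUnitalCStarAlgebra D]
    {f : C →⋆ₙₐ[ℂ] D} (hf : Function.Surjective f) :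
    IsQuotientBy (TwoSidedIdeal.ker f : Set C) f :=
  ⟨hf, fun _ => TwoSidedIdeal.mem_ker f⟩

section

variable {C : Type u} [NonUnitalCStarAlgebra C] {D : ℕ → Type u}
  [∀ k, NonUnitalCStarAlgebra (D k)] {Q : Type u} [NonUnitalCStarAlgebra Q]

/-- An element with small image under `ρ k` is close to the kernel of `ρ k`, so `hker` is all that
is needed to recognize a limit of quotients. -/
lemma mem_closure_iUnion_ker_iff {ρ : ∀ k, C →⋆ₙₐ[ℂ] D k} {p : ∀ k, D k →⋆ₙₐ[ℂ] Q}
    {π : C →⋆ₙₐ[ℂ] Q} (hp : ∀ k c, p k (ρ k c) = π c)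
    (hker : ∀ c, π c = 0 → ∀ ε > 0, ∃ k, ‖ρ k c‖ < ε) (c : C) :
    c ∈ closure (⋃ k, (TwoSidedIdeal.ker (ρ k) : Set C)) ↔ π c = 0 := by
  constructor
  · intro hc
    have : closure (⋃ k, (TwoSidedIdeal.ker (ρ k) : Set C)) ⊆ TwoSidedIdeal.ker π := by
      refine closure_minimal (Set.iUnion_subset fun k x hx => ?_) (isClosed_ker π)
      have hx' : ρ k x = 0 := (TwoSidedIdeal.mem_ker (ρ k)).1 hx
      exact (TwoSidedIdeal.mem_ker π).2 (by rw [← hp k, hx', map_zero])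
    exact (TwoSidedIdeal.mem_ker π).1 (this hc)
  · intro hc
    refine Metric.mem_closure_iff.2 fun ε hε => ?_
    obtain ⟨k, hk⟩ := hker c hc (ε / 4) (by positivity)
    obtain ⟨d, hd, hn⟩ := exists_mem_ker_norm_sub_le (ρ k) c hk.le
    exact ⟨d, Set.mem_iUnion.2 ⟨k, (TwoSidedIdeal.mem_ker (ρ k)).2 hd⟩, by
      rw [dist_eq_norm]; linarith⟩

/-- Ranges are closed, hence C*-algebras. Corestricting every map to its range turns the data into
genuine quotient maps. -/
lemma LiftsUpTo.exists_lift_of_separable [TopologicalSpace.SeparableSpace C]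
    {φ : A →⋆ₙₐ[ℂ] B} {S : Set A} {N : Set ℝ} (hφ : LiftsUpTo φ S N)
    (ρ : ∀ k, C →⋆ₙₐ[ℂ] D k) (p : ∀ k, D k →⋆ₙₐ[ℂ] Q) (π : C →⋆ₙₐ[ℂ] Q)
    (hp : ∀ k c, p k (ρ k c) = π c) (hmono : ∀ k c, ρ k c = 0 → ρ (k + 1) c = 0)
    (hker : ∀ c, π c = 0 → ∀ ε > 0, ∃ k, ‖ρ k c‖ < ε)
    (σ : B →⋆ₙₐ[ℂ] Q) (hσ : ∀ b, σ b ∈ Set.range π) :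
    ∃ (k : ℕ) (ψ : A →⋆ₙₐ[ℂ] D k), (∀ a ∈ S, ‖p k (ψ a) - σ (φ a)‖ ∈ N) ∧
      ∀ a, ψ a ∈ Set.range (ρ k) := by
  have (k : ℕ) : IsClosed (NonUnitalStarAlgHom.range (ρ k) : Set (D k)) := isClosed_range (ρ k)
  have : IsClosed (NonUnitalStarAlgHom.range π : Set Q) := isClosed_range π
  let ρ' (k : ℕ) : C →⋆ₙₐ[ℂ] NonUnitalStarAlgHom.range (ρ k) :=
    NonUnitalStarAlgHom.codRestrict (ρ k) _ fun c => ⟨c, rfl⟩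
  let π' : C →⋆ₙₐ[ℂ] NonUnitalStarAlgHom.range π :=
    NonUnitalStarAlgHom.codRestrict π _ fun c => ⟨c, rfl⟩
  let p' (k : ℕ) : NonUnitalStarAlgHom.range (ρ k) →⋆ₙₐ[ℂ] NonUnitalStarAlgHom.range π :=
    NonUnitalStarAlgHom.codRestrict ((p k).comp (NonUnitalStarSubalgebraClass.subtype _)) _ (by
      rintro ⟨_, c, rfl⟩
      exact ⟨c, (hp k c).symm⟩)
  let σ' : B →⋆ₙₐ[ℂ] NonUnitalStarAlgHom.range π := NonUnitalStarAlgHom.codRestrict σ _ hσ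
  have hρ' : ∀ k, Function.Surjective (ρ' k) := by
    rintro k ⟨_, c, rfl⟩
    exact ⟨c, rfl⟩
  have hπ' : Function.Surjective π' := by
    rintro ⟨_, c, rfl⟩
    exact ⟨c, rfl⟩
  have hp' : ∀ k c, p' k (ρ' k c) = π' c := fun k c => Subtype.ext (hp k c)
  have hz : ∀ k c, ρ' k c = 0 ↔ ρ k c = 0 := fun k c => Subtype.ext_iff
  obtain ⟨k, ψ, hψ⟩ := hφ C (fun k => TwoSidedIdeal.ker (ρ' k)) (fun k => isClosed_ker _)
    (monotone_nat_of_le_succ fun k c hc => by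
      have hc' := (TwoSidedIdeal.mem_ker (ρ' k)).1 hc
      exact (TwoSidedIdeal.mem_ker (ρ' (k + 1))).2
        ((hz _ _).2 (hmono k c ((hz _ _).1 hc'))))
    (fun k => NonUnitalStarAlgHom.range (ρ k)) (NonUnitalStarAlgHom.range π) ρ' π' p'
    (fun k => isQuotientBy_ker (hρ' k))
    ⟨hπ', mem_closure_iUnion_ker_iff hp' fun c hc => hker c (congrArg Subtype.val hc)⟩
    (fun k => NonUnitalStarAlgHom.ext (hp' k)) σ'
  exact ⟨k, (NonUnitalStarSubalgebraClass.subtype _).comp ψ, hψ, fun a => (ψ a).2⟩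

/-- Lifting for a codomain that need not be separable and for homomorphisms that need not be
surjective. -/
theorem LiftsUpTo.exists_lift [TopologicalSpace.SeparableSpace B]
    {φ : A →⋆ₙₐ[ℂ] B} {S : Set A} {N : Set ℝ} (hφ : LiftsUpTo φ S N)
    (ρ : ∀ k, C →⋆ₙₐ[ℂ] D k) (p : ∀ k, D k →⋆ₙₐ[ℂ] Q) (π : C →⋆ₙₐ[ℂ] Q)
    (hp : ∀ k c, p k (ρ k c) = π c) (hmono : ∀ k c, ρ k c = 0 → ρ (k + 1) c = 0)
    (hker : ∀ c, π c = 0 → ∀ ε > 0, ∃ k, ‖ρ k c‖ < ε)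
    (σ : B →⋆ₙₐ[ℂ] Q) (hσ : ∀ b, σ b ∈ Set.range π) :
    ∃ (k : ℕ) (ψ : A →⋆ₙₐ[ℂ] D k), (∀ a ∈ S, ‖p k (ψ a) - σ (φ a)‖ ∈ N) ∧
      ∀ a, ψ a ∈ Set.range (ρ k) := by
  obtain ⟨b, hb⟩ := TopologicalSpace.exists_dense_seq B
  -- The closed subalgebra generated by preimages of a dense sequence is separable. Its image is
  -- closed, so it still contains the whole range of `σ`.
  choose c hc using fun i => hσ (b i)
  have := separableSpace_generated (Set.countable_range c)
  let j : generated (Set.range c) →⋆ₙₐ[ℂ] C := NonUnitalStarSubalgebraClass.subtype _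
  have hσ' : ∀ x, σ x ∈ Set.range (π.comp j) := by
    intro x
    have hcl : IsClosed (σ ⁻¹' Set.range (π.comp j)) :=
      (isClosed_range _).preimage (continuous_hom σ)
    have hd : Set.range b ⊆ σ ⁻¹' Set.range (π.comp j) := by
      rintro _ ⟨i, rfl⟩
      exact ⟨⟨c i, subset_generated _ ⟨i, rfl⟩⟩, hc i⟩
    exact closure_minimal hd hcl (hb x)
  obtain ⟨k, ψ, h1, h2⟩ := hφ.exists_lift_of_separable (fun k => (ρ k).comp j) p (π.comp j)
    (fun k c => hp k _) (fun k c => hmono k _) (fun c => hker _) σ hσ'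
  refine ⟨k, ψ, h1, fun a => ?_⟩
  obtain ⟨x, hx⟩ := h2 a
  exact ⟨j x, hx⟩

end
end Semiprojective

/-! ### Bounded products -/

section Product

variable {ι B : Type*} {C : ι → Type*} [NonUnitalCStarAlgebra B]
  [∀ i, NonUnitalCStarAlgebra (C i)]

/-- The homomorphism into the bounded product given by a family of homomorphisms. -/
noncomputable def prodHom (f : ∀ i, B →⋆ₙₐ[ℂ] C i) : B →⋆ₙₐ[ℂ] lp C ∞ where
  toFun b := ⟨fun i => f i b, memℓp_infty ⟨‖b‖, by
    rintro _ ⟨i, rfl⟩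
    exact NonUnitalStarAlgHom.norm_apply_le (f i) b⟩⟩
  map_smul' r b := by ext i; simp
  map_zero' := by ext i; simp
  map_add' a b := by ext i; exact map_add (f i) a b
  map_mul' a b := by ext i; simp
  map_star' b := by ext i; simp [map_star]

@[simp] lemma prodHom_apply (f : ∀ i, B →⋆ₙₐ[ℂ] C i) (b : B) (i : ι) :
    (prodHom f b : ∀ i, C i) i = f i b := rfl

variable (C) in
/-- Evaluation of an element of the bounded product at a coordinate. -/
def coordHom (i : ι) : lp C ∞ →⋆ₙₐ[ℂ] C i where
  toFun x := x i
  map_smul' _ _ := rfl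
  map_zero' := rfl
  map_add' _ _ := rfl
  map_mul' _ _ := rfl
  map_star' _ := rfl

@[simp] lemma coordHom_apply (i : ι) (x : lp C ∞) : coordHom C i x = x i := rfl

end Product

/-! ### From asymptotic morphisms to morphisms -/

section Asymptotic

variable {C : ℕ → Type u} [∀ n, NonUnitalCStarAlgebra (C n)]

open Classical in
/-- The truncation that sets the coordinates below `k` to zero. -/
noncomputable def truncHom (k : ℕ) : lp C ∞ →⋆ₙₐ[ℂ] lp C ∞ :=
  prodHom fun n => if k ≤ n then coordHom C n else 0

lemma truncHom_apply_of_le {k n : ℕ} (h : k ≤ n) (x : lp C ∞) :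
    (truncHom k x : ∀ n, C n) n = x n := by
  simp [truncHom, h]

lemma truncHom_apply_of_lt {k n : ℕ} (h : n < k) (x : lp C ∞) :
    (truncHom k x : ∀ n, C n) n = 0 := by
  simp [truncHom, not_le.2 h]

lemma norm_truncHom_le {k : ℕ} {x : lp C ∞} {r : ℝ} (hr : 0 ≤ r) (h : ∀ n ≥ k, ‖x n‖ ≤ r) :
    ‖truncHom k x‖ ≤ r := by
  refine lp.norm_le_of_forall_le hr fun n => ?_
  rcases le_or_gt k n with hn | hn
  · rw [truncHom_apply_of_le hn]; exact h n hn
  · rw [truncHom_apply_of_lt hn]; simpa using hr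

variable {A B G : Type u} [NonUnitalCStarAlgebra A] [NonUnitalCStarAlgebra B]
  [NonUnitalCStarAlgebra G]

/-- A subalgebra `R` of `(∏ C n) × G` with the norm estimate below is the graph of an asymptotic
homomorphism into the algebras `C n`; along morphisms with a lifting property it can be replaced
by honest homomorphisms. -/
theorem LiftsUpTo.exists_lift_of_asymptotic [TopologicalSpace.SeparableSpace B]
    {φ : A →⋆ₙₐ[ℂ] B} {S : Set A} {N : Set ℝ} (hφ : LiftsUpTo φ S N)
    (R : NonUnitalStarSubalgebra ℂ (lp C ∞ × G)) {K : ℝ} (hK0 : 0 ≤ K)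
    (hK : ∀ z ∈ R, ∀ ε > 0, ∀ᶠ n in atTop, ‖z.1 n‖ ≤ K * ‖z.2‖ + ε)
    (τ : B →⋆ₙₐ[ℂ] G) (hτ : ∀ b, τ b ∈ closure (Prod.snd '' (R : Set (lp C ∞ × G)))) :
    ∃ (k : ℕ) (ψ : A →⋆ₙₐ[ℂ] lp C ∞) (χ : A →⋆ₙₐ[ℂ] G),
      (∀ a ∈ S, ‖χ a - τ (φ a)‖ ∈ N) ∧
      ∀ a, ∃ x, (x, χ a) ∈ closure (R : Set (lp C ∞ × G)) ∧ ∀ n ≥ k, ψ a n = x n := by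
  have hcl : IsClosed (R.topologicalClosure : Set (lp C ∞ × G)) :=
    R.isClosed_topologicalClosure
  let E := R.topologicalClosure
  let j : E →⋆ₙₐ[ℂ] lp C ∞ × G := NonUnitalStarSubalgebraClass.subtype _
  let fstH : lp C ∞ × G →⋆ₙₐ[ℂ] lp C ∞ := NonUnitalStarAlgHom.fst ℂ _ _
  let sndH : lp C ∞ × G →⋆ₙₐ[ℂ] G := NonUnitalStarAlgHom.snd ℂ _ _
  -- The kernel of `ρ k` is the ideal of those `(x, 0)` in `E` for which `x` vanishes from `k` on.
  -- These ideals increase with `k`.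
  let ρ (k : ℕ) : E →⋆ₙₐ[ℂ] lp C ∞ × G :=
    (NonUnitalStarAlgHom.prod ((truncHom k).comp fstH) sndH).comp j
  have hρ1 : ∀ k e, (ρ k e).1 = truncHom k (e : lp C ∞ × G).1 := fun k e => rfl
  have hρ2 : ∀ k e, (ρ k e).2 = (e : lp C ∞ × G).2 := fun k e => rfl
  obtain ⟨k, ψ, h1, h2⟩ := hφ.exists_lift (D := fun _ => lp C ∞ × G) ρ (fun _ => sndH)
    (sndH.comp j) (fun k c => rfl) (by
      intro k e he
      have he1 : truncHom k (e : lp C ∞ × G).1 = 0 := congrArg Prod.fst he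
      refine Prod.ext ?_ (congrArg Prod.snd he :)
      rw [hρ1]
      ext n
      rcases le_or_gt (k + 1) n with hn | hn
      · rw [truncHom_apply_of_le hn, ← truncHom_apply_of_le (by omega : k ≤ n), he1]
        rfl
      · rw [truncHom_apply_of_lt hn]
        rfl) (by
      intro e he ε hε
      have he2 : (e : lp C ∞ × G).2 = 0 := he
      -- The estimate `hK` is known on `R` only. With this tolerance the distance to `z`, the term
      -- `K ‖z.2‖` and the error in `hK` cost at most `ε / 4` each.
      obtain ⟨z, hz, hd⟩ := Metric.mem_closure_iff.1 (show (e : lp C ∞ × G) ∈ closure (R : Set _)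
        from e.2) (ε / (4 * (K + 1))) (by positivity)
      rw [dist_eq_norm] at hd
      have hz1 : ‖(e : lp C ∞ × G).1 - z.1‖ < ε / (4 * (K + 1)) := (norm_fst_le _).trans_lt hd
      have hz2 : ‖(e : lp C ∞ × G).2 - z.2‖ < ε / (4 * (K + 1)) := (norm_snd_le _).trans_lt hd
      rw [he2, zero_sub, norm_neg] at hz2
      obtain ⟨k, hk⟩ := eventually_atTop.1 (hK z hz (ε / 4) (by positivity))
      have hb : ε / (4 * (K + 1)) ≤ ε / 4 := by
        apply div_le_div_of_nonneg_left hε.le (by norm_num); linarith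
      have hb2 : K * ‖z.2‖ ≤ ε / 4 := by
        calc K * ‖z.2‖ ≤ (K + 1) * (ε / (4 * (K + 1))) := by
              apply mul_le_mul (by linarith) hz2.le (norm_nonneg _) (by linarith)
          _ = ε / 4 := by field_simp
      refine ⟨k, ?_⟩
      have h3 : ‖truncHom k (e : lp C ∞ × G).1‖ ≤ 3 * ε / 4 := by
        refine norm_truncHom_le (by positivity) fun n hn => ?_
        have := lp.norm_apply_le_norm (by simp) ((e : lp C ∞ × G).1 - z.1) n
        have h4 : ‖(e : lp C ∞ × G).1 n‖ ≤ ‖((e : lp C ∞ × G).1 - z.1) n‖ + ‖z.1 n‖ := by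
          have := norm_add_le (((e : lp C ∞ × G).1 - z.1) n) (z.1 n)
          simpa using this
        have := hk n hn
        linarith
      rw [Prod.norm_def, hρ1, hρ2, he2, norm_zero]
      refine max_lt (by linarith) hε) τ (by
      intro b
      have h3 : closure (Prod.snd '' (R : Set (lp C ∞ × G))) ⊆ Set.range (sndH.comp j) := by
        refine closure_minimal ?_ (isClosed_range _)
        rintro _ ⟨z, hz, rfl⟩
        exact ⟨⟨z, R.le_topologicalClosure hz⟩, rfl⟩
      exact h3 (hτ b))
  refine ⟨k, fstH.comp ψ, sndH.comp ψ, h1, fun a => ?_⟩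
  obtain ⟨e, he⟩ := h2 a
  refine ⟨(e : lp C ∞ × G).1, ?_, fun n hn => ?_⟩
  · have : (sndH.comp ψ) a = (e : lp C ∞ × G).2 := (congrArg Prod.snd he).symm
    rw [this]
    exact e.2
  · have : (fstH.comp ψ) a = truncHom k (e : lp C ∞ × G).1 := (congrArg Prod.fst he).symm
    rw [this, truncHom_apply_of_le hn]

/-- The constraints `π n (x n) = σ n g` are closed conditions, so they pass from `R` to its closure.
The coordinate `k` of the lift then satisfies its constraint exactly. -/
theorem SemiprojectiveHom.exists_lift_of_asymptotic [TopologicalSpace.SeparableSpace B]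
    {φ : A →⋆ₙₐ[ℂ] B} (hφ : SemiprojectiveHom φ)
    (R : NonUnitalStarSubalgebra ℂ (lp C ∞ × G)) {K : ℝ} (hK0 : 0 ≤ K)
    (hK : ∀ z ∈ R, ∀ ε > 0, ∀ᶠ n in atTop, ‖z.1 n‖ ≤ K * ‖z.2‖ + ε)
    (τ : B →⋆ₙₐ[ℂ] G) (hτ : ∀ b, τ b ∈ closure (Prod.snd '' (R : Set (lp C ∞ × G))))
    {Q : ℕ → Type*} [∀ n, NonUnitalCStarAlgebra (Q n)] (π : ∀ n, C n →⋆ₙₐ[ℂ] Q n)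
    (σ : ∀ n, G →⋆ₙₐ[ℂ] Q n) (hπ : ∀ z ∈ R, ∀ n, π n (z.1 n) = σ n z.2) :
    ∃ (n : ℕ) (ψ : A →⋆ₙₐ[ℂ] C n), ∀ a, π n (ψ a) = σ n (τ (φ a)) := by
  obtain ⟨k, ψ, χ, h1, h2⟩ := hφ.liftsUpTo.exists_lift_of_asymptotic R hK0 hK τ hτ
  refine ⟨k, (coordHom C k).comp ψ, fun a => ?_⟩
  obtain ⟨x, hx, hxn⟩ := h2 a
  have hχ : χ a = τ (φ a) := by
    have := h1 a (Set.mem_univ a)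
    exact sub_eq_zero.1 (norm_eq_zero.1 this)
  have hc : closure (R : Set (lp C ∞ × G)) ⊆ {z | π k (z.1 k) = σ k z.2} := by
    refine closure_minimal (fun z hz => hπ z hz k) (isClosed_eq ?_ ?_)
    · exact (continuous_hom ((π k).comp (coordHom C k))).comp continuous_fst
    · exact (continuous_hom (σ k)).comp continuous_snd
  have := hc hx
  change π k (x k) = σ k (χ a) at this
  rw [← hχ, ← this, ← hxn k le_rfl]
  rfl

end Asymptotic

/-! ### Homotopies and path algebras -/

section Homotopy

variable {A B D : Type u} [NonUnitalCStarAlgebra A] [NonUnitalCStarAlgebra B]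
  [NonUnitalCStarAlgebra D]

lemma Homotopic.refl (φ : A →⋆ₙₐ[ℂ] B) : Homotopic φ φ :=
  ⟨fun _ => φ, fun _ => continuous_const, rfl, rfl⟩

lemma Homotopic.symm {φ ψ : A →⋆ₙₐ[ℂ] B} (h : Homotopic φ ψ) : Homotopic ψ φ := by
  obtain ⟨H, hc, h0, h1⟩ := h
  exact ⟨fun t => H (unitInterval.symm t), fun a => (hc a).comp unitInterval.continuous_symm,
    by simp [h1], by simp [h0]⟩

lemma Homotopic.trans {φ ψ χ : A →⋆ₙₐ[ℂ] B} (h : Homotopic φ ψ) (h' : Homotopic ψ χ) :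
    Homotopic φ χ := by
  obtain ⟨H, hc, h0, h1⟩ := h
  obtain ⟨H', hc', h0', h1'⟩ := h'
  let F : ℝ → (A →⋆ₙₐ[ℂ] B) := fun t => if t ≤ 1 / 2
    then H (Set.projIcc 0 1 zero_le_one (2 * t)) else H' (Set.projIcc 0 1 zero_le_one (2 * t - 1))
  refine ⟨fun t => F t, fun a => ?_, ?_, ?_⟩
  · have : Continuous fun t : ℝ => F t a := by
      have hF : (fun t : ℝ => F t a) = fun t : ℝ => if t ≤ 1 / 2
          then H (Set.projIcc 0 1 zero_le_one (2 * t)) a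
          else H' (Set.projIcc 0 1 zero_le_one (2 * t - 1)) a := by
        funext t
        simp only [F]
        split_ifs <;> rfl
      rw [hF]
      refine Continuous.if_le ((hc a).comp (continuous_projIcc.comp (by fun_prop)))
        ((hc' a).comp (continuous_projIcc.comp (by fun_prop))) continuous_id continuous_const ?_
      rintro t rfl
      have e1 : Set.projIcc (0 : ℝ) 1 zero_le_one (2 * (1 / 2)) = 1 := by
        norm_num
      have e2 : Set.projIcc (0 : ℝ) 1 zero_le_one (2 * (1 / 2) - 1) = 0 := by
        norm_num
      rw [e1, e2, h1, h0']
    exact this.comp continuous_subtype_val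
  · have e : Set.projIcc (0 : ℝ) 1 zero_le_one (2 * 0) = 0 := by norm_num
    simp [F, -mul_zero, e, h0]
  · have e : Set.projIcc (0 : ℝ) 1 zero_le_one (2 * 1 - 1) = 1 := by norm_num
    have : ¬ ((1 : ℝ) ≤ 1 / 2) := by norm_num
    change (if (1 : ℝ) ≤ 1 / 2 then _ else _) = χ
    rw [if_neg this, Set.Icc.coe_one, e, h1']

lemma Homotopic.comp_left {φ ψ : A →⋆ₙₐ[ℂ] B} (h : Homotopic φ ψ) (χ : B →⋆ₙₐ[ℂ] D) :
    Homotopic (χ.comp φ) (χ.comp ψ) := by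
  obtain ⟨H, hc, rfl, rfl⟩ := h
  exact ⟨fun t => χ.comp (H t), fun a => (continuous_hom χ).comp (hc a), rfl, rfl⟩

lemma Homotopic.comp_right {φ ψ : B →⋆ₙₐ[ℂ] D} (h : Homotopic φ ψ) (χ : A →⋆ₙₐ[ℂ] B) :
    Homotopic (φ.comp χ) (ψ.comp χ) := by
  obtain ⟨H, hc, rfl, rfl⟩ := h
  exact ⟨fun t => (H t).comp χ, fun a => hc (χ a), rfl, rfl⟩

/-- Evaluation of paths. -/
def evalHom (B : Type u) [NonUnitalCStarAlgebra B] (t : unitInterval) :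
    C(unitInterval, B) →⋆ₙₐ[ℂ] B where
  toFun f := f t
  map_smul' _ _ := rfl
  map_zero' := rfl
  map_add' _ _ := rfl
  map_mul' _ _ := rfl
  map_star' _ := rfl

@[simp] lemma evalHom_apply (t : unitInterval) (f : C(unitInterval, B)) : evalHom B t f = f t :=
  rfl

/-- A homotopy as a homomorphism into the algebra of paths. -/
def pathHom (H : unitInterval → (A →⋆ₙₐ[ℂ] B)) (hc : ∀ a, Continuous fun t => H t a) :
    A →⋆ₙₐ[ℂ] C(unitInterval, B) where
  toFun a := ⟨fun t => H t a, hc a⟩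
  map_smul' r a := by ext t; simp
  map_zero' := by ext t; simp
  map_add' a b := by ext t; simp
  map_mul' a b := by ext t; simp
  map_star' a := by ext t; simp [map_star]

@[simp] lemma pathHom_apply (H : unitInterval → (A →⋆ₙₐ[ℂ] B))
    (hc : ∀ a, Continuous fun t => H t a) (a : A) (t : unitInterval) :
    pathHom H hc a t = H t a := rfl

lemma homotopic_of_path (ψ : A →⋆ₙₐ[ℂ] C(unitInterval, B)) :
    Homotopic ((evalHom B 0).comp ψ) ((evalHom B 1).comp ψ) :=
  ⟨fun t => (evalHom B t).comp ψ, fun a => (ψ a).continuous, rfl, rfl⟩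

end Homotopy

/-! ### Connecting maps of inductive systems -/

namespace InductiveSystem

variable (S : InductiveSystem.{u})

lemma trans_self (k : ℕ) : S.trans (le_refl k) = NonUnitalStarAlgHom.id ℂ (S.obj k) :=
  Nat.leRecOn_self _

lemma trans_succ {k l : ℕ} (h : k ≤ l) (h' : k ≤ l + 1) :
    S.trans h' = (S.map l).comp (S.trans h) :=
  Nat.leRecOn_succ h _

lemma trans_trans {k l m : ℕ} (h : k ≤ l) (h' : l ≤ m) :
    S.trans (h.trans h') = (S.trans h').comp (S.trans h) := by
  induction m, h' using Nat.le_induction with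
  | base => rw [trans_self]; rfl
  | succ m hm ih => rw [S.trans_succ (h.trans hm), S.trans_succ hm, ih]; rfl

lemma trans_trans_apply {k l m : ℕ} (h : k ≤ l) (h' : l ≤ m) (a : S.obj k) :
    S.trans h' (S.trans h a) = S.trans (h.trans h') a :=
  (DFunLike.congr_fun (S.trans_trans h h') a).symm

lemma trans_succ_self (k : ℕ) : S.trans (Nat.le_succ k) = S.map k := by
  rw [S.trans_succ (le_refl k), trans_self]; rfl

variable {S} {A : Type u} [NonUnitalCStarAlgebra A] {ι : ∀ k, S.obj k →⋆ₙₐ[ℂ] A}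

lemma IsLimit.comp_trans (h : S.IsLimit A ι) {k l : ℕ} (hkl : k ≤ l) :
    (ι l).comp (S.trans hkl) = ι k := by
  induction l, hkl using Nat.le_induction with
  | base => rw [trans_self]; rfl
  | succ l hl ih =>
    rw [S.trans_succ hl, ← ih, ← h.compat l]; rfl

lemma IsLimit.apply_trans (h : S.IsLimit A ι) {k l : ℕ} (hkl : k ≤ l) (a : S.obj k) :
    ι l (S.trans hkl a) = ι k a :=
  DFunLike.congr_fun (h.comp_trans hkl) a

lemma IsLimit.eventually_norm_trans_le (h : S.IsLimit A ι) (k : ℕ) (a : S.obj k) {ε : ℝ}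
    (hε : 0 < ε) : ∀ᶠ n in atTop, ∀ hn : k ≤ n, ‖S.trans hn a‖ ≤ ‖ι k a‖ + ε := by
  have h1 := (h.norm_tendsto k a).eventually (gt_mem_nhds (lt_add_of_pos_right _ hε))
  obtain ⟨m, hm⟩ := eventually_atTop.1 h1
  refine eventually_atTop.2 ⟨k + m, fun n hn hkn => ?_⟩
  obtain ⟨i, rfl⟩ := Nat.exists_eq_add_of_le hkn
  exact (hm i (by omega)).le

end InductiveSystem

/-! ### Null homotopies in shape systems of the zero algebra -/

section

variable {S : InductiveSystem.{u}}

lemma tendsto_norm_zero_mul {C : ℕ → Type*} [∀ n, NonUnitalCStarAlgebra (C n)] {x y : lp C ∞}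
    (hx : Tendsto (fun n => ‖x n‖) atTop (𝓝 0)) :
    Tendsto (fun n => ‖(x * y) n‖) atTop (𝓝 0) := by
  have : Tendsto (fun n => ‖x n‖ * ‖y‖) atTop (𝓝 0) := by simpa using hx.mul_const ‖y‖
  refine squeeze_zero (fun _ => norm_nonneg _) (fun n => ?_) this
  exact (norm_mul_le _ _).trans
    (mul_le_mul_of_nonneg_left (lp.norm_apply_le_norm (by simp) y n) (norm_nonneg _))

lemma tendsto_norm_zero_mul' {C : ℕ → Type*} [∀ n, NonUnitalCStarAlgebra (C n)] {x y : lp C ∞}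
    (hy : Tendsto (fun n => ‖y n‖) atTop (𝓝 0)) :
    Tendsto (fun n => ‖(x * y) n‖) atTop (𝓝 0) := by
  have : Tendsto (fun n => ‖x‖ * ‖y n‖) atTop (𝓝 0) := by simpa using hy.const_mul ‖x‖
  refine squeeze_zero (fun _ => norm_nonneg _) (fun n => ?_) this
  exact (norm_mul_le _ _).trans
    (mul_le_mul_of_nonneg_right (lp.norm_apply_le_norm (by simp) x n) (norm_nonneg _))

lemma tendsto_norm_zero_add {C : ℕ → Type*} [∀ n, NonUnitalCStarAlgebra (C n)] {x y : lp C ∞}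
    (hx : Tendsto (fun n => ‖x n‖) atTop (𝓝 0)) (hy : Tendsto (fun n => ‖y n‖) atTop (𝓝 0)) :
    Tendsto (fun n => ‖(x + y) n‖) atTop (𝓝 0) :=
  squeeze_zero (fun _ => norm_nonneg _) (fun n => norm_add_le (x n) (y n))
    (by simpa using hx.add hy)

lemma tendsto_norm_zero_smul {C : ℕ → Type*} [∀ n, NonUnitalCStarAlgebra (C n)] {x : lp C ∞} (r : ℂ)
    (hx : Tendsto (fun n => ‖x n‖) atTop (𝓝 0)) :
    Tendsto (fun n => ‖(r • x) n‖) atTop (𝓝 0) := by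
  have : (fun n => ‖(r • x) n‖) = fun n => ‖r‖ * ‖x n‖ := funext fun n => norm_smul r (x n)
  rw [this]
  simpa using hx.const_mul ‖r‖

/-- The null sequences of paths over the identity of `S.obj m`, starting at the connecting maps
and ending at zero. -/
def nullPaths (S : InductiveSystem.{u}) (m : ℕ) : NonUnitalStarSubalgebra ℂ
    (lp (fun j => C(unitInterval, S.obj (m + j))) ∞ × S.obj m) where
  carrier := {z | (∀ j, z.1 j 0 = S.trans (Nat.le_add_right m j) z.2 ∧ z.1 j 1 = 0) ∧
    Tendsto (fun j => ‖z.1 j‖) atTop (𝓝 0)}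
  add_mem' := by
    rintro a b ⟨ha, ha'⟩ ⟨hb, hb'⟩
    refine ⟨fun j => ⟨?_, ?_⟩, tendsto_norm_zero_add ha' hb'⟩
    · change a.1 j 0 + b.1 j 0 = S.trans _ (a.2 + b.2)
      rw [(ha j).1, (hb j).1, map_add]
    · change a.1 j 1 + b.1 j 1 = 0
      rw [(ha j).2, (hb j).2, add_zero]
  zero_mem' := by
    refine ⟨fun j => ⟨?_, rfl⟩, ?_⟩
    · change (0 : S.obj (m + j)) = S.trans _ 0
      rw [map_zero]
    · change Tendsto (fun j => ‖(0 : C(unitInterval, S.obj (m + j)))‖) atTop (𝓝 0)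
      simp
  mul_mem' := by
    rintro a b ⟨ha, ha'⟩ ⟨hb, hb'⟩
    refine ⟨fun j => ⟨?_, ?_⟩, tendsto_norm_zero_mul ha'⟩
    · change a.1 j 0 * b.1 j 0 = S.trans _ (a.2 * b.2)
      rw [(ha j).1, (hb j).1, map_mul]
    · change a.1 j 1 * b.1 j 1 = 0
      rw [(ha j).2, zero_mul]
  smul_mem' := by
    rintro r a ⟨ha, ha'⟩
    refine ⟨fun j => ⟨?_, ?_⟩, tendsto_norm_zero_smul r ha'⟩
    · change r • a.1 j 0 = S.trans _ (r • a.2)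
      rw [(ha j).1, map_smul]
    · change r • a.1 j 1 = 0
      rw [(ha j).2, smul_zero]
  star_mem' := by
    rintro a ⟨ha, ha'⟩
    refine ⟨fun j => ⟨?_, ?_⟩, ?_⟩
    · change star (a.1 j 0) = S.trans _ (star a.2)
      rw [(ha j).1, map_star]
    · change star (a.1 j 1) = 0
      rw [(ha j).2, star_zero]
    · exact ha'.congr fun j => (norm_star (a.1 j)).symm

/-- In a shape system of the zero algebra the connecting morphisms are eventually
null-homotopic. -/
lemma exists_nullHomotopic_of_zero (hS : S.IsShapeSystem PUnit.{u + 1}) (k : ℕ) :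
    ∃ l, ∃ h : k ≤ l, Homotopic (S.trans h) 0 := by
  obtain ⟨⟨ι, hι⟩, hsp⟩ := hS
  have hnull (m : ℕ) (y : S.obj m) :
      Tendsto (fun j => ‖S.trans (Nat.le_add_right m j) y‖) atTop (𝓝 0) := by
    have := hι.norm_tendsto m y
    rwa [show ‖ι m y‖ = 0 from norm_eq_zero.2 (Subsingleton.elim _ _)] at this
  -- All first components are null sequences, so `K = 0` works. The auxiliary algebras `Q j` record
  -- both endpoints of a path.
  obtain ⟨n, ψ, hψ⟩ := (hsp k).exists_lift_of_asymptotic (nullPaths S (k + 1)) (K := 0) le_rfl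
    (fun z hz ε hε => by
      filter_upwards [hz.2.eventually (gt_mem_nhds hε)] with n hn
      simpa using hn.le)
    (NonUnitalStarAlgHom.id ℂ _)
    -- The straight segment to zero is not multiplicative in `y`, but only one null sequence over
    -- each `y` is needed. Its norms tend to zero because the limit algebra is zero.
    (fun y => by
      let g (j : ℕ) : C(unitInterval, S.obj (k + 1 + j)) :=
        ⟨fun t => ((1 - (t : ℝ) : ℝ) : ℂ) • S.trans (Nat.le_add_right (k + 1) j) y, by fun_prop⟩
      have hg (j : ℕ) : ‖g j‖ ≤ ‖S.trans (Nat.le_add_right (k + 1) j) y‖ := by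
        refine (ContinuousMap.norm_le _ (norm_nonneg _)).2 fun t => ?_
        change ‖((1 - (t : ℝ) : ℝ) : ℂ) • S.trans (Nat.le_add_right (k + 1) j) y‖ ≤ _
        rw [norm_smul, Complex.norm_real]
        refine mul_le_of_le_one_left (norm_nonneg _) ?_
        rw [Real.norm_eq_abs, abs_le]
        constructor <;> linarith [t.2.1, t.2.2]
      refine subset_closure ⟨⟨⟨g, memℓp_infty ⟨‖y‖, ?_⟩⟩, y⟩, ⟨fun j => ⟨?_, ?_⟩, ?_⟩, rfl⟩
      · rintro _ ⟨j, rfl⟩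
        exact (hg j).trans (NonUnitalStarAlgHom.norm_apply_le _ _)
      · change ((1 - ((0 : unitInterval) : ℝ) : ℝ) : ℂ) • S.trans _ y = _
        simp
      · change ((1 - ((1 : unitInterval) : ℝ) : ℝ) : ℂ) • S.trans _ y = _
        simp
      · exact squeeze_zero (fun _ => norm_nonneg _) hg (hnull _ y))
    (Q := fun j => S.obj (k + 1 + j) × S.obj (k + 1 + j))
    (fun j => NonUnitalStarAlgHom.prod (evalHom _ 0) (evalHom _ 1))
    (fun j => NonUnitalStarAlgHom.prod (S.trans (Nat.le_add_right (k + 1) j)) 0)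
    (fun z hz n => Prod.ext (hz.1 n).1 (hz.1 n).2)
  refine ⟨k + 1 + n, by omega, ?_⟩
  have h := homotopic_of_path ψ
  have e0 : (evalHom _ 0).comp ψ = S.trans (by omega : k ≤ k + 1 + n) := by
    rw [S.trans_trans (Nat.le_succ k) (Nat.le_add_right (k + 1) n), S.trans_succ_self]
    exact NonUnitalStarAlgHom.ext fun a => congrArg Prod.fst (hψ a)
  have e1 : (evalHom _ 1).comp ψ = 0 :=
    NonUnitalStarAlgHom.ext fun a => congrArg Prod.snd (hψ a)
  rwa [e0, e1] at h

end

/-! ### Approximate maps into the algebras of an inductive system -/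

section Telescope

/-- The sequences that are eventually coherent in an inductive system, paired with their limit. -/
def coherentSequences {S : InductiveSystem.{u}} {A : Type u} [NonUnitalCStarAlgebra A]
    {ι : ∀ k, S.obj k →⋆ₙₐ[ℂ] A} (hι : S.IsLimit A ι) :
    NonUnitalStarSubalgebra ℂ (lp S.obj ∞ × A) where
  carrier := {z | ∃ k b, z.2 = ι k b ∧ ∀ n (h : k ≤ n), z.1 n = S.trans h b}
  add_mem' := by
    rintro x y ⟨k, b, hb, hb'⟩ ⟨l, c, hc, hc'⟩
    refine ⟨max k l, S.trans (le_max_left _ _) b + S.trans (le_max_right _ _) c, ?_, fun n h => ?_⟩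
    · rw [map_add, hι.apply_trans, hι.apply_trans, ← hb, ← hc]; rfl
    · rw [map_add, S.trans_trans_apply, S.trans_trans_apply,
        ← hb' n ((le_max_left _ _).trans h), ← hc' n ((le_max_right _ _).trans h)]
      rfl
  zero_mem' := ⟨0, 0, by simp, fun n h => by simp⟩
  mul_mem' := by
    rintro x y ⟨k, b, hb, hb'⟩ ⟨l, c, hc, hc'⟩
    refine ⟨max k l, S.trans (le_max_left _ _) b * S.trans (le_max_right _ _) c, ?_, fun n h => ?_⟩
    · rw [map_mul, hι.apply_trans, hι.apply_trans, ← hb, ← hc]; rfl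
    · rw [map_mul, S.trans_trans_apply, S.trans_trans_apply,
        ← hb' n ((le_max_left _ _).trans h), ← hc' n ((le_max_right _ _).trans h)]
      rfl
  smul_mem' := by
    rintro r x ⟨k, b, hb, hb'⟩
    refine ⟨k, r • b, ?_, fun n h => ?_⟩
    · rw [map_smul, ← hb]; rfl
    · rw [map_smul, ← hb' n h]; rfl
  star_mem' := by
    rintro x ⟨k, b, hb, hb'⟩
    refine ⟨k, star b, ?_, fun n h => ?_⟩
    · rw [map_star, ← hb]; rfl
    · rw [map_star, ← hb' n h]; rfl

open Classical in
/-- A weakly semiprojective inductive limit maps approximately into the approximating algebras. -/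
lemma exists_approx_section {S : InductiveSystem.{u}} {A : Type u} [NonUnitalCStarAlgebra A]
    [TopologicalSpace.SeparableSpace A] {ι : ∀ k, S.obj k →⋆ₙₐ[ℂ] A} (hι : S.IsLimit A ι)
    (hA : IsWeaklySemiprojective A) (F : Finset A) {ε : ℝ} (hε : 0 < ε) :
    ∃ (n : ℕ) (ψ : A →⋆ₙₐ[ℂ] S.obj n), ∀ a ∈ F, ‖ι n (ψ a) - a‖ < ε := by
  obtain ⟨k, ψ, χ, h1, h2⟩ := (hA.liftsUpTo F (half_pos hε)).exists_lift_of_asymptotic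
    (coherentSequences hι) zero_le_one
    (fun z hz ε hε => by
      obtain ⟨k, b, hb, hb'⟩ := hz
      filter_upwards [hι.eventually_norm_trans_le k b hε, eventually_ge_atTop k] with n hn hkn
      rw [hb' n hkn, hb, one_mul]
      exact hn hkn) (NonUnitalStarAlgHom.id ℂ A)
    (fun a => by
      refine closure_mono ?_ (hι.dense a)
      rintro _ ⟨_, ⟨k, rfl⟩, b, rfl⟩
      refine ⟨(prodHom (fun n => if h : k ≤ n then S.trans h else 0) b, ι k b),
        ⟨k, b, rfl, fun n h => ?_⟩, rfl⟩
      simp [h])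
  -- A coherent sequence eventually maps exactly to its limit. On the closure this survives as
  -- convergence, because every `ι n` is contractive.
  have hcl (z : lp S.obj ∞ × A) (hz : z ∈ closure (coherentSequences hι : Set (lp S.obj ∞ × A)))
      {δ : ℝ} (hδ : 0 < δ) : ∀ᶠ n in atTop, ‖ι n (z.1 n) - z.2‖ < δ := by
    obtain ⟨y, ⟨k, b, hb, hb'⟩, hy⟩ := Metric.mem_closure_iff.1 hz (δ / 2) (half_pos hδ)
    rw [dist_eq_norm] at hy
    filter_upwards [eventually_ge_atTop k] with n hn
    have hy1 : ‖(z.1 - y.1) n‖ ≤ ‖z - y‖ :=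
      (lp.norm_apply_le_norm (by simp) (z.1 - y.1) n).trans (norm_fst_le (z - y))
    have hy2 : ‖z.2 - y.2‖ ≤ ‖z - y‖ := norm_snd_le (z - y)
    have hι1 : ‖ι n ((z.1 - y.1) n)‖ ≤ ‖(z.1 - y.1) n‖ := NonUnitalStarAlgHom.norm_apply_le _ _
    have e : ι n (z.1 n) - z.2 = ι n ((z.1 - y.1) n) - (z.2 - y.2) := by
      change _ = ι n (z.1 n - y.1 n) - _
      rw [map_sub, hb' n hn, hι.apply_trans, hb]
      abel
    rw [e]
    exact (norm_sub_le _ _).trans_lt (by linarith)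
  have hev : ∀ᶠ n in atTop, ∀ a ∈ F, ‖ι n (ψ a n) - χ a‖ < ε / 2 := by
    refine (Finset.eventually_all F).2 fun a _ => ?_
    obtain ⟨x, hx, hx'⟩ := h2 a
    filter_upwards [hcl _ hx (half_pos hε), eventually_ge_atTop k] with n hn hkn
    rwa [hx' n hkn]
  obtain ⟨n, hn⟩ := hev.exists
  refine ⟨n, (coordHom S.obj n).comp ψ, fun a ha => ?_⟩
  have hχ : ‖χ a - a‖ < ε / 2 := h1 a ha
  have := norm_add_le (ι n (ψ a n) - χ a) (χ a - a)
  rw [sub_add_sub_cancel] at this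
  exact this.trans_lt (by linarith [hn a ha])

end Telescope

/-! ### Approximate lifts and exact lifts -/

section WeaklyProjective

variable {A : Type u} [NonUnitalCStarAlgebra A]

/-- The graph of the asymptotic homomorphism given by a sequence of approximate lifts. -/
def approxLifts {C Q : Type u} [NonUnitalCStarAlgebra C] [NonUnitalCStarAlgebra Q]
    (π : C →⋆ₙₐ[ℂ] Q) (σ : A →⋆ₙₐ[ℂ] Q) (ψ : ℕ → (A →⋆ₙₐ[ℂ] C)) :
    NonUnitalStarSubalgebra ℂ (lp (fun _ : ℕ => C) ∞ × A) where
  carrier := {z | (∀ n, π (z.1 n) = σ z.2) ∧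
    Tendsto (fun n => ‖(z.1 - prodHom ψ z.2) n‖) atTop (𝓝 0)}
  add_mem' := by
    rintro x y ⟨hx, hx'⟩ ⟨hy, hy'⟩
    refine ⟨fun n => ?_, ?_⟩
    · change π (x.1 n + y.1 n) = σ (x.2 + y.2)
      rw [map_add, map_add, hx, hy]
    · have e : (x + y).1 - prodHom ψ (x + y).2 =
          (x.1 - prodHom ψ x.2) + (y.1 - prodHom ψ y.2) := by
        rw [Prod.fst_add, Prod.snd_add, map_add]; abel
      rw [e]
      exact tendsto_norm_zero_add hx' hy'
  zero_mem' := by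
    refine ⟨fun n => ?_, ?_⟩
    · change π 0 = σ 0
      simp
    · rw [Prod.fst_zero, Prod.snd_zero, map_zero, sub_zero]
      change Tendsto (fun n => ‖(0 : C)‖) atTop (𝓝 0)
      simp
  mul_mem' := by
    rintro x y ⟨hx, hx'⟩ ⟨hy, hy'⟩
    refine ⟨fun n => ?_, ?_⟩
    · change π (x.1 n * y.1 n) = σ (x.2 * y.2)
      rw [map_mul, map_mul, hx, hy]
    · have e : (x * y).1 - prodHom ψ (x * y).2 =
          (x.1 - prodHom ψ x.2) * y.1 + prodHom ψ x.2 * (y.1 - prodHom ψ y.2) := by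
        rw [Prod.fst_mul, Prod.snd_mul, map_mul, sub_mul, mul_sub]; abel
      rw [e]
      exact tendsto_norm_zero_add (tendsto_norm_zero_mul hx') (tendsto_norm_zero_mul' hy')
  smul_mem' := by
    rintro r x ⟨hx, hx'⟩
    refine ⟨fun n => ?_, ?_⟩
    · change π (r • x.1 n) = σ (r • x.2)
      rw [map_smul, map_smul, hx]
    · have e : (r • x).1 - prodHom ψ (r • x).2 = r • (x.1 - prodHom ψ x.2) := by
        rw [Prod.smul_fst, Prod.smul_snd, map_smul, smul_sub]
      rw [e]
      exact tendsto_norm_zero_smul r hx'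
  star_mem' := by
    rintro x ⟨hx, hx'⟩
    refine ⟨fun n => ?_, ?_⟩
    · change π (star (x.1 n)) = σ (star x.2)
      rw [map_star, map_star, hx]
    · have e : (star x).1 - prodHom ψ (star x).2 = star (x.1 - prodHom ψ x.2) := by
        rw [Prod.fst_star, Prod.snd_star, map_star, star_sub]
      rw [e]
      exact hx'.congr fun n => (norm_star ((x.1 - prodHom ψ x.2) n)).symm

/-- Ask for tolerance `1/(n+1)` on the first `n` terms of a dense sequence; contractivity extends
the convergence to every element. -/
lemma IsWeaklyProjective.exists_seq [TopologicalSpace.SeparableSpace A] {C Q : Type u}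
    [NonUnitalCStarAlgebra C] [TopologicalSpace.SeparableSpace C] [NonUnitalCStarAlgebra Q]
    (hA : IsWeaklyProjective A) {π : C →⋆ₙₐ[ℂ] Q} (hπ : Function.Surjective π)
    (σ : A →⋆ₙₐ[ℂ] Q) :
    ∃ ψ : ℕ → (A →⋆ₙₐ[ℂ] C), ∀ a, Tendsto (fun n => ‖σ a - π (ψ n a)‖) atTop (𝓝 0) := by
  classical
  obtain ⟨d, hd⟩ := TopologicalSpace.exists_dense_seq A
  have h (n : ℕ) : ∃ ψ : A →⋆ₙₐ[ℂ] C, ∀ i < n, ‖π (ψ (d i)) - σ (d i)‖ < 1 / ((n : ℝ) + 1) := by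
    obtain ⟨ψ, hψ⟩ := hA C Q (TwoSidedIdeal.ker π) π (isClosed_ker π) (isQuotientBy_ker hπ) σ
      (1 / ((n : ℝ) + 1)) ((Finset.range n).image d) (by positivity)
    exact ⟨ψ, fun i hi => hψ _ (Finset.mem_image_of_mem _ (Finset.mem_range.2 hi))⟩
  choose ψ hψ using h
  refine ⟨ψ, fun a => ?_⟩
  rw [Metric.tendsto_atTop]
  intro ε hε
  obtain ⟨_, ⟨i, rfl⟩, hi⟩ := Metric.mem_closure_iff.1 (hd a) (ε / 3) (by positivity)
  rw [dist_eq_norm] at hi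
  obtain ⟨m, hm⟩ := exists_nat_one_div_lt (show (0 : ℝ) < ε / 3 by positivity)
  refine ⟨max m (i + 1), fun n hn => ?_⟩
  have h1 := hψ n i (by have := le_max_right m (i + 1); omega)
  have h2 : 1 / ((n : ℝ) + 1) ≤ 1 / ((m : ℝ) + 1) :=
    one_div_le_one_div_of_le (by positivity) (by
      have : (m : ℝ) ≤ n := by exact_mod_cast (le_max_left _ _).trans hn
      linarith)
  have h3 : ‖σ (a - d i)‖ ≤ ‖a - d i‖ := NonUnitalStarAlgHom.norm_apply_le _ _
  have h4 : ‖π (ψ n (a - d i))‖ ≤ ‖a - d i‖ :=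
    NonUnitalStarAlgHom.norm_apply_le (π.comp (ψ n)) _
  have e : σ a - π (ψ n a) = σ (a - d i) - (π (ψ n (d i)) - σ (d i)) - π (ψ n (a - d i)) := by
    simp only [map_sub]; abel
  rw [dist_zero_right, norm_norm, e]
  have h5 := norm_sub_le (σ (a - d i) - (π (ψ n (d i)) - σ (d i))) (π (ψ n (a - d i)))
  have h6 := norm_sub_le (σ (a - d i)) (π (ψ n (d i)) - σ (d i))
  linarith

/-- For each `a` the error `σ a - π (ψ n a)` tends to zero and has preimages of at most twice its
norm. Adding these to `ψ n a` gives exact lifts of `σ a`, multiplicative only asymptotically.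
Semiprojectivity replaces them by a morphism that still lifts exactly. -/
theorem IsWeaklyProjective.isProjective [TopologicalSpace.SeparableSpace A]
    (hA : IsWeaklyProjective A) (hA' : IsSemiprojective A) : IsProjective A := by
  intro C Q _ _ _ J π hJ hπ σ
  obtain ⟨ψ, hψ⟩ := hA.exists_seq hπ.surjective σ
  obtain ⟨n, χ, hχ⟩ := hA'.exists_lift_of_asymptotic (approxLifts π σ ψ) zero_le_one
    (fun z hz ε hε => by
      filter_upwards [hz.2.eventually (gt_mem_nhds hε)] with n hn
      have h1 : ‖ψ n z.2‖ ≤ ‖z.2‖ := NonUnitalStarAlgHom.norm_apply_le _ _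
      have h2 : ‖z.1 n - ψ n z.2‖ < ε := hn
      have h3 := norm_add_le (z.1 n - ψ n z.2) (ψ n z.2)
      rw [sub_add_cancel] at h3
      linarith)
    (NonUnitalStarAlgHom.id ℂ A)
    (fun a => by
      choose d hd hd' using fun n =>
        exists_preimage_norm_le π (hπ.surjective (σ a - π (ψ n a)))
      have hb (n : ℕ) : ‖d n‖ ≤ 4 * ‖a‖ := by
        have h1 : ‖σ a‖ ≤ ‖a‖ := NonUnitalStarAlgHom.norm_apply_le _ _
        have h2 : ‖π (ψ n a)‖ ≤ ‖a‖ := NonUnitalStarAlgHom.norm_apply_le (π.comp (ψ n)) _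
        have := norm_sub_le (σ a) (π (ψ n a))
        linarith [hd' n]
      let D : lp (fun _ : ℕ => C) ∞ := ⟨d, memℓp_infty ⟨4 * ‖a‖, by
        rintro _ ⟨n, rfl⟩
        exact hb n⟩⟩
      refine subset_closure ⟨(D + prodHom ψ a, a), ⟨fun n => ?_, ?_⟩, rfl⟩
      · change π (d n + ψ n a) = σ a
        rw [map_add, hd, sub_add_cancel]
      · change Tendsto (fun n => ‖(D + prodHom ψ a - prodHom ψ a) n‖) atTop (𝓝 0)
        rw [add_sub_cancel_right]
        exact squeeze_zero (fun _ => norm_nonneg _) hd' (by simpa using (hψ a).const_mul 2))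
    (fun _ => π) (fun _ => σ) (fun z hz n => hz.1 n)
  exact ⟨χ, NonUnitalStarAlgHom.ext hχ⟩

lemma IsProjective.isWeaklyProjective (hA : IsProjective A) : IsWeaklyProjective A := by
  intro C Q _ _ _ J π hJ hπ σ ε F hε
  obtain ⟨ψ, hψ⟩ := hA C Q J π hJ hπ σ
  refine ⟨ψ, fun a _ => ?_⟩
  have : π (ψ a) = σ a := DFunLike.congr_fun hψ a
  simpa [this] using hε

lemma IsProjective.isSemiprojective (hA : IsProjective A) : IsSemiprojective A := by
  intro C _ _ J hJ hm D _ Q _ ρ π p hρ hπ hp σ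
  obtain ⟨ψ, hψ⟩ := hA C Q _ π (isClosed_ker π) (isQuotientBy_ker hπ.surjective) σ
  exact ⟨0, (ρ 0).comp ψ, by rw [← hψ, ← hp 0]; rfl⟩

lemma IsWeaklyProjective.isWeaklySemiprojective (hA : IsWeaklyProjective A) :
    IsWeaklySemiprojective A := by
  intro C _ _ J hJ hm D _ Q _ ρ π p hρ hπ hp σ ε F hε
  obtain ⟨ψ, hψ⟩ := hA C Q _ π (isClosed_ker π) (isQuotientBy_ker hπ.surjective) σ ε F hε
  refine ⟨0, (ρ 0).comp ψ, fun a ha => ?_⟩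
  have : p 0 (ρ 0 (ψ a)) = π (ψ a) := DFunLike.congr_fun (hp 0) _
  change ‖p 0 (ρ 0 (ψ a)) - _‖ < ε
  rw [this]
  exact hψ a ha

lemma IsSemiprojective.isWeaklySemiprojective (hA : IsSemiprojective A) :
    IsWeaklySemiprojective A := by
  intro C _ _ J hJ hm D _ Q _ ρ π p hρ hπ hp σ ε F hε
  obtain ⟨k, ψ, hψ⟩ := hA C J hJ hm D Q ρ π p hρ hπ hp σ
  refine ⟨k, ψ, fun a _ => ?_⟩
  have : p k (ψ a) = σ a := DFunLike.congr_fun hψ a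
  simpa [this] using hε

end WeaklyProjective

/-! ### Quasicentral approximate units -/

section Quasicentral

/-- Writing the unit as `star b * b` keeps the statement free of an order on `J`, so it can be
applied to an ideal and read in any ordered algebra containing it. -/
lemma exists_approx_unit {J : Type*} [NonUnitalCStarAlgebra J] (F : Finset J) {ε : ℝ}
    (hε : 0 < ε) : ∃ b : J, ‖star b * b‖ ≤ 1 ∧
      ∀ j ∈ F, ‖star b * b * j - j‖ < ε ∧ ‖j * (star b * b) - j‖ < ε := by
  let _ := CStarAlgebra.spectralOrder J
  let _ := CStarAlgebra.spectralOrderedRing J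
  have h := CStarAlgebra.increasingApproximateUnit J
  have h1 : ∀ᶠ e in CStarAlgebra.approximateUnit J,
      ∀ j ∈ F, ‖e * j - j‖ < ε ∧ ‖j * e - j‖ < ε := by
    refine (Finset.eventually_all F).2 fun j _ => ?_
    have h2 := (h.tendsto_mul_right j).eventually (Metric.ball_mem_nhds j hε)
    have h3 := (h.tendsto_mul_left j).eventually (Metric.ball_mem_nhds j hε)
    filter_upwards [h2, h3] with e he he'
    exact ⟨by simpa [dist_eq_norm] using he, by simpa [dist_eq_norm] using he'⟩
  obtain ⟨e, he, he0, hen⟩ := (h1.and (h.eventually_nonneg.and h.eventually_norm)).exists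
  obtain ⟨b, rfl⟩ := CStarAlgebra.nonneg_iff_eq_star_mul_self.1 he0
  exact ⟨b, hen, he⟩

/-- The kernel of a homomorphism as a star subalgebra. -/
def kerSubalgebra {C Q : Type*} [NonUnitalCStarAlgebra C] [NonUnitalCStarAlgebra Q]
    (π : C →⋆ₙₐ[ℂ] Q) : NonUnitalStarSubalgebra ℂ C where
  carrier := {c | π c = 0}
  add_mem' {a b} ha hb := by
    change π (a + b) = 0
    rw [map_add, show π a = 0 from ha, show π b = 0 from hb, add_zero]
  zero_mem' := map_zero π
  mul_mem' {a b} ha hb := by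
    change π (a * b) = 0
    rw [map_mul, show π a = 0 from ha, zero_mul]
  smul_mem' r a ha := by
    change π (r • a) = 0
    rw [map_smul, show π a = 0 from ha, smul_zero]
  star_mem' {a} ha := by
    change π (star a) = 0
    rw [map_star, show π a = 0 from ha, star_zero]

instance isClosed_kerSubalgebra {C Q : Type*} [NonUnitalCStarAlgebra C] [NonUnitalCStarAlgebra Q]
    (π : C →⋆ₙₐ[ℂ] Q) : IsClosed (kerSubalgebra π : Set C) :=
  isClosed_singleton.preimage (continuous_hom π)

variable {C Q : Type*} [CStarAlgebra C] [PartialOrder C] [StarOrderedRing C]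
  [NonUnitalCStarAlgebra Q]

lemma exists_approx_unit_ker (π : C →⋆ₙₐ[ℂ] Q) (F : Finset C) (hF : ∀ j ∈ F, π j = 0) {ε : ℝ}
    (hε : 0 < ε) : ∃ e : C, 0 ≤ e ∧ e ≤ 1 ∧ π e = 0 ∧
      ∀ j ∈ F, ‖e * j - j‖ < ε ∧ ‖j * e - j‖ < ε := by
  classical
  obtain ⟨b, hb, h⟩ := exists_approx_unit
    (F.attach.image fun j : {x // x ∈ F} => (⟨j.1, hF j.1 j.2⟩ : kerSubalgebra π)) hε
  have hb0 : π b = 0 := b.2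
  have h0 : (0 : C) ≤ star (b : C) * b := star_mul_self_nonneg _
  refine ⟨star (b : C) * b, h0, ?_, by rw [map_mul, hb0, mul_zero], fun j hj => ?_⟩
  · exact (CStarAlgebra.norm_le_one_iff_of_nonneg _ h0).1 hb
  · exact h ⟨j, hF j hj⟩ (Finset.mem_image.2 ⟨⟨j, hj⟩, Finset.mem_attach _ _, rfl⟩)

/-- By the C*-identity, bounded summands that are almost orthogonal have a sum of norm about `√n`,
so their average is small. -/
lemma norm_sum_sq_le {C : Type*} [NonUnitalCStarAlgebra C] (y : ℕ → C) {M η : ℝ}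
    (hM : ∀ i, ‖y i‖ ≤ M) (hη : ∀ i j, i < j → ‖star (y i) * y j‖ ≤ η) (hη0 : 0 ≤ η) (n : ℕ) :
    ‖∑ i ∈ Finset.range n, y i‖ ^ 2 ≤ n * M ^ 2 + n ^ 2 * η := by
  have hij : ∀ i j, ‖star (y i) * y j‖ ≤ (if i = j then M ^ 2 else 0) + η := by
    intro i j
    rcases lt_trichotomy i j with h | rfl | h
    · simpa [h.ne] using hη i j h
    · have := hM i
      rw [if_pos rfl, CStarRing.norm_star_mul_self]
      nlinarith [norm_nonneg (y i)]
    · rw [if_neg h.ne', zero_add, ← norm_star, star_mul, star_star]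
      exact hη j i h
  rw [sq, ← CStarRing.norm_star_mul_self, star_sum, Finset.sum_mul_sum]
  calc ‖∑ i ∈ Finset.range n, ∑ j ∈ Finset.range n, star (y i) * y j‖
      ≤ ∑ i ∈ Finset.range n, ∑ j ∈ Finset.range n, ((if i = j then M ^ 2 else 0) + η) := by
        refine (norm_sum_le _ _).trans (Finset.sum_le_sum fun i _ => ?_)
        exact (norm_sum_le _ _).trans (Finset.sum_le_sum fun j _ => hij i j)
    _ = n * M ^ 2 + n ^ 2 * η := by
        have : ∀ i ∈ Finset.range n, ∑ j ∈ Finset.range n, ((if i = j then M ^ 2 else 0) + η) =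
            M ^ 2 + n * η := by
          intro i hi
          rw [Finset.sum_add_distrib, Finset.sum_ite_eq, if_pos hi]
          simp
        rw [Finset.sum_congr rfl this]
        simp
        ring

/-- Choose approximate units `e i` successively. The earlier commutators lie in the ideal, so a
later `e'` acts on them almost as a unit, and the later commutators are almost orthogonal to them.
By `norm_sum_sq_le` the average of many `e i` almost commutes with `Fc`. -/
lemma exists_quasicentral (π : C →⋆ₙₐ[ℂ] Q) (Fc Fj : Finset C) (hF : ∀ j ∈ Fj, π j = 0) {ε : ℝ}
    (hε : 0 < ε) : ∃ u : C, 0 ≤ u ∧ u ≤ 1 ∧ π u = 0 ∧ (∀ j ∈ Fj, ‖u * j - j‖ < ε) ∧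
      ∀ c ∈ Fc, ‖u * c - c * u‖ < ε := by
  classical
  obtain ⟨M, hM0, hM⟩ : ∃ M : ℝ, 0 ≤ M ∧ ∀ c ∈ Fc, ‖c‖ ≤ M :=
    ⟨∑ c ∈ Fc, ‖c‖, Finset.sum_nonneg fun _ _ => norm_nonneg _, fun c hc =>
      Finset.single_le_sum (f := fun c => ‖c‖) (fun _ _ => norm_nonneg _) hc⟩
  set η : ℝ := ε ^ 2 / 4 with hη
  have hη0 : 0 < η := by positivity
  obtain ⟨e, he, hr⟩ := exists_seq_of_forall_finset_exists
    (fun e : C => 0 ≤ e ∧ e ≤ 1 ∧ π e = 0 ∧ ∀ j ∈ Fj, ‖e * j - j‖ ≤ ε / 2)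
    (fun e e' => ∀ c ∈ Fc, ‖star (e * c - c * e) * (e' * c - c * e')‖ ≤ η) (by
      intro s hs
      have hz : ∀ e ∈ s, ∀ c, π (star (e * c - c * e)) = 0 := by
        intro e he c
        simp [map_star, (hs e he).2.2.1]
      obtain ⟨e', h0, h1, hπ, h⟩ := exists_approx_unit_ker π
        (Fj ∪ (s ×ˢ Fc).image (fun p => star (p.1 * p.2 - p.2 * p.1)) ∪
          (s ×ˢ Fc).image (fun p => star (p.1 * p.2 - p.2 * p.1) * p.2))
        (by
          intro j hj
          rcases Finset.mem_union.1 hj with hj | hj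
          · rcases Finset.mem_union.1 hj with hj | hj
            · exact hF j hj
            · obtain ⟨p, hp, rfl⟩ := Finset.mem_image.1 hj
              exact hz _ (Finset.mem_product.1 hp).1 _
          · obtain ⟨p, hp, rfl⟩ := Finset.mem_image.1 hj
            rw [map_mul, hz _ (Finset.mem_product.1 hp).1 _, zero_mul])
        (show 0 < min (ε / 2) (η / (M + 1)) by positivity)
      refine ⟨e', ⟨h0, h1, hπ, fun j hj => ?_⟩, fun e he c hc => ?_⟩
      · exact (h j (by simp [hj])).1.le.trans (min_le_left _ _)
      · set y := star (e * c - c * e) with hy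
        have m1 := (h y (Finset.mem_union_left _ (Finset.mem_union_right _
          (Finset.mem_image.2 ⟨(e, c), Finset.mem_product.2 ⟨he, hc⟩, rfl⟩)))).2.le.trans
          (min_le_right _ _)
        have m2 := (h (y * c) (Finset.mem_union_right _
          (Finset.mem_image.2 ⟨(e, c), Finset.mem_product.2 ⟨he, hc⟩, rfl⟩))).2.le.trans
          (min_le_right _ _)
        have e1 : y * (e' * c - c * e') = (y * e' - y) * c - (y * c * e' - y * c) := by
          noncomm_ring
        rw [e1]
        calc _ ≤ ‖(y * e' - y) * c‖ + ‖y * c * e' - y * c‖ := norm_sub_le _ _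
          _ ≤ η / (M + 1) * M + η / (M + 1) := by
            refine add_le_add ((norm_mul_le _ _).trans ?_) m2
            exact mul_le_mul m1 (hM c hc) (norm_nonneg _) (by positivity)
          _ = η := by field_simp)
  -- The commutators are bounded by `2 * M`. For this many summands the diagonal terms contribute
  -- less than `n² ε² / 4`, and the choice of `η` bounds the others by the same amount.
  obtain ⟨m, hm⟩ := exists_nat_gt (4 * (2 * M) ^ 2 / ε ^ 2)
  set n := m + 1 with hn
  have hn0 : (0 : ℝ) < n := by positivity
  have hsmul : ∀ x : C, ((n : ℝ)⁻¹ : ℝ) • (n • x) = x := by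
    intro x
    rw [← Nat.cast_smul_eq_nsmul ℝ, smul_smul, inv_mul_cancel₀ hn0.ne', one_smul]
  refine ⟨(n : ℝ)⁻¹ • ∑ i ∈ Finset.range n, e i, ?_, ?_, ?_, ?_, ?_⟩
  · exact smul_nonneg (by positivity) (Finset.sum_nonneg fun i _ => (he i).1)
  · have h1 : ∑ i ∈ Finset.range n, e i ≤ n • (1 : C) := by
      simpa using Finset.sum_le_sum fun i (_ : i ∈ Finset.range n) => (he i).2.1
    have := smul_le_smul_of_nonneg_left h1 (show (0 : ℝ) ≤ (n : ℝ)⁻¹ by positivity)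
    rwa [hsmul] at this
  · rw [RCLike.real_smul_eq_coe_smul (K := ℂ), map_smul, map_sum,
      Finset.sum_eq_zero fun i _ => (he i).2.2.1, smul_zero]
  · intro j hj
    have e1 : ((n : ℝ)⁻¹ • ∑ i ∈ Finset.range n, e i) * j - j =
        (n : ℝ)⁻¹ • ∑ i ∈ Finset.range n, (e i * j - j) := by
      rw [Finset.sum_sub_distrib, smul_sub, Finset.sum_const, Finset.card_range, hsmul,
        smul_mul_assoc, Finset.sum_mul]
    rw [e1, norm_smul, Real.norm_of_nonneg (by positivity)]
    have h1 : ‖∑ i ∈ Finset.range n, (e i * j - j)‖ ≤ n * (ε / 2) := by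
      refine (norm_sum_le_of_le _ fun i _ => (he i).2.2.2 j hj).trans ?_
      simp
    calc (n : ℝ)⁻¹ * ‖∑ i ∈ Finset.range n, (e i * j - j)‖ ≤ (n : ℝ)⁻¹ * (n * (ε / 2)) := by
          gcongr
      _ = ε / 2 := by field_simp
      _ < ε := by linarith
  · intro c hc
    have e1 : ((n : ℝ)⁻¹ • ∑ i ∈ Finset.range n, e i) * c -
        c * ((n : ℝ)⁻¹ • ∑ i ∈ Finset.range n, e i) =
        (n : ℝ)⁻¹ • ∑ i ∈ Finset.range n, (e i * c - c * e i) := by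
      rw [Finset.sum_sub_distrib, smul_sub, smul_mul_assoc, Finset.sum_mul, mul_smul_comm,
        Finset.mul_sum]
    rw [e1, norm_smul, Real.norm_of_nonneg (by positivity)]
    have hb : ∀ i, ‖e i * c - c * e i‖ ≤ 2 * M := by
      intro i
      have h1 : ‖e i‖ ≤ 1 := (CStarAlgebra.norm_le_one_iff_of_nonneg _ (he i).1).2 (he i).2.1
      have h2 := hM c hc
      calc _ ≤ ‖e i‖ * ‖c‖ + ‖c‖ * ‖e i‖ :=
            (norm_sub_le _ _).trans (add_le_add (norm_mul_le _ _) (norm_mul_le _ _))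
        _ ≤ 2 * M := by nlinarith [norm_nonneg c, norm_nonneg (e i)]
    have h1 := norm_sum_sq_le (fun i => e i * c - c * e i) hb
      (fun i j hij => hr i j hij c hc) hη0.le n
    have hn1 : 4 * (2 * M) ^ 2 < n * ε ^ 2 := by
      have := (div_lt_iff₀ (by positivity)).1 hm
      have h3 : (m : ℝ) ≤ n := by simp [hn]
      nlinarith [sq_nonneg ε]
    have h2 : ‖∑ i ∈ Finset.range n, (e i * c - c * e i)‖ ^ 2 < (n * ε) ^ 2 := by
      refine h1.trans_lt ?_
      rw [hη]
      have : (n : ℝ) * (4 * (2 * M) ^ 2) < n * (n * ε ^ 2) := by gcongr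
      nlinarith [sq_nonneg (n * ε)]
    have h3 := lt_of_pow_lt_pow_left₀ 2 (by positivity) h2
    rw [inv_mul_lt_iff₀ hn0]
    exact h3

/-- A sequential quasicentral approximate unit for the kernel of a homomorphism. -/
lemma exists_quasicentral_seq [TopologicalSpace.SeparableSpace C] (π : C →⋆ₙₐ[ℂ] Q) :
    ∃ u : ℕ → C, (∀ n, 0 ≤ u n ∧ u n ≤ 1 ∧ π (u n) = 0) ∧
      (∀ j, π j = 0 → Tendsto (fun n => u n * j - j) atTop (𝓝 0)) ∧
      ∀ c, Tendsto (fun n => u n * c - c * u n) atTop (𝓝 0) := by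
  classical
  obtain ⟨d, hd⟩ := TopologicalSpace.exists_dense_seq C
  obtain ⟨k, hk⟩ := TopologicalSpace.exists_dense_seq (kerSubalgebra π)
  have h (n : ℕ) := exists_quasicentral π ((Finset.range n).image d)
    ((Finset.range n).image fun i => (k i : C)) (by
      intro j hj
      obtain ⟨i, _, rfl⟩ := Finset.mem_image.1 hj
      exact (k i).2) (show 0 < 1 / ((n : ℝ) + 1) by positivity)
  choose u h0 h1 hπ hj hc using h
  have hu (n : ℕ) : ‖u n‖ ≤ 1 := (CStarAlgebra.norm_le_one_iff_of_nonneg _ (h0 n)).2 (h1 n)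
  -- Both convergences follow from uniformly Lipschitz bounds and convergence along a sequence with
  -- `x` in its closure.
  have key (x : C) (s : ℕ → C) (L : ℕ → C → C) (hL : ∀ n a b, ‖L n a‖ ≤ ‖L n b‖ + 2 * ‖a - b‖)
      (hs : x ∈ closure (Set.range s)) (hLs : ∀ n, ∀ i < n, ‖L n (s i)‖ < 1 / ((n : ℝ) + 1)) :
      Tendsto (fun n => L n x) atTop (𝓝 0) := by
    rw [Metric.tendsto_atTop]
    intro ε hε
    obtain ⟨_, ⟨i, rfl⟩, hi⟩ := Metric.mem_closure_iff.1 hs (ε / 4) (by positivity)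
    rw [dist_eq_norm] at hi
    obtain ⟨m, hm⟩ := exists_nat_one_div_lt (show (0 : ℝ) < ε / 4 by positivity)
    refine ⟨max m (i + 1), fun n hn => ?_⟩
    have h1 := hLs n i (by have := le_max_right m (i + 1); omega)
    have h2 : 1 / ((n : ℝ) + 1) ≤ 1 / ((m : ℝ) + 1) :=
      one_div_le_one_div_of_le (by positivity) (by
        have : (m : ℝ) ≤ n := by exact_mod_cast (le_max_left _ _).trans hn
        linarith)
    rw [dist_zero_right]
    linarith [hL n x (s i)]
  refine ⟨u, fun n => ⟨h0 n, h1 n, hπ n⟩, fun j hj0 => ?_, fun c => ?_⟩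
  · refine key j (fun i => (k i : C)) (fun n x => u n * x - x) (fun n a b => ?_) ?_ ?_
    · have e1 : u n * a - a = (u n * b - b) + (u n * (a - b) - (a - b)) := by noncomm_ring
      rw [e1]
      refine (norm_add_le _ _).trans (add_le_add le_rfl ((norm_sub_le _ _).trans ?_))
      have := norm_mul_le (u n) (a - b)
      nlinarith [norm_nonneg (a - b), hu n]
    · have := hk ⟨j, hj0⟩
      rw [Metric.mem_closure_iff] at this ⊢
      intro ε hε
      obtain ⟨_, ⟨i, rfl⟩, hi⟩ := this ε hε
      exact ⟨_, ⟨i, rfl⟩, hi⟩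
    · exact fun n i hi => hj n _ (Finset.mem_image.2 ⟨i, Finset.mem_range.2 hi, rfl⟩)
  · refine key c d (fun n x => u n * x - x * u n) (fun n a b => ?_) (hd c) ?_
    · have e1 : u n * a - a * u n = (u n * b - b * u n) + (u n * (a - b) - (a - b) * u n) := by
        noncomm_ring
      rw [e1]
      refine (norm_add_le _ _).trans (add_le_add le_rfl ((norm_sub_le _ _).trans ?_))
      have := norm_mul_le (u n) (a - b)
      have := norm_mul_le (a - b) (u n)
      nlinarith [norm_nonneg (a - b), hu n]
    · exact fun n i hi => hc n _ (Finset.mem_image.2 ⟨i, Finset.mem_range.2 hi, rfl⟩)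

end Quasicentral

/-! ### Functional calculus of a quasicentral approximate unit -/

section Calculus

variable {C : Type*} [CStarAlgebra C]

/-- The continuous functional calculus of an element with spectrum in the unit interval. -/
noncomputable def unitCalculus (a : C) (ha : IsSelfAdjoint a) (hs : spectrum ℝ a ⊆ unitInterval) :
    C(unitInterval, ℝ) →⋆ₐ[ℝ] C :=
  (cfcHom ha).comp (ContinuousMap.compStarAlgHom' ℝ ℝ ⟨Set.inclusion hs, continuous_inclusion hs⟩)

lemma norm_unitCalculus_le (a : C) (ha : IsSelfAdjoint a) (hs : spectrum ℝ a ⊆ unitInterval)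
    (f : C(unitInterval, ℝ)) : ‖unitCalculus a ha hs f‖ ≤ ‖f‖ := by
  change ‖cfcHom ha (f.comp ⟨Set.inclusion hs, continuous_inclusion hs⟩)‖ ≤ ‖f‖
  rw [norm_cfcHom a _ ha]
  exact (ContinuousMap.norm_le _ (norm_nonneg _)).2 fun x => f.norm_coe_le_norm _

lemma unitCalculus_id (a : C) (ha : IsSelfAdjoint a) (hs : spectrum ℝ a ⊆ unitInterval) :
    unitCalculus a ha hs (.restrict unitInterval (.id ℝ)) = a :=
  cfcHom_id ha

lemma unitCalculus_const (a : C) (ha : IsSelfAdjoint a) (hs : spectrum ℝ a ⊆ unitInterval)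
    (r : ℝ) : unitCalculus a ha hs (.const _ r) = algebraMap ℝ C r :=
  AlgHomClass.commutes (unitCalculus a ha hs) r

/-- A property of continuous functions on the unit interval holds for all of them if it holds for
constants and the identity, and is stable under the algebra operations and limits. -/
lemma unitInterval_induction {p : C(unitInterval, ℝ) → Prop} (const : ∀ r, p (.const _ r))
    (id : p (.restrict unitInterval (.id ℝ))) (add : ∀ f g, p f → p g → p (f + g))
    (mul : ∀ f g, p f → p g → p (f * g))
    (lim : ∀ f, (∀ ε > 0, ∃ g, p g ∧ ‖f - g‖ < ε) → p f) (f : C(unitInterval, ℝ)) : p f := by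
  refine ContinuousMap.induction_on_of_compact const id (by simpa using id) add mul ?_ f
  intro f hf
  refine lim f fun ε hε => ?_
  obtain ⟨g, hg, hd⟩ := (hf.and_eventually (Metric.ball_mem_nhds f hε)).exists
  exact ⟨g, hg, by rw [← dist_eq_norm, dist_comm]; exact hd⟩

lemma tendsto_zero_of_approx {E : Type*} [NormedAddCommGroup E] {x : ℕ → E}
    (h : ∀ ε > 0, ∃ y : ℕ → E, Tendsto y atTop (𝓝 0) ∧ ∀ n, ‖x n - y n‖ ≤ ε) :
    Tendsto x atTop (𝓝 0) := by
  rw [Metric.tendsto_atTop]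
  intro ε hε
  obtain ⟨y, hy, hxy⟩ := h (ε / 2) (half_pos hε)
  obtain ⟨N, hN⟩ := Metric.tendsto_atTop.1 hy (ε / 2) (half_pos hε)
  refine ⟨N, fun n hn => ?_⟩
  have h1 := hN n hn
  rw [dist_zero_right] at h1 ⊢
  have := norm_add_le (x n - y n) (y n)
  rw [sub_add_cancel] at this
  linarith [hxy n]

lemma tendsto_zero_mul_left_of_bounded {y z : ℕ → C} {M : ℝ} (hy : ∀ n, ‖y n‖ ≤ M)
    (hz : Tendsto z atTop (𝓝 0)) : Tendsto (fun n => y n * z n) atTop (𝓝 0) := by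
  rw [tendsto_zero_iff_norm_tendsto_zero] at hz ⊢
  refine squeeze_zero (fun _ => norm_nonneg _) (fun n => (norm_mul_le _ _).trans
    (mul_le_mul_of_nonneg_right (hy n) (norm_nonneg _))) (by simpa using hz.const_mul M)

lemma tendsto_zero_mul_right_of_bounded {y z : ℕ → C} {M : ℝ} (hy : ∀ n, ‖y n‖ ≤ M)
    (hz : Tendsto z atTop (𝓝 0)) : Tendsto (fun n => z n * y n) atTop (𝓝 0) := by
  rw [tendsto_zero_iff_norm_tendsto_zero] at hz ⊢
  refine squeeze_zero (fun _ => norm_nonneg _) (fun n => (norm_mul_le _ _).trans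
    (mul_le_mul_of_nonneg_left (hy n) (norm_nonneg _))) (by simpa using hz.mul_const M)

/-- Here `Θ n f = f(1 - u n)` for a quasicentral approximate unit `u n` of the kernel. The element
`1 - u n` maps to `1` in the quotient, asymptotically annihilates the kernel and asymptotically
commutes with everything. Each claim holds for constants and the identity function, and is stable
under sums, products and uniform limits. -/
lemma exists_quasicentral_calculus {Q : Type*} [CStarAlgebra Q]
    [TopologicalSpace.SeparableSpace C] (π : C →⋆ₐ[ℂ] Q) :
    ∃ Θ : ℕ → (C(unitInterval, ℝ) →⋆ₐ[ℝ] C), (∀ n f, ‖Θ n f‖ ≤ ‖f‖) ∧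
      (∀ n f, π (Θ n f) = algebraMap ℝ Q (f 1)) ∧
      (∀ f j, π j = 0 → Tendsto (fun n => Θ n f * j - f 0 • j) atTop (𝓝 0)) ∧
      ∀ f c, Tendsto (fun n => Θ n f * c - c * Θ n f) atTop (𝓝 0) := by
  let _ := CStarAlgebra.spectralOrder C
  let _ := CStarAlgebra.spectralOrderedRing C
  obtain ⟨u, hu, huj, huc⟩ := exists_quasicentral_seq (π : C →⋆ₙₐ[ℂ] Q)
  have hsa (n : ℕ) : IsSelfAdjoint (1 - u n) := (sub_nonneg.2 (hu n).2.1).isSelfAdjoint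
  have hs (n : ℕ) : spectrum ℝ (1 - u n) ⊆ unitInterval := by
    intro x hx
    have h0 : 0 ≤ 1 - u n := sub_nonneg.2 (hu n).2.1
    have h1 : 1 - u n ≤ 1 := sub_le_self 1 (hu n).1
    refine ⟨spectrum_nonneg_of_nonneg h0 hx, ?_⟩
    have h2 := (CStarAlgebra.norm_le_one_iff_of_nonneg _ h0).2 h1
    have h3 := IsometricContinuousFunctionalCalculus.norm_spectrum_le (𝕜 := ℝ) (1 - u n) hx (hsa n)
    exact (le_abs_self x).trans (h3.trans h2)
  let Θ (n : ℕ) := unitCalculus (1 - u n) (hsa n) (hs n)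
  have hΘ : ∀ n f, ‖Θ n f‖ ≤ ‖f‖ := fun n f => norm_unitCalculus_le _ _ _ f
  have hid : ∀ n, Θ n (.restrict unitInterval (.id ℝ)) = 1 - u n := fun n => unitCalculus_id _ _ _
  have hconst : ∀ n r, Θ n (.const _ r) = algebraMap ℝ C r := fun n r => unitCalculus_const _ _ _ r
  refine ⟨Θ, hΘ, fun n f => ?_, fun f j hj => ?_, fun f c => ?_⟩
  · induction f using unitInterval_induction with
    | const r =>
      rw [hconst, ContinuousMap.const_apply, Algebra.algebraMap_eq_smul_one,
        Algebra.algebraMap_eq_smul_one, RCLike.real_smul_eq_coe_smul (K := ℂ), map_smul, map_one,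
        RCLike.real_smul_eq_coe_smul (K := ℂ)]
    | id =>
      have : π (u n) = 0 := (hu n).2.2
      rw [hid, map_sub, map_one, this, sub_zero]
      simp
    | add f g hf hg => simp [map_add, hf, hg]
    | mul f g hf hg => simp [map_mul, hf, hg]
    | lim f h =>
      refine eq_of_sub_eq_zero (norm_le_zero_iff.1 (le_of_forall_pos_le_add fun ε hε => ?_))
      obtain ⟨g, hg, hfg⟩ := h (ε / 2) (half_pos hε)
      have h1 : ‖π (Θ n (f - g))‖ ≤ ‖f - g‖ :=
        (NonUnitalStarAlgHom.norm_apply_le (π : C →⋆ₙₐ[ℂ] Q) _).trans (hΘ n _)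
      have h2 : ‖algebraMap ℝ Q ((f - g) 1)‖ ≤ ‖f - g‖ := by
        rw [Algebra.algebraMap_eq_smul_one, norm_smul]
        refine (mul_le_of_le_one_right (norm_nonneg _) ?_).trans ((f - g).norm_coe_le_norm 1)
        rcases subsingleton_or_nontrivial Q with h | h
        · simp [Subsingleton.elim (1 : Q) 0]
        · simp
      have e : π (Θ n f) - algebraMap ℝ Q (f 1) =
          π (Θ n (f - g)) - algebraMap ℝ Q ((f - g) 1) := by
        rw [map_sub (Θ n), map_sub π, hg, ContinuousMap.sub_apply, map_sub]
        abel
      rw [e]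
      exact (norm_sub_le _ _).trans (by linarith)
  · induction f using unitInterval_induction with
    | const r => simp [hconst, Algebra.algebraMap_eq_smul_one]
    | id =>
      have := (huj j hj).neg
      rw [neg_zero] at this
      refine this.congr fun n => ?_
      rw [hid]
      simp [sub_mul]
    | add f g hf hg =>
      have := hf.add hg
      rw [add_zero] at this
      refine this.congr fun n => ?_
      rw [map_add, ContinuousMap.add_apply, add_mul, add_smul]
      abel
    | mul f g hf hg =>
      have h1 := (tendsto_zero_mul_left_of_bounded (fun n => hΘ n f) hg).add (hf.const_smul (g 0))
      rw [smul_zero, add_zero] at h1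
      refine h1.congr fun n => ?_
      rw [map_mul, ContinuousMap.mul_apply, mul_sub, smul_sub, mul_smul_comm, smul_smul,
        mul_comm (g 0) (f 0), mul_assoc]
      abel
    | lim f h =>
      refine tendsto_zero_of_approx fun ε hε => ?_
      obtain ⟨g, hg, hfg⟩ := h (ε / (2 * (‖j‖ + 1))) (by positivity)
      refine ⟨_, hg, fun n => ?_⟩
      have e : Θ n f * j - f 0 • j - (Θ n g * j - g 0 • j) =
          Θ n (f - g) * j - (f - g) 0 • j := by
        rw [map_sub, ContinuousMap.sub_apply, sub_mul, sub_smul]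
        abel
      have h1 : ‖Θ n (f - g) * j‖ ≤ ‖f - g‖ * ‖j‖ :=
        (norm_mul_le _ _).trans (mul_le_mul_of_nonneg_right (hΘ n _) (norm_nonneg _))
      have h2 : ‖(f - g) 0 • j‖ ≤ ‖f - g‖ * ‖j‖ := by
        rw [norm_smul]
        exact mul_le_mul_of_nonneg_right ((f - g).norm_coe_le_norm 0) (norm_nonneg _)
      have h3 : ‖f - g‖ * ‖j‖ ≤ ε / 2 := by
        calc ‖f - g‖ * ‖j‖ ≤ ε / (2 * (‖j‖ + 1)) * (‖j‖ + 1) := by gcongr; linarith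
          _ = ε / 2 := by field_simp
      rw [e]
      exact (norm_sub_le _ _).trans (by linarith)
  · induction f using unitInterval_induction with
    | const r => simp [hconst, Algebra.algebraMap_eq_smul_one]
    | id =>
      have := (huc c).neg
      rw [neg_zero] at this
      refine this.congr fun n => ?_
      rw [hid]
      noncomm_ring
    | add f g hf hg =>
      have := hf.add hg
      rw [add_zero] at this
      refine this.congr fun n => ?_
      rw [map_add]
      noncomm_ring
    | mul f g hf hg =>
      have h1 := (tendsto_zero_mul_left_of_bounded (fun n => hΘ n f) hg).add
        (tendsto_zero_mul_right_of_bounded (fun n => hΘ n g) hf)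
      rw [add_zero] at h1
      refine h1.congr fun n => ?_
      rw [map_mul]
      noncomm_ring
    | lim f h =>
      refine tendsto_zero_of_approx fun ε hε => ?_
      obtain ⟨g, hg, hfg⟩ := h (ε / (2 * (‖c‖ + 1))) (by positivity)
      refine ⟨_, hg, fun n => ?_⟩
      have e : Θ n f * c - c * Θ n f - (Θ n g * c - c * Θ n g) =
          Θ n (f - g) * c - c * Θ n (f - g) := by
        rw [map_sub]
        noncomm_ring
      have h1 : ‖Θ n (f - g) * c‖ ≤ ‖f - g‖ * ‖c‖ :=
        (norm_mul_le _ _).trans (mul_le_mul_of_nonneg_right (hΘ n _) (norm_nonneg _))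
      have h2 : ‖c * Θ n (f - g)‖ ≤ ‖f - g‖ * ‖c‖ := by
        rw [mul_comm ‖f - g‖]
        exact (norm_mul_le _ _).trans (mul_le_mul_of_nonneg_left (hΘ n _) (norm_nonneg _))
      have h3 : ‖f - g‖ * ‖c‖ ≤ ε / 2 := by
        calc ‖f - g‖ * ‖c‖ ≤ ε / (2 * (‖c‖ + 1)) * (‖c‖ + 1) := by gcongr; linarith
          _ = ε / 2 := by field_simp
      rw [e]
      exact (norm_sub_le _ _).trans (by linarith)

end Calculus

/-! ### Norm bounds for sums over a partition of unity -/

section Partition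

variable {C : Type*} [CStarAlgebra C] [PartialOrder C] [StarOrderedRing C]

/-- Shifting by `M` gives a positive element below `2 * M`, where the norm is monotone. The crude
constant 3 is harmless. -/
lemma norm_le_of_neg_le_of_le {x : C} {M : ℝ} (hM : 0 ≤ M) (h1 : -algebraMap ℝ C M ≤ x)
    (h2 : x ≤ algebraMap ℝ C M) : ‖x‖ ≤ 3 * M := by
  have h0 : 0 ≤ x + algebraMap ℝ C M := by
    have := add_le_add_left h1 (algebraMap ℝ C M)
    simpa [add_comm] using this
  have h3 : x + algebraMap ℝ C M ≤ algebraMap ℝ C (2 * M) := by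
    rw [two_mul, map_add]
    exact add_le_add h2 le_rfl
  have h4 := CStarAlgebra.norm_le_norm_of_nonneg_of_le h0 h3
  have hn (r : ℝ) (hr : 0 ≤ r) : ‖algebraMap ℝ C r‖ ≤ r := by
    rw [Algebra.algebraMap_eq_smul_one, norm_smul, Real.norm_of_nonneg hr]
    refine mul_le_of_le_one_right hr ?_
    rcases subsingleton_or_nontrivial C with h | h
    · simp [Subsingleton.elim (1 : C) 0]
    · simp
  have h5 := norm_sub_le (x + algebraMap ℝ C M) (algebraMap ℝ C M)
  rw [add_sub_cancel_right] at h5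
  linarith [hn M hM, hn (2 * M) (by linarith)]

/-- The map `k ↦ ∑ v i * k i * v i` is positive and unital, so it preserves the bounds `±M`,
whatever the number of summands. -/
lemma norm_sum_conjugate_le_of_isSelfAdjoint {ι : Type*} (s : Finset ι) (v k : ι → C) {M : ℝ}
    (hM0 : 0 ≤ M)
    (hv : ∀ i ∈ s, IsSelfAdjoint (v i)) (hsum : ∑ i ∈ s, v i * v i = 1)
    (hk : ∀ i ∈ s, IsSelfAdjoint (k i)) (hM : ∀ i ∈ s, ‖k i‖ ≤ M) :
    ‖∑ i ∈ s, v i * k i * v i‖ ≤ 3 * M := by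
  have hc : ∑ i ∈ s, v i * algebraMap ℝ C M * v i = algebraMap ℝ C M := by
    have : ∀ i ∈ s, v i * algebraMap ℝ C M * v i = algebraMap ℝ C M * (v i * v i) := by
      intro i _
      rw [← Algebra.commutes, mul_assoc]
    rw [Finset.sum_congr rfl this, ← Finset.mul_sum, hsum, mul_one]
  have hle : ∀ i ∈ s, k i ≤ algebraMap ℝ C M := fun i hi =>
    ((hk i hi).le_algebraMap_norm_self).trans (algebraMap_mono C (hM i hi))
  have hge : ∀ i ∈ s, -algebraMap ℝ C M ≤ k i := fun i hi =>
    (neg_le_neg (algebraMap_mono C (hM i hi))).trans ((hk i hi).neg_algebraMap_norm_le_self)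
  refine norm_le_of_neg_le_of_le hM0 ?_ ?_
  · rw [← hc, ← Finset.sum_neg_distrib]
    refine Finset.sum_le_sum fun i hi => ?_
    have := star_left_conjugate_le_conjugate (hge i hi) (v i)
    rw [(hv i hi).star_eq] at this
    simpa using this
  · rw [← hc]
    refine Finset.sum_le_sum fun i hi => ?_
    have := star_left_conjugate_le_conjugate (hle i hi) (v i)
    rwa [(hv i hi).star_eq] at this

lemma norm_sum_conjugate_le {ι : Type*} (s : Finset ι) (v k : ι → C) {M : ℝ} (hM0 : 0 ≤ M)
    (hv : ∀ i ∈ s, IsSelfAdjoint (v i)) (hsum : ∑ i ∈ s, v i * v i = 1)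
    (hM : ∀ i ∈ s, ‖k i‖ ≤ M) : ‖∑ i ∈ s, v i * k i * v i‖ ≤ 6 * M := by
  have e : ∑ i ∈ s, v i * k i * v i = ∑ i ∈ s, v i * (realPart (k i) : C) * v i +
      Complex.I • ∑ i ∈ s, v i * (imaginaryPart (k i) : C) * v i := by
    rw [Finset.smul_sum, ← Finset.sum_add_distrib]
    refine Finset.sum_congr rfl fun i _ => ?_
    conv_lhs => rw [← realPart_add_I_smul_imaginaryPart (k i)]
    simp [mul_add, add_mul]
  have h1 := norm_sum_conjugate_le_of_isSelfAdjoint s v (fun i => (realPart (k i) : C)) hM0 hv hsum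
    (fun i _ => (realPart (k i)).2) fun i hi => (realPart.norm_le (k i)).trans (hM i hi)
  have h2 := norm_sum_conjugate_le_of_isSelfAdjoint s v (fun i => (imaginaryPart (k i) : C)) hM0 hv
    hsum (fun i _ => (imaginaryPart (k i)).2)
    fun i hi => (imaginaryPart.norm_le (k i)).trans (hM i hi)
  rw [e]
  refine (norm_add_le _ _).trans ?_
  rw [norm_smul, Complex.norm_I, one_mul]
  linarith

end Partition

/-! ### Asymptotic lifting of paths starting at zero -/

section Cone

variable {C Q : Type u} [CStarAlgebra C] [CStarAlgebra Q]

/-- The elements `f(T n) c` paired with the path `f ⊗ π c` in the quotient, where `f ↦ f(T n)` is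
the functional calculus `Θ n`. -/
def coneGenerators (π : C →⋆ₐ[ℂ] Q) (Θ : ℕ → (C(unitInterval, ℝ) →⋆ₐ[ℝ] C)) :
    Set (lp (fun _ : ℕ => C) ∞ × C(unitInterval, Q)) :=
  {z | ∃ (f : C(unitInterval, ℝ)) (c : C), f 0 = 0 ∧ (∀ n, z.1 n = Θ n f * c) ∧
    ∀ t, z.2 t = f t • π c}

/-- The null sequences in the kernel of `π`. -/
def nullSequences (π : C →⋆ₐ[ℂ] Q) : Set (lp (fun _ : ℕ => C) ∞ × C(unitInterval, Q)) :=
  {z | z.2 = 0 ∧ (∀ n, π (z.1 n) = 0) ∧ Tendsto (fun n => ‖z.1 n‖) atTop (𝓝 0)}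

variable {π : C →⋆ₐ[ℂ] Q} {Θ : ℕ → (C(unitInterval, ℝ) →⋆ₐ[ℝ] C)}

lemma exists_mem_coneGenerators (hΘ : ∀ n f, ‖Θ n f‖ ≤ ‖f‖) (f : C(unitInterval, ℝ)) (c : C) :
    ∃ z : lp (fun _ : ℕ => C) ∞ × C(unitInterval, Q), (∀ n, z.1 n = Θ n f * c) ∧
      ∀ t, z.2 t = f t • π c :=
  ⟨(⟨fun n => Θ n f * c, memℓp_infty ⟨‖f‖ * ‖c‖, by
      rintro _ ⟨n, rfl⟩
      exact (norm_mul_le _ _).trans (mul_le_mul_of_nonneg_right (hΘ n f) (norm_nonneg _))⟩⟩,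
    ⟨fun t => f t • π c, by fun_prop⟩), fun _ => rfl, fun _ => rfl⟩

lemma map_real_smul (π : C →⋆ₐ[ℂ] Q) (r : ℝ) (c : C) : π (r • c) = r • π c := by
  rw [RCLike.real_smul_eq_coe_smul (K := ℂ), map_smul, RCLike.real_smul_eq_coe_smul (K := ℂ)]

lemma map_eq_eval_one_of_mem_span (hπ : ∀ n f, π (Θ n f) = algebraMap ℝ Q (f 1))
    {z : lp (fun _ : ℕ => C) ∞ × C(unitInterval, Q)}
    (hz : z ∈ Submodule.span ℂ (coneGenerators π Θ ∪ nullSequences π)) (n : ℕ) :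
    π (z.1 n) = z.2 1 := by
  induction hz using Submodule.span_induction with
  | mem z hz =>
    rcases hz with ⟨f, c, -, h1, h2⟩ | ⟨h1, h2, -⟩
    · rw [h1, h2, map_mul, hπ, Algebra.algebraMap_eq_smul_one, smul_mul_assoc, one_mul]
    · rw [h2, h1]; rfl
  | zero => exact map_zero π
  | add x y _ _ hx hy =>
    change π (x.1 n + y.1 n) = x.2 1 + y.2 1
    rw [map_add, hx, hy]
  | smul r x _ hx =>
    change π (r • x.1 n) = r • x.2 1
    rw [map_smul, hx]

lemma mem_span_of_sub_mem_nullSequences {z w : lp (fun _ : ℕ => C) ∞ × C(unitInterval, Q)}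
    (hw : w ∈ coneGenerators π Θ) (h : z - w ∈ nullSequences π) :
    z ∈ Submodule.span ℂ (coneGenerators π Θ ∪ nullSequences π) := by
  have h1 : z - w ∈ Submodule.span ℂ (coneGenerators π Θ ∪ nullSequences π) :=
    Submodule.subset_span (Or.inr h)
  have h2 : w ∈ Submodule.span ℂ (coneGenerators π Θ ∪ nullSequences π) :=
    Submodule.subset_span (Or.inl hw)
  have := add_mem h1 h2
  rwa [sub_add_cancel] at this

/-- The products `f(T n) c g(T n) d` and `(fg)(T n) c d` differ by a term with the commutator of
`g(T n)` and `c`. This is a null sequence, and it lies in the kernel since both products have the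
same image. -/
lemma mul_mem_of_mem_coneGenerators (hΘ : ∀ n f, ‖Θ n f‖ ≤ ‖f‖)
    (hπ : ∀ n f, π (Θ n f) = algebraMap ℝ Q (f 1))
    (hc : ∀ f c, Tendsto (fun n => Θ n f * c - c * Θ n f) atTop (𝓝 0))
    {x y : lp (fun _ : ℕ => C) ∞ × C(unitInterval, Q)} (hx : x ∈ coneGenerators π Θ)
    (hy : y ∈ coneGenerators π Θ) :
    x * y ∈ Submodule.span ℂ (coneGenerators π Θ ∪ nullSequences π) := by
  obtain ⟨f, c, hf, h1, h2⟩ := id hx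
  obtain ⟨g, d, hg, h3, h4⟩ := id hy
  obtain ⟨w, hw1, hw2⟩ := exists_mem_coneGenerators (π := π) hΘ (f * g) (c * d)
  have hw : w ∈ coneGenerators π Θ := ⟨f * g, c * d, by simp [hf], hw1, hw2⟩
  have hS {z} (hz : z ∈ coneGenerators π Θ) (n : ℕ) : π (z.1 n) = z.2 1 :=
    map_eq_eval_one_of_mem_span hπ (Submodule.subset_span (Or.inl hz)) n
  refine mem_span_of_sub_mem_nullSequences hw ⟨?_, fun n => ?_, ?_⟩
  · ext t
    change x.2 t * y.2 t - w.2 t = 0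
    rw [h2, h4, hw2, map_mul, ContinuousMap.mul_apply, smul_mul_smul_comm, sub_self]
  · change π (x.1 n * y.1 n - w.1 n) = 0
    rw [map_sub, map_mul, hS hx, hS hy, hS hw, h2, h4, hw2, map_mul, ContinuousMap.mul_apply,
      smul_mul_smul_comm, sub_self]
  · rw [← tendsto_zero_iff_norm_tendsto_zero]
    have h5 := ((tendsto_zero_mul_left_of_bounded (fun n => hΘ n f) (hc g c)).mul_const d).neg
    rw [zero_mul, neg_zero] at h5
    refine h5.congr fun n => ?_
    change _ = x.1 n * y.1 n - w.1 n
    rw [h1, h3, hw1, map_mul]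
    noncomm_ring

lemma star_mem_of_mem_coneGenerators (hΘ : ∀ n f, ‖Θ n f‖ ≤ ‖f‖)
    (hπ : ∀ n f, π (Θ n f) = algebraMap ℝ Q (f 1))
    (hc : ∀ f c, Tendsto (fun n => Θ n f * c - c * Θ n f) atTop (𝓝 0))
    {x : lp (fun _ : ℕ => C) ∞ × C(unitInterval, Q)} (hx : x ∈ coneGenerators π Θ) :
    star x ∈ Submodule.span ℂ (coneGenerators π Θ ∪ nullSequences π) := by
  obtain ⟨f, c, hf, h1, h2⟩ := id hx
  obtain ⟨w, hw1, hw2⟩ := exists_mem_coneGenerators (π := π) hΘ f (star c)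
  have hw : w ∈ coneGenerators π Θ := ⟨f, star c, hf, hw1, hw2⟩
  have hS {z} (hz : z ∈ coneGenerators π Θ) (n : ℕ) : π (z.1 n) = z.2 1 :=
    map_eq_eval_one_of_mem_span hπ (Submodule.subset_span (Or.inl hz)) n
  have hstar (t : unitInterval) : star (x.2 t) = w.2 t := by
    rw [h2, hw2, star_smul, map_star]
    simp
  refine mem_span_of_sub_mem_nullSequences hw ⟨?_, fun n => ?_, ?_⟩
  · ext t
    change star (x.2 t) - w.2 t = 0
    rw [hstar, sub_self]
  · change π (star (x.1 n) - w.1 n) = 0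
    rw [map_sub, map_star, hS hx, hS hw, hstar, sub_self]
  · rw [← tendsto_zero_iff_norm_tendsto_zero]
    have h5 := (hc f (star c)).neg
    rw [neg_zero] at h5
    refine h5.congr fun n => ?_
    change _ = star (x.1 n) - w.1 n
    have : star (Θ n f) = Θ n f := by
      rw [← map_star]
      congr 1
    rw [h1, hw1, star_mul, this]
    abel

lemma mul_mem_nullSequences {x y : lp (fun _ : ℕ => C) ∞ × C(unitInterval, Q)}
    (h : x ∈ nullSequences π ∨ y ∈ nullSequences π) : x * y ∈ nullSequences π := by
  rcases h with ⟨h1, h2, h3⟩ | ⟨h1, h2, h3⟩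
  · refine ⟨by rw [Prod.snd_mul, h1, zero_mul], fun n => ?_, tendsto_norm_zero_mul h3⟩
    change π (x.1 n * y.1 n) = 0
    rw [map_mul, h2, zero_mul]
  · refine ⟨by rw [Prod.snd_mul, h1, mul_zero], fun n => ?_, tendsto_norm_zero_mul' h3⟩
    change π (x.1 n * y.1 n) = 0
    rw [map_mul, h2, mul_zero]

/-- The subalgebra spanned by the cone generators and the null sequences. -/
def coneSubalgebra (π : C →⋆ₐ[ℂ] Q) (Θ : ℕ → (C(unitInterval, ℝ) →⋆ₐ[ℝ] C))
    (hΘ : ∀ n f, ‖Θ n f‖ ≤ ‖f‖) (hπ : ∀ n f, π (Θ n f) = algebraMap ℝ Q (f 1))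
    (hc : ∀ f c, Tendsto (fun n => Θ n f * c - c * Θ n f) atTop (𝓝 0)) :
    NonUnitalStarSubalgebra ℂ (lp (fun _ : ℕ => C) ∞ × C(unitInterval, Q)) where
  carrier := Submodule.span ℂ (coneGenerators π Θ ∪ nullSequences π)
  add_mem' := add_mem
  zero_mem' := zero_mem _
  smul_mem' r _ hx := Submodule.smul_mem _ r hx
  mul_mem' {a b} ha hb := by
    refine Submodule.span_induction₂ (R := ℂ) (p := fun x y _ _ =>
      x * y ∈ Submodule.span ℂ (coneGenerators π Θ ∪ nullSequences π)) ?_ ?_ ?_ ?_ ?_ ?_ ?_ ha hb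
    · rintro x y (hx | hx) (hy | hy)
      · exact mul_mem_of_mem_coneGenerators hΘ hπ hc hx hy
      · exact Submodule.subset_span (Or.inr (mul_mem_nullSequences (Or.inr hy)))
      · exact Submodule.subset_span (Or.inr (mul_mem_nullSequences (Or.inl hx)))
      · exact Submodule.subset_span (Or.inr (mul_mem_nullSequences (Or.inl hx)))
    · intro y _
      rw [zero_mul]
      exact zero_mem _
    · intro y _
      rw [mul_zero]
      exact zero_mem _
    · intro x y z _ _ _ hx hy
      rw [add_mul]
      exact add_mem hx hy
    · intro x y z _ _ _ hx hy
      rw [mul_add]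
      exact add_mem hx hy
    · intro r x y _ _ h
      rw [smul_mul_assoc]
      exact Submodule.smul_mem _ r h
    · intro r x y _ _ h
      rw [mul_smul_comm]
      exact Submodule.smul_mem _ r h
  star_mem' {a} ha := by
    change a ∈ Submodule.span ℂ (coneGenerators π Θ ∪ nullSequences π) at ha
    change star a ∈ Submodule.span ℂ (coneGenerators π Θ ∪ nullSequences π)
    induction ha using Submodule.span_induction with
    | mem x hx =>
      rcases hx with hx | ⟨h1, h2, h3⟩
      · exact star_mem_of_mem_coneGenerators hΘ hπ hc hx
      · refine Submodule.subset_span (Or.inr ⟨?_, fun n => ?_, ?_⟩)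
        · rw [Prod.snd_star, h1, star_zero]
        · change π (star (x.1 n)) = 0
          rw [map_star, h2, star_zero]
        · exact h3.congr fun n => (norm_star (x.1 n)).symm
    | zero => rw [star_zero]; exact zero_mem _
    | add x y _ _ hx hy => rw [star_add]; exact add_mem hx hy
    | smul r x _ hx => rw [star_smul]; exact Submodule.smul_mem _ _ hx

lemma norm_bernsteinApproximation_sub_le (hΘ : ∀ n f, ‖Θ n f‖ ≤ ‖f‖) (f : C(unitInterval, ℝ))
    (c : C) {ε : ℝ} (hε : 0 < ε) : ∀ᶠ m in atTop, ∀ n,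
      ‖Θ n f * c - ∑ k : Fin (m + 1), Θ n (bernstein m k) * (f (bernstein.z k) • c)‖ ≤ ε := by
  have h := (bernsteinApproximation_uniform f).eventually
    (Metric.ball_mem_nhds f (show 0 < ε / (‖c‖ + 1) by positivity))
  filter_upwards [h] with m hm n
  have e : Θ n f * c - ∑ k : Fin (m + 1), Θ n (bernstein m k) * (f (bernstein.z k) • c) =
      Θ n (f - bernsteinApproximation m f) * c := by
    rw [map_sub, sub_mul]
    congr 1
    have : bernsteinApproximation m f =
        ∑ k : Fin (m + 1), f (bernstein.z k) • bernstein m k := by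
      ext t
      rw [bernsteinApproximation.apply]
      simp [mul_comm]
    rw [this, map_sum, Finset.sum_mul]
    refine Finset.sum_congr rfl fun k _ => ?_
    rw [map_smul, mul_smul_comm, smul_mul_assoc]
  rw [e]
  have h1 : ‖f - bernsteinApproximation m f‖ < ε / (‖c‖ + 1) := by
    rw [← dist_eq_norm, dist_comm]
    exact hm
  calc _ ≤ ‖Θ n (f - bernsteinApproximation m f)‖ * ‖c‖ := norm_mul_le _ _
    _ ≤ ε / (‖c‖ + 1) * (‖c‖ + 1) := by
      refine mul_le_mul ((hΘ n _).trans h1.le) (by linarith) (norm_nonneg _) (by positivity)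
    _ = ε := by field_simp

/-- Elements of the cone subalgebra are approximated by Bernstein sums of a path of lifts. -/
lemma exists_bernstein_approx (hΘ : ∀ n f, ‖Θ n f‖ ≤ ‖f‖)
    {z : lp (fun _ : ℕ => C) ∞ × C(unitInterval, Q)}
    (hz : z ∈ Submodule.span ℂ (coneGenerators π Θ ∪ nullSequences π)) :
    ∃ h : unitInterval → C, h 0 = 0 ∧ (∀ t, π (h t) = z.2 t) ∧ ∀ ε > 0, ∀ᶠ m in atTop,
      ∀ᶠ n in atTop, ‖z.1 n - ∑ k : Fin (m + 1), Θ n (bernstein m k) * h (bernstein.z k)‖ ≤ ε := by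
  induction hz using Submodule.span_induction with
  | mem z hz =>
    rcases hz with ⟨f, c, hf, h1, h2⟩ | ⟨h1, h2, h3⟩
    · refine ⟨fun t => f t • c, by simp [hf], fun t => by rw [h2, map_real_smul], fun ε hε => ?_⟩
      filter_upwards [norm_bernsteinApproximation_sub_le hΘ f c hε] with m hm
      filter_upwards with n
      rw [h1]
      exact hm n
    · refine ⟨fun _ => 0, rfl, fun t => by simp [h1], fun ε hε => ?_⟩
      filter_upwards with m
      filter_upwards [h3.eventually (gt_mem_nhds hε)] with n hn
      simpa using hn.le
  | zero =>
    refine ⟨fun _ => 0, rfl, fun t => by simp, fun ε hε => ?_⟩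
    filter_upwards with m
    filter_upwards with n
    change ‖(0 : C) - _‖ ≤ ε
    simpa using hε.le
  | add x y _ _ hx hy =>
    obtain ⟨h, h0, hπ, happ⟩ := hx
    obtain ⟨h', h0', hπ', happ'⟩ := hy
    refine ⟨fun t => h t + h' t, by simp [h0, h0'], fun t => ?_, fun ε hε => ?_⟩
    · rw [map_add, hπ, hπ']; rfl
    filter_upwards [happ (ε / 2) (half_pos hε), happ' (ε / 2) (half_pos hε)] with m hm hm'
    filter_upwards [hm, hm'] with n hn hn'
    change ‖x.1 n + y.1 n - _‖ ≤ ε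
    simp only [mul_add, Finset.sum_add_distrib]
    rw [add_sub_add_comm]
    exact (norm_add_le _ _).trans (by linarith)
  | smul r x _ hx =>
    obtain ⟨h, h0, hπ, happ⟩ := hx
    refine ⟨fun t => r • h t, by simp [h0], fun t => ?_, fun ε hε => ?_⟩
    · rw [map_smul, hπ]; rfl
    filter_upwards [happ (ε / (‖r‖ + 1)) (by positivity)] with m hm
    filter_upwards [hm] with n hn
    change ‖r • x.1 n - _‖ ≤ ε
    simp only [mul_smul_comm, ← Finset.smul_sum]
    rw [← smul_sub, norm_smul]
    calc _ ≤ (‖r‖ + 1) * (ε / (‖r‖ + 1)) :=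
          mul_le_mul (by linarith) hn (norm_nonneg _) (by positivity)
      _ = ε := by field_simp

/-- Replace `z.1 n` by a Bernstein sum of lifts of the values of `z.2`, and exchange these for lifts
of norm at most `2 ‖z.2‖`. With the square roots of the Bernstein functions moved to both sides, the
sum becomes a conjugation by a partition of unity. The constant is `12 = 6 * 2`. -/
lemma eventually_norm_le_of_mem_span (hsurj : Function.Surjective π)
    (hΘ : ∀ n f, ‖Θ n f‖ ≤ ‖f‖)
    (hj : ∀ f j, π j = 0 → Tendsto (fun n => Θ n f * j - f 0 • j) atTop (𝓝 0))
    (hc : ∀ f c, Tendsto (fun n => Θ n f * c - c * Θ n f) atTop (𝓝 0))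
    {z : lp (fun _ : ℕ => C) ∞ × C(unitInterval, Q)}
    (hz : z ∈ Submodule.span ℂ (coneGenerators π Θ ∪ nullSequences π)) {ε : ℝ} (hε : 0 < ε) :
    ∀ᶠ n in atTop, ‖z.1 n‖ ≤ 12 * ‖z.2‖ + ε := by
  let _ := CStarAlgebra.spectralOrder C
  let _ := CStarAlgebra.spectralOrderedRing C
  obtain ⟨h, h0, hh, happ⟩ := exists_bernstein_approx hΘ hz
  obtain ⟨m, hm⟩ := (happ (ε / 2) (half_pos hε)).exists
  choose k hk hkn using fun j : Fin (m + 1) =>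
    exists_preimage_norm_le (π : C →⋆ₙₐ[ℂ] Q) (hsurj (z.2 (bernstein.z j)))
  have hkn' (j : Fin (m + 1)) : ‖k j‖ ≤ 2 * ‖z.2‖ :=
    (hkn j).trans (by linarith [z.2.norm_coe_le_norm (bernstein.z j)])
  let v (j : Fin (m + 1)) : C(unitInterval, ℝ) :=
    ⟨fun t => Real.sqrt (bernstein m j t), by fun_prop⟩
  have hv (j : Fin (m + 1)) : v j * v j = bernstein m j := by
    ext t
    exact Real.mul_self_sqrt bernstein_nonneg
  have hterm (j : Fin (m + 1)) : Tendsto (fun n => Θ n (bernstein m j) * h (bernstein.z j) -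
      Θ n (v j) * k j * Θ n (v j)) atTop (𝓝 0) := by
    -- On the kernel `b(T n)` acts asymptotically as `b 0`. This vanishes for every Bernstein
    -- function except the one with index 0, where both lifts are zero.
    have h1 : (bernstein m j) 0 • (h (bernstein.z j) - k j) = 0 := by
      by_cases hj0 : j = 0
      · subst hj0
        have e : (bernstein.z (0 : Fin (m + 1))) = 0 := bernstein.z_zero
        have hk0 : k 0 = 0 := by
          have h2 := hkn 0
          rw [e, ← hh, h0, map_zero, norm_zero, mul_zero] at h2
          exact norm_le_zero_iff.1 h2
        rw [e, h0, hk0, sub_zero, smul_zero]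
      · have : (j : ℕ) ≠ 0 := fun h => hj0 (Fin.ext h)
        rw [bernstein_apply]
        simp [this]
    have h2 := hj (bernstein m j) (h (bernstein.z j) - k j) (by
      rw [map_sub, hh, sub_eq_zero]; exact (hk j).symm)
    rw [h1] at h2
    have h3 := h2.add (tendsto_zero_mul_left_of_bounded (fun n => hΘ n (v j)) (hc (v j) (k j)))
    rw [add_zero] at h3
    refine h3.congr fun n => ?_
    rw [← hv, map_mul]
    noncomm_ring
  have hsum := tendsto_finsetSum Finset.univ fun j (_ : j ∈ Finset.univ) => hterm j
  rw [Finset.sum_const_zero, tendsto_zero_iff_norm_tendsto_zero] at hsum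
  filter_upwards [hm, hsum.eventually (gt_mem_nhds (half_pos hε))] with n hn1 hn2
  have hb := norm_sum_conjugate_le Finset.univ (fun j => Θ n (v j)) k
    (show 0 ≤ 2 * ‖z.2‖ by positivity)
    (fun j _ => by
      rw [isSelfAdjoint_iff, ← map_star]
      congr 1)
    (by
      have : ∑ j : Fin (m + 1), v j * v j = 1 := by
        ext t
        simp only [hv]
        rw [ContinuousMap.sum_apply]
        exact bernstein.probability m t
      simp only [← map_mul]
      rw [← map_sum, this, map_one])
    (fun j _ => hkn' j)
  have e : z.1 n = (z.1 n - ∑ j : Fin (m + 1), Θ n (bernstein m j) * h (bernstein.z j)) +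
      (∑ j : Fin (m + 1), (Θ n (bernstein m j) * h (bernstein.z j) -
        Θ n (v j) * k j * Θ n (v j))) + ∑ j : Fin (m + 1), Θ n (v j) * k j * Θ n (v j) := by
    rw [Finset.sum_sub_distrib]
    abel
  rw [e]
  refine (norm_add₃_le).trans ?_
  linarith

/-- Lifting at the end of a path which starts at zero, in the unital case. -/
lemma SemiprojectiveHom.exists_lift_path_unital {A B : Type u} [NonUnitalCStarAlgebra A]
    [NonUnitalCStarAlgebra B] [TopologicalSpace.SeparableSpace B]
    [TopologicalSpace.SeparableSpace C] {φ : A →⋆ₙₐ[ℂ] B} (hφ : SemiprojectiveHom φ)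
    (hsurj : Function.Surjective π) (τ : B →⋆ₙₐ[ℂ] C(unitInterval, Q)) (hτ : ∀ b, τ b 0 = 0) :
    ∃ ψ : A →⋆ₙₐ[ℂ] C, ∀ a, π (ψ a) = τ (φ a) 1 := by
  obtain ⟨Θ, hΘ, hπ, hj, hc⟩ := exists_quasicentral_calculus π
  obtain ⟨n, ψ, hψ⟩ := hφ.exists_lift_of_asymptotic (coneSubalgebra π Θ hΘ hπ hc)
    (show (0 : ℝ) ≤ 12 by norm_num)
    (fun z hz ε hε => eventually_norm_le_of_mem_span hsurj hΘ hj hc hz hε) τ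
    -- The Bernstein approximations of the path are projections of elements of the span: the term of
    -- index 0 vanishes because the path starts at zero, and the other Bernstein functions vanish at
    -- 0.
    (fun b => by
      refine mem_closure_of_tendsto (bernsteinApproximation_uniform (τ b))
        (Eventually.of_forall fun m => ?_)
      have hmem : bernsteinApproximation m (τ b) ∈
          (Submodule.span ℂ (coneGenerators π Θ ∪ nullSequences π)).map
            (LinearMap.snd ℂ (lp (fun _ : ℕ => C) ∞) C(unitInterval, Q)) := by
        refine Submodule.sum_mem _ fun k _ => ?_
        by_cases hk : k = 0
        · subst hk
          have e : τ b (bernstein.z (0 : Fin (m + 1))) = 0 := by rw [bernstein.z_zero, hτ]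
          rw [e]
          convert! Submodule.zero_mem _
          ext t
          simp
        · obtain ⟨c, hc'⟩ := hsurj (τ b (bernstein.z k))
          obtain ⟨w, hw1, hw2⟩ := exists_mem_coneGenerators (π := π) hΘ (bernstein m k) c
          refine ⟨w, Submodule.subset_span (Or.inl ⟨bernstein m k, c, ?_, hw1, hw2⟩), ?_⟩
          · have : (k : ℕ) ≠ 0 := fun h => hk (Fin.ext h)
            rw [bernstein_apply]
            simp [this]
          · ext t
            change w.2 t = _
            rw [hw2, hc']
            rfl
      obtain ⟨w, hw, hw'⟩ := hmem
      exact ⟨w, hw, hw'⟩)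
    (fun _ => (π : C →⋆ₙₐ[ℂ] Q)) (fun _ => evalHom Q 1)
    (fun z hz n => map_eq_eval_one_of_mem_span hπ hz n)
  exact ⟨ψ, hψ⟩

end Cone

/-! ### Unitizations -/

section Unitization

lemma separableSpace_unitization (C : Type*) [NonUnitalCStarAlgebra C]
    [TopologicalSpace.SeparableSpace C] :
    TopologicalSpace.SeparableSpace (Unitization ℂ C) := by
  have hc : Continuous fun p : ℂ × C =>
      algebraMap ℂ (Unitization ℂ C) p.1 + (p.2 : Unitization ℂ C) := by
    have h1 : Continuous fun c : C => (c : Unitization ℂ C) :=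
      (Unitization.isometry_inr (𝕜 := ℂ)).continuous
    exact ((algebraMapCLM ℂ (Unitization ℂ C)).continuous.comp continuous_fst).add
      (h1.comp continuous_snd)
  refine Function.Surjective.denseRange (f := fun p : ℂ × C =>
      algebraMap ℂ (Unitization ℂ C) p.1 + (p.2 : Unitization ℂ C)) ?_ |>.separableSpace hc
  intro x
  exact ⟨(x.fst, x.snd), Unitization.inl_fst_add_inr_snd_eq x⟩

/-- A homomorphism into the unitization with values in the algebra itself. -/
lemma exists_hom_of_fst_eq_zero {A C : Type*} [NonUnitalCStarAlgebra A] [NonUnitalCStarAlgebra C]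
    (ψ : A →⋆ₙₐ[ℂ] Unitization ℂ C) (h : ∀ a, (ψ a).fst = 0) :
    ∃ χ : A →⋆ₙₐ[ℂ] C, ∀ a, (χ a : Unitization ℂ C) = ψ a := by
  have hs (a : A) : ((ψ a).snd : Unitization ℂ C) = ψ a := by
    ext
    · simp [h]
    · simp
  have hinj := Unitization.inr_injective (R := ℂ) (A := C)
  refine ⟨{ toFun := fun a => (ψ a).snd, map_smul' := ?_, map_zero' := ?_, map_add' := ?_,
            map_mul' := ?_, map_star' := ?_ }, hs⟩
  · intro r a
    exact hinj (by simp [hs])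
  · simp
  · intro a b
    simp
  · intro a b
    exact hinj (by simp [hs, h])
  · intro a
    simp [map_star]

end Unitization

/-! ### Null-homotopic maps and projectivity -/

section Projective

variable {A B D : Type u} [NonUnitalCStarAlgebra A] [NonUnitalCStarAlgebra B]
  [NonUnitalCStarAlgebra D]

/-- A semiprojective morphism followed by a null-homotopic one is projective. -/
theorem SemiprojectiveHom.projectiveHom_comp [TopologicalSpace.SeparableSpace B]
    {φ : A →⋆ₙₐ[ℂ] B} (hφ : SemiprojectiveHom φ) {δ : B →⋆ₙₐ[ℂ] D} (hδ : Homotopic δ 0) :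
    ProjectiveHom (δ.comp φ) := by
  intro C Q _ _ _ J π hJ hπ σ
  -- Reversed, the homotopy starts at zero and ends at `δ`, as lifting of path endpoints requires.
  obtain ⟨H, hH, H0, H1⟩ := hδ.symm
  have := separableSpace_unitization C
  let inrQ : Q →⋆ₙₐ[ℂ] Unitization ℂ Q := Unitization.inrNonUnitalStarAlgHom ℂ Q
  have hcont (b : B) : Continuous fun t => ((inrQ.comp σ).comp (H t)) b :=
    (continuous_hom (inrQ.comp σ)).comp (hH b)
  obtain ⟨ψ, hψ⟩ := hφ.exists_lift_path_unital (π := Unitization.starMap π)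
    (Unitization.starMap_surjective hπ.surjective)
    (pathHom (fun t => (inrQ.comp σ).comp (H t)) hcont)
    (fun b => by
      rw [pathHom_apply, H0]
      exact map_zero (inrQ.comp σ))
  have hψ' (a : A) : Unitization.starMap π (ψ a) = ((σ (δ (φ a)) : Q) : Unitization ℂ Q) := by
    rw [hψ, pathHom_apply, H1]
    rfl
  -- The unitized quotient map preserves scalar parts, so a lift of an element of `Q` lies in `C`.
  obtain ⟨χ, hχ⟩ := exists_hom_of_fst_eq_zero ψ (fun a => by
    have := congrArg (fun x : Unitization ℂ Q => x.fst) (hψ' a)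
    simpa [Unitization.algebraMap_eq_inl] using this)
  refine ⟨χ, NonUnitalStarAlgHom.ext fun a => ?_⟩
  have h1 := hψ' a
  rw [← hχ, Unitization.starMap_inr] at h1
  exact Unitization.inr_injective h1

end Projective

/-! ### Trivial shape implies weak projectivity -/

section TrivialShape

open InductiveSystem

lemma Homotopic.comp {A B D : Type u} [NonUnitalCStarAlgebra A] [NonUnitalCStarAlgebra B]
    [NonUnitalCStarAlgebra D] {φ φ' : A →⋆ₙₐ[ℂ] B} {ψ ψ' : B →⋆ₙₐ[ℂ] D} (h : Homotopic ψ ψ')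
    (h' : Homotopic φ φ') : Homotopic (ψ.comp φ) (ψ'.comp φ') :=
  (h'.comp_left ψ).trans (h.comp_right φ')

/-- In a shape system of an algebra of trivial shape, equivalent to a shape system of the zero
algebra, the connecting morphisms are eventually null-homotopic. -/
lemma exists_nullHomotopic_of_equivalent {S T : InductiveSystem.{u}}
    (hT : T.IsShapeSystem PUnit.{u + 1}) (hST : S.Equivalent T) (m : ℕ) :
    ∃ l, ∃ h : m ≤ l, Homotopic (S.trans h) 0 := by
  obtain ⟨k, n, hkn, hnk, α, β, hβα, hαβ⟩ := hST
  have hk : StrictMono k := strictMono_nat_of_lt_succ fun i => (hkn i).trans (hnk i)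
  have hn : StrictMono n := strictMono_nat_of_lt_succ fun i => (hnk i).trans (hkn (i + 1))
  -- The maps `α` commute with the connecting maps up to homotopy. Composing with `β j` then carries
  -- null homotopies from `T` to `S`.
  have key (i j : ℕ) (hij : i ≤ j) : Homotopic ((α j).comp (S.trans (hk.monotone hij)))
      ((T.trans (hn.monotone hij)).comp (α i)) := by
    induction j, hij using Nat.le_induction with
    | base =>
      rw [trans_self, trans_self]
      exact Homotopic.refl _
    | succ j hij ih =>
      rw [S.trans_trans (hk.monotone hij) (hk.monotone j.le_succ),
        T.trans_trans (hn.monotone hij) (hn.monotone j.le_succ)]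
      have h1 : Homotopic ((α (j + 1)).comp
          ((S.trans (hk.monotone j.le_succ)).comp (S.trans (hk.monotone hij))))
          (((α (j + 1)).comp (β j)).comp ((α j).comp (S.trans (hk.monotone hij)))) :=
        (((hβα j).symm.comp_right _).comp_left (α (j + 1)))
      exact h1.trans ((hαβ j).comp ih)
  obtain ⟨i, hi⟩ : ∃ i, m ≤ k i := ⟨m, hk.le_apply⟩
  obtain ⟨p, hp, hTp⟩ := exists_nullHomotopic_of_zero hT (n i)
  obtain ⟨j, hj⟩ : ∃ j, i ≤ j ∧ p ≤ n j :=
    ⟨max i p, le_max_left _ _, (le_max_right i p).trans hn.le_apply⟩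
  have hTj : Homotopic (T.trans (hn.monotone hj.1)) 0 := by
    have := hTp.comp_left (T.trans hj.2)
    rw [← T.trans_trans hp hj.2] at this
    have e : (T.trans hj.2).comp (0 : T.obj (n i) →⋆ₙₐ[ℂ] T.obj p) = 0 :=
      NonUnitalStarAlgHom.ext fun x => map_zero (T.trans hj.2)
    rwa [e] at this
  have h1 : Homotopic (S.trans (hk.monotone (hj.1.trans j.le_succ))) 0 := by
    rw [S.trans_trans (hk.monotone hj.1) (hk.monotone j.le_succ)]
    have h2 : Homotopic ((S.trans (hk.monotone j.le_succ)).comp (S.trans (hk.monotone hj.1)))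
        ((β j).comp ((α j).comp (S.trans (hk.monotone hj.1)))) := (hβα j).symm.comp_right _
    refine h2.trans (((key i j hj.1).trans (hTj.comp_right (α i))).comp_left (β j) |>.trans ?_)
    have e : (β j).comp ((0 : T.obj (n i) →⋆ₙₐ[ℂ] T.obj (n j)).comp (α i)) = 0 :=
      NonUnitalStarAlgHom.ext fun x => map_zero (β j)
    rw [e]
    exact Homotopic.refl _
  refine ⟨k (j + 1), hi.trans (hk.monotone (hj.1.trans j.le_succ)), ?_⟩
  rw [S.trans_trans hi (hk.monotone (hj.1.trans j.le_succ))]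
  exact h1.comp_right (S.trans hi)

/-- An approximate map from `A` to `S.obj n` is followed by an exact lift of `σ ∘ ι n`. The lift
exists because a connecting map is semiprojective and a later composite is null-homotopic. -/
theorem IsWeaklySemiprojective.isWeaklyProjective {A : Type u} [NonUnitalCStarAlgebra A]
    [TopologicalSpace.SeparableSpace A] (hA : IsWeaklySemiprojective A) (hA' : HasTrivialShape A) :
    IsWeaklyProjective A := by
  obtain ⟨S, T, ⟨⟨ι, hι⟩, hS⟩, hT, hST⟩ := hA'
  intro C Q _ _ _ J π hJ hπ σ ε F hε
  obtain ⟨n, ψ, hψ⟩ := exists_approx_section hι hA F hε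
  -- The null homotopy starts at `n + 1`: the step from `n` to `n + 1` supplies the semiprojective
  -- factor.
  obtain ⟨l, hl, hnull⟩ := exists_nullHomotopic_of_equivalent hT hST (n + 1)
  obtain ⟨χ, hχ⟩ := (hS n).projectiveHom_comp hnull C Q J π hJ hπ (σ.comp (ι l))
  have hχ' (x : S.obj n) : π (χ x) = σ (ι n x) := by
    have h1 : π (χ x) = σ (ι l (S.trans hl (S.map n x))) := DFunLike.congr_fun hχ x
    have h2 : ι (n + 1) (S.map n x) = ι n x := DFunLike.congr_fun (hι.compat n) x
    rw [h1, hι.apply_trans, h2]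
  refine ⟨χ.comp ψ, fun a ha => ?_⟩
  change ‖π (χ (ψ a)) - σ a‖ < ε
  rw [hχ', ← map_sub]
  exact (NonUnitalStarAlgHom.norm_apply_le σ _).trans_lt (hψ a ha)

end TrivialShape

/-! ### Generated subalgebras and factorization -/

section Generated

variable {C : Type*} [NonUnitalCStarAlgebra C]

lemma generated_induction {s : Set C} {p : generated s → Prop}
    (mem : ∀ x (hx : x ∈ s), p ⟨x, subset_generated s hx⟩) (zero : p 0)
    (add : ∀ x y, p x → p y → p (x + y)) (mul : ∀ x y, p x → p y → p (x * y))
    (smul : ∀ (r : ℂ) x, p x → p (r • x)) (star : ∀ x, p x → p (star x))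
    (closed : IsClosed {x | p x}) (x : generated s) : p x := by
  let S : NonUnitalStarSubalgebra ℂ C :=
    { carrier := {y | ∃ h : y ∈ generated s, p ⟨y, h⟩}
      add_mem' := by
        rintro a b ⟨ha, ha'⟩ ⟨hb, hb'⟩
        exact ⟨add_mem ha hb, add _ _ ha' hb'⟩
      zero_mem' := ⟨zero_mem _, zero⟩
      mul_mem' := by
        rintro a b ⟨ha, ha'⟩ ⟨hb, hb'⟩
        exact ⟨mul_mem ha hb, mul _ _ ha' hb'⟩
      smul_mem' := by
        rintro r a ⟨ha, ha'⟩
        exact ⟨SMulMemClass.smul_mem r ha, smul _ _ ha'⟩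
      star_mem' := by
        rintro a ⟨ha, ha'⟩
        exact ⟨star_mem ha, star _ ha'⟩ }
  have hS : (S : Set C) = Subtype.val '' {x : generated s | p x} := by
    ext y
    constructor
    · rintro ⟨h, hp⟩
      exact ⟨⟨y, h⟩, hp, rfl⟩
    · rintro ⟨⟨y, h⟩, hp, rfl⟩
      exact ⟨h, hp⟩
  have hcl : IsClosed (S : Set C) := by
    rw [hS]
    exact (isClosed_generated s).isClosedEmbedding_subtypeVal.isClosedMap _ closed
  obtain ⟨_, hp⟩ := generated_le hcl (fun y hy => ⟨subset_generated s hy, mem y hy⟩) x.2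
  exact hp

/-- A homomorphism factors through a surjective one with smaller kernel. -/
lemma exists_factor {F E B : Type*} [NonUnitalCStarAlgebra F] [NonUnitalCStarAlgebra E]
    [NonUnitalCStarAlgebra B] {q : F →⋆ₙₐ[ℂ] E} (hq : Function.Surjective q) (f : F →⋆ₙₐ[ℂ] B)
    (h : ∀ y, q y = 0 → f y = 0) : ∃ g : E →⋆ₙₐ[ℂ] B, ∀ y, g (q y) = f y := by
  have key : ∀ y y', q y = q y' → f y = f y' := fun y y' hy =>
    sub_eq_zero.1 (by rw [← map_sub]; exact h _ (by rw [map_sub, hy, sub_self]))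
  let s := Function.surjInv hq
  have hs : ∀ e, q (s e) = e := Function.surjInv_eq hq
  refine ⟨{ toFun := fun e => f (s e), map_smul' := ?_, map_zero' := ?_, map_add' := ?_,
            map_mul' := ?_, map_star' := ?_ }, fun y => key _ _ (hs _)⟩
  · intro r e
    change f (s (r • e)) = r • f (s e)
    rw [← map_smul]
    exact key _ _ (by simp [hs])
  · exact h _ (hs 0)
  · intro a b
    change f (s (a + b)) = f (s a) + f (s b)
    rw [← map_add]
    exact key _ _ (by simp [hs])
  · intro a b
    rw [← map_mul]
    exact key _ _ (by simp [hs])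
  · intro a
    rw [← map_star]
    exact key _ _ (by simp [hs, map_star])

end Generated

/-! ### The universal algebra of a sequence of selfadjoint contractions -/

section Universal

/-- Formal star polynomials without constant term in a sequence of variables. -/
inductive Term : Type
  | gen : ℕ → Term
  | add : Term → Term → Term
  | mul : Term → Term → Term
  | smul : ℂ → Term → Term
  | star : Term → Term

/-- Evaluation of a formal star polynomial. -/
def Term.eval {B : Type*} [NonUnitalCStarAlgebra B] (x : ℕ → B) : Term → B
  | .gen n => x n
  | .add s t => s.eval x + t.eval x
  | .mul s t => s.eval x * t.eval x
  | .smul r t => r • t.eval x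
  | .star t => Star.star (t.eval x)

lemma Term.map_eval {B D : Type*} [NonUnitalCStarAlgebra B] [NonUnitalCStarAlgebra D]
    (f : B →⋆ₙₐ[ℂ] D) (x : ℕ → B) (t : Term) : f (t.eval x) = t.eval fun n => f (x n) := by
  induction t with
  | gen n => rfl
  | add s t hs ht => simp [Term.eval, hs, ht]
  | mul s t hs ht => simp [Term.eval, hs, ht]
  | smul r t ht => simp [Term.eval, ht]
  | star t ht => simp [Term.eval, ht, map_star]

lemma exists_term_of_mem_adjoin {B : Type*} [NonUnitalCStarAlgebra B] (x : ℕ → B) {b : B}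
    (hb : b ∈ NonUnitalStarAlgebra.adjoin ℂ (Set.range x)) : ∃ t : Term, t.eval x = b := by
  induction hb using NonUnitalStarAlgebra.adjoin_induction with
  | mem y hy =>
    obtain ⟨n, rfl⟩ := hy
    exact ⟨.gen n, rfl⟩
  | zero => exact ⟨.smul 0 (.gen 0), by simp [Term.eval]⟩
  | add a b _ _ ha hb =>
    obtain ⟨s, rfl⟩ := ha
    obtain ⟨t, rfl⟩ := hb
    exact ⟨.add s t, rfl⟩
  | mul a b _ _ ha hb =>
    obtain ⟨s, rfl⟩ := ha
    obtain ⟨t, rfl⟩ := hb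
    exact ⟨.mul s t, rfl⟩
  | smul r a _ ha =>
    obtain ⟨s, rfl⟩ := ha
    exact ⟨.smul r s, rfl⟩
  | star a _ ha =>
    obtain ⟨s, rfl⟩ := ha
    exact ⟨.star s, rfl⟩

/-- A homomorphism is defined by its values on generators, subject to norm estimates. -/
lemma exists_hom_of_norm_eval_le {F B : Type*} [NonUnitalCStarAlgebra F] [NonUnitalCStarAlgebra B]
    {g : ℕ → F} {x : ℕ → B} (hg : ∀ y, y ∈ generated (Set.range g))
    (h : ∀ t : Term, ‖t.eval x‖ ≤ ‖t.eval g‖) : ∃ f : F →⋆ₙₐ[ℂ] B, ∀ n, f (g n) = x n := by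
  -- The closed subalgebra generated by these pairs is the graph of the homomorphism; the norm
  -- estimates extend to it and make it single-valued.
  let w (n : ℕ) : F × B := (g n, x n)
  let fstH : generated (Set.range w) →⋆ₙₐ[ℂ] F :=
    (NonUnitalStarAlgHom.fst ℂ _ _).comp (NonUnitalStarSubalgebraClass.subtype _)
  let sndH : generated (Set.range w) →⋆ₙₐ[ℂ] B :=
    (NonUnitalStarAlgHom.snd ℂ _ _).comp (NonUnitalStarSubalgebraClass.subtype _)
  have hle : ∀ z : F × B, z ∈ generated (Set.range w) → ‖z.2‖ ≤ ‖z.1‖ := by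
    intro z hz
    refine closure_minimal (t := {z : F × B | ‖z.2‖ ≤ ‖z.1‖}) ?_
      (isClosed_le continuous_snd.norm continuous_fst.norm) hz
    intro z hz
    obtain ⟨t, rfl⟩ := exists_term_of_mem_adjoin w hz
    have h1 : (t.eval w).2 = t.eval x := t.map_eval (NonUnitalStarAlgHom.snd ℂ F B) w
    have h2 : (t.eval w).1 = t.eval g := t.map_eval (NonUnitalStarAlgHom.fst ℂ F B) w
    change ‖(t.eval w).2‖ ≤ ‖(t.eval w).1‖
    rw [h1, h2]
    exact h t
  have hsurj : Function.Surjective fstH := by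
    intro y
    refine generated_le (S := NonUnitalStarAlgHom.range fstH) ?_ ?_ (hg y)
    · rw [NonUnitalStarAlgHom.coe_range]
      exact isClosed_range fstH
    · rintro _ ⟨n, rfl⟩
      exact ⟨⟨w n, subset_generated _ ⟨n, rfl⟩⟩, rfl⟩
  obtain ⟨f, hf⟩ := exists_factor hsurj sndH (fun y hy => by
    have h1 : (y : F × B).1 = 0 := hy
    have h2 := hle y y.2
    rw [h1, norm_zero] at h2
    exact norm_le_zero_iff.1 h2)
  exact ⟨f, fun n => hf ⟨w n, subset_generated _ ⟨n, rfl⟩⟩⟩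

/-- Sequences of selfadjoint contractions. -/
def IsContractionSeq {B : Type*} [NonUnitalCStarAlgebra B] (x : ℕ → B) : Prop :=
  ∀ n, IsSelfAdjoint (x n) ∧ ‖x n‖ ≤ 1

/-- The norms on formal star polynomials given by sequences of selfadjoint contractions. -/
def termNorms : Set (Term → ℝ) :=
  {ν | ∃ (B : Type u) (_ : NonUnitalCStarAlgebra B) (x : ℕ → B), IsContractionSeq x ∧
    ∀ t : Term, ν t = ‖t.eval x‖}

/-- An algebra realizing a given norm on formal star polynomials. -/
def ModelAlg (ν : termNorms.{u}) : Type u := ν.2.choose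

noncomputable instance (ν : termNorms.{u}) : NonUnitalCStarAlgebra (ModelAlg ν) :=
  ν.2.choose_spec.choose

/-- The sequence realizing a given norm on formal star polynomials. -/
noncomputable def modelSeq (ν : termNorms.{u}) : ℕ → ModelAlg ν :=
  ν.2.choose_spec.choose_spec.choose

lemma isContractionSeq_modelSeq (ν : termNorms.{u}) : IsContractionSeq (modelSeq ν) :=
  ν.2.choose_spec.choose_spec.choose_spec.1

lemma norm_eval_modelSeq (ν : termNorms.{u}) (t : Term) : ‖t.eval (modelSeq ν)‖ = ν.1 t :=
  (ν.2.choose_spec.choose_spec.choose_spec.2 t).symm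

/-- The universal sequence of selfadjoint contractions. -/
noncomputable def univSeq (n : ℕ) : lp ModelAlg.{u} ∞ :=
  ⟨fun ν => modelSeq ν n, memℓp_infty ⟨1, by
    rintro _ ⟨ν, rfl⟩
    exact (isContractionSeq_modelSeq ν n).2⟩⟩

/-- The universal C*-algebra generated by a sequence of selfadjoint contractions. -/
def UnivAlg : Type u := generated (Set.range univSeq.{u})

noncomputable instance : NonUnitalCStarAlgebra UnivAlg.{u} :=
  inferInstanceAs (NonUnitalCStarAlgebra (generated (Set.range univSeq.{u})))

instance : TopologicalSpace.SeparableSpace UnivAlg.{u} :=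
  separableSpace_generated (Set.countable_range _)

/-- The generators of the universal algebra. -/
noncomputable def univGen (n : ℕ) : UnivAlg.{u} := ⟨univSeq n, subset_generated _ ⟨n, rfl⟩⟩

lemma isContractionSeq_univGen : IsContractionSeq univGen.{u} := by
  refine fun n => ⟨?_, ?_⟩
  · refine Subtype.ext ?_
    ext ν
    exact (isContractionSeq_modelSeq ν n).1
  · exact lp.norm_le_of_forall_le zero_le_one fun ν => (isContractionSeq_modelSeq ν n).2

lemma IsContractionSeq.map {B D : Type*} [NonUnitalCStarAlgebra B] [NonUnitalCStarAlgebra D]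
    {x : ℕ → B} (hx : IsContractionSeq x) (f : B →⋆ₙₐ[ℂ] D) :
    IsContractionSeq fun n => f (x n) :=
  fun n => ⟨(hx n).1.map f, (NonUnitalStarAlgHom.norm_apply_le f _).trans (hx n).2⟩

/-- Evaluation of the universal algebra at a model. -/
noncomputable def univCoord (ν : termNorms.{u}) : UnivAlg.{u} →⋆ₙₐ[ℂ] ModelAlg ν :=
  (coordHom ModelAlg ν).comp (NonUnitalStarSubalgebraClass.subtype (generated (Set.range univSeq)))

variable {B : Type u} [NonUnitalCStarAlgebra B]

lemma univAlg_induction {p : UnivAlg.{u} → Prop} (gen : ∀ n, p (univGen n)) (zero : p 0)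
    (add : ∀ x y, p x → p y → p (x + y)) (mul : ∀ x y, p x → p y → p (x * y))
    (smul : ∀ (r : ℂ) x, p x → p (r • x)) (star : ∀ x, p x → p (star x))
    (closed : IsClosed {x | p x}) (x : UnivAlg.{u}) : p x := by
  refine generated_induction ?_ zero add mul smul star closed x
  rintro _ ⟨n, rfl⟩
  exact gen n

lemma univAlg_hom_ext {f g : UnivAlg.{u} →⋆ₙₐ[ℂ] B} (h : ∀ n, f (univGen n) = g (univGen n)) :
    f = g := by
  refine NonUnitalStarAlgHom.ext fun x => ?_
  induction x using univAlg_induction with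
  | gen n => exact h n
  | zero => simp
  | add x y hx hy => simp [hx, hy]
  | mul x y hx hy => simp [hx, hy]
  | smul r x hx => simp [hx]
  | star x hx => simp [map_star, hx]
  | closed => exact isClosed_eq (continuous_hom f) (continuous_hom g)

lemma mem_generated_univGen (y : UnivAlg.{u}) : y ∈ generated (Set.range univGen.{u}) := by
  induction y using univAlg_induction with
  | gen n => exact subset_generated _ ⟨n, rfl⟩
  | zero => exact zero_mem _
  | add a b ha hb => exact add_mem ha hb
  | mul a b ha hb => exact mul_mem ha hb
  | smul r a ha => exact SMulMemClass.smul_mem r ha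
  | star a ha => exact star_mem ha
  | closed => exact isClosed_generated _

theorem exists_univAlg_hom {x : ℕ → B} (hx : IsContractionSeq x) :
    ∃ f : UnivAlg.{u} →⋆ₙₐ[ℂ] B, ∀ n, f (univGen n) = x n := by
  -- The product defining the universal algebra runs over norms on formal polynomials, not over all
  -- algebras, so it stays in the universe. Some model has the same norms as `x`, which suffices.
  let ν : termNorms.{u} := ⟨fun t => ‖t.eval x‖, B, inferInstance, x, hx, fun _ => rfl⟩
  refine exists_hom_of_norm_eval_le mem_generated_univGen fun t => ?_
  have h3 : univCoord ν (t.eval univGen) = t.eval (modelSeq ν) := t.map_eval (univCoord ν) univGen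
  calc ‖t.eval x‖ = ‖univCoord ν (t.eval univGen)‖ := by rw [h3, norm_eval_modelSeq]
    _ ≤ _ := NonUnitalStarAlgHom.norm_apply_le _ _

/-- The norms induced by homomorphisms on the universal algebra are induced by models. -/
lemma exists_norm_univCoord_eq (f : UnivAlg.{u} →⋆ₙₐ[ℂ] B) :
    ∃ ν : termNorms.{u}, ∀ y, ‖univCoord ν y‖ = ‖f y‖ := by
  let ν : termNorms.{u} := ⟨fun t => ‖t.eval fun n => f (univGen n)‖, B, inferInstance, _,
    isContractionSeq_univGen.map f, fun _ => rfl⟩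
  refine ⟨ν, fun y => ?_⟩
  refine closure_minimal (t := {y | ‖univCoord ν y‖ = ‖f y‖}) (fun z hz => ?_)
    (isClosed_eq (continuous_hom _).norm (continuous_hom f).norm) (mem_generated_univGen y)
  obtain ⟨t, rfl⟩ := exists_term_of_mem_adjoin univGen hz
  change ‖univCoord ν (t.eval univGen)‖ = ‖f (t.eval univGen)‖
  rw [t.map_eval, t.map_eval]
  exact norm_eval_modelSeq ν t

end Universal

/-! ### Sharp estimates for quotient norms -/

section NormEstimates

/-- Selfadjoint elements have preimages without loss of norm. Passing to `star c * c` and squared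
norms avoids the factor 2 of general preimages. -/
lemma exists_ker_norm_sub_le {C D : Type*} [NonUnitalCStarAlgebra C] [NonUnitalCStarAlgebra D]
    (f : C →⋆ₙₐ[ℂ] D) (c : C) : ∃ z, f z = 0 ∧ ‖star c * c - z‖ ≤ ‖f c‖ ^ 2 := by
  obtain ⟨e, -, he, hfe⟩ := exists_selfAdjoint_preimage f ⟨star c * c, rfl⟩
    ((IsSelfAdjoint.star_mul_self c).map f) le_rfl
  refine ⟨star c * c - e, by rw [map_sub, hfe, sub_self], ?_⟩
  rw [map_mul, map_star, CStarRing.norm_star_mul_self] at he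
  simpa [sq] using he

lemma norm_sq_le_add {C E : Type*} [NonUnitalCStarAlgebra C] [NonUnitalCStarAlgebra E]
    {c z : C} {s : ℝ} (h : ‖star c * c - z‖ ≤ s) (g : C →⋆ₙₐ[ℂ] E) : ‖g c‖ ^ 2 ≤ s + ‖g z‖ := by
  calc ‖g c‖ ^ 2 = ‖g (star c * c - z) + g z‖ := by
        rw [← map_add, sub_add_cancel, map_mul, map_star, CStarRing.norm_star_mul_self, sq]
    _ ≤ ‖g (star c * c - z)‖ + ‖g z‖ := norm_add_le _ _
    _ ≤ _ := by
        gcongr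
        exact (NonUnitalStarAlgHom.norm_apply_le g _).trans h

/-- The norm on the quotient by an increasing union of ideals is the limit of the quotient
norms. -/
lemma eventually_norm_lt_of_isQuotientBy {C : Type u} [NonUnitalCStarAlgebra C]
    {J : ℕ → TwoSidedIdeal C} (hJ : Monotone J) {D : ℕ → Type u}
    [∀ k, NonUnitalCStarAlgebra (D k)] {Q : Type u} [NonUnitalCStarAlgebra Q]
    {ρ : ∀ k, C →⋆ₙₐ[ℂ] D k} {π : C →⋆ₙₐ[ℂ] Q} (hρ : ∀ k, IsQuotientBy (J k : Set C) (ρ k))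
    (hπ : IsQuotientBy (closure (⋃ k, (J k : Set C))) π) {c : C} {r : ℝ} (hc : ‖π c‖ < r) :
    ∀ᶠ m in atTop, ‖ρ m c‖ < r := by
  obtain ⟨z, hz, hn⟩ := exists_ker_norm_sub_le π c
  have hη : 0 < r ^ 2 - ‖π c‖ ^ 2 := by
    have := norm_nonneg (π c)
    nlinarith
  obtain ⟨z', hz', hd⟩ := Metric.mem_closure_iff.1 ((hπ.mem_iff z).2 hz) _ hη
  obtain ⟨m, hm⟩ := Set.mem_iUnion.1 hz'
  refine eventually_atTop.2 ⟨m, fun l hl => ?_⟩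
  have h0 : ρ l z' = 0 := ((hρ l).mem_iff z').1 (hJ hl hm)
  have h1 : ‖ρ l z‖ < r ^ 2 - ‖π c‖ ^ 2 := by
    have : ρ l z = ρ l (z - z') := by rw [map_sub, h0, sub_zero]
    rw [this]
    rw [dist_eq_norm] at hd
    exact (NonUnitalStarAlgHom.norm_apply_le _ _).trans_lt hd
  have h2 : ‖ρ l c‖ ^ 2 < r ^ 2 := by linarith [norm_sq_le_add hn (ρ l)]
  exact lt_of_pow_lt_pow_left₀ 2 ((norm_nonneg _).trans hc.le) h2

end NormEstimates

/-! ### Universal algebras for relaxed relations -/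

section Stage

variable {B : Type u} [NonUnitalCStarAlgebra B] (r : ℕ → UnivAlg.{u}) (k : ℕ)

/-- The models that satisfy the first relations of a sequence up to a small error. -/
def RelModels : Type :=
  {ν : termNorms.{u} // ∀ j ≤ k, ‖univCoord ν (r j)‖ ≤ 1 / ((k : ℝ) + 1)}

/-- The representation of the universal algebra on approximate models of the relations. -/
noncomputable def relHom : UnivAlg.{u} →⋆ₙₐ[ℂ] lp (fun ν : RelModels r k => ModelAlg ν.1) ∞ :=
  prodHom fun ν => univCoord ν.1

instance isClosed_range_relHom : IsClosed (NonUnitalStarAlgHom.range (relHom r k) :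
    Set (lp (fun ν : RelModels r k => ModelAlg ν.1) ∞)) := by
  rw [NonUnitalStarAlgHom.coe_range]
  exact isClosed_range _

/-- The universal algebra for the first relations of a sequence, relaxed by a small error. -/
def Stage : Type u := NonUnitalStarAlgHom.range (relHom r k)

noncomputable instance : NonUnitalCStarAlgebra (Stage r k) :=
  inferInstanceAs (NonUnitalCStarAlgebra (NonUnitalStarAlgHom.range (relHom r k)))

/-- The quotient map from the universal algebra. -/
noncomputable def stageHom : UnivAlg.{u} →⋆ₙₐ[ℂ] Stage r k :=
  NonUnitalStarAlgHom.codRestrict (relHom r k) (NonUnitalStarAlgHom.range (relHom r k))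
    (NonUnitalStarAlgHom.mem_range_self _)

lemma stageHom_surjective : Function.Surjective (stageHom r k) := by
  rintro ⟨_, y, rfl⟩
  exact ⟨y, rfl⟩

instance : TopologicalSpace.SeparableSpace (Stage r k) :=
  (stageHom_surjective r k).denseRange.separableSpace (continuous_hom _)

variable {r k}

lemma norm_stageHom_le {j : ℕ} (h : j ≤ k) : ‖stageHom r k (r j)‖ ≤ 1 / ((k : ℝ) + 1) :=
  lp.norm_le_of_forall_le (f := relHom r k (r j)) (by positivity) fun ν => ν.2 j h

lemma exists_stage_hom (f : UnivAlg.{u} →⋆ₙₐ[ℂ] B)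
    (h : ∀ j ≤ k, ‖f (r j)‖ ≤ 1 / ((k : ℝ) + 1)) :
    ∃ g : Stage r k →⋆ₙₐ[ℂ] B, ∀ y, g (stageHom r k y) = f y := by
  obtain ⟨ν, hν⟩ := exists_norm_univCoord_eq f
  refine exists_factor (stageHom_surjective r k) f fun y hy => ?_
  have h1 : relHom r k y = 0 := congrArg Subtype.val hy
  have h2 : relHom r k y ⟨ν, fun j hj => (hν _).trans_le (h j hj)⟩ = univCoord ν y := rfl
  rw [← norm_eq_zero, ← hν, ← h2, h1]
  exact norm_zero

lemma stage_hom_ext {f g : Stage r k →⋆ₙₐ[ℂ] B}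
    (h : ∀ y, f (stageHom r k y) = g (stageHom r k y)) : f = g := by
  refine NonUnitalStarAlgHom.ext fun x => ?_
  obtain ⟨y, rfl⟩ := stageHom_surjective r k x
  exact h y

/-- Lift the images of the generators to selfadjoint contractions in `C`. In the limit quotient the
relations have norm at most `1/(k+2)`, so at some finite level they have norm below `1/(k+1)`, which
is what `Stage r k` asks for. -/
lemma semiprojectiveHom_of_comp_stageHom {θ : Stage r k →⋆ₙₐ[ℂ] Stage r (k + 1)}
    (hθ : ∀ y, θ (stageHom r k y) = stageHom r (k + 1) y) : SemiprojectiveHom θ := by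
  intro C _ _ J _ hJ D _ Q _ ρ π p hρ hπ hp σ
  have hlift (n : ℕ) : ∃ c : C, IsSelfAdjoint c ∧ ‖c‖ ≤ 1 ∧
      π c = σ (stageHom r (k + 1) (univGen n)) := by
    have h := (isContractionSeq_univGen.map (stageHom r (k + 1))).map σ n
    exact exists_selfAdjoint_preimage π (hπ.surjective _) h.1 h.2
  choose c hsa hn hc using hlift
  obtain ⟨f, hf⟩ := exists_univAlg_hom (x := c) fun n => ⟨hsa n, hn n⟩
  have hπf : π.comp f = σ.comp (stageHom r (k + 1)) := univAlg_hom_ext fun n => by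
    change π (f _) = _
    rw [hf, hc]
    rfl
  have hπf' (y) : π (f y) = σ (stageHom r (k + 1) y) := DFunLike.congr_fun hπf y
  have hev : ∀ᶠ m in atTop, ∀ j ∈ Set.Iic k, ‖ρ m (f (r j))‖ < 1 / ((k : ℝ) + 1) := by
    refine ((Set.finite_Iic k).eventually_all).2 fun j hj => ?_
    refine eventually_norm_lt_of_isQuotientBy hJ hρ hπ ?_
    rw [hπf']
    refine ((NonUnitalStarAlgHom.norm_apply_le σ _).trans
      (norm_stageHom_le (Nat.le_succ_of_le hj))).trans_lt ?_
    push_cast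
    exact one_div_lt_one_div_of_lt (by positivity) (by linarith)
  obtain ⟨m, hm⟩ := hev.exists
  obtain ⟨ψ, hψ⟩ := exists_stage_hom ((ρ m).comp f) fun j hj => (hm j hj).le
  refine ⟨m, ψ, stage_hom_ext fun y => ?_⟩
  change p m (ψ (stageHom r k y)) = σ (θ (stageHom r k y))
  rw [hψ, hθ, ← hπf', ← hp m]
  rfl

end Stage

/-! ### Straight-line homotopies on generators -/

section Paths

variable {B : Type u} [NonUnitalCStarAlgebra B]

/-- Homomorphisms on the universal algebra depend uniformly continuously on the images of the
generators. -/
lemma exists_modulus (y : UnivAlg.{u}) : ∀ ε > 0, ∃ m : ℕ, ∃ δ > 0,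
    ∀ (B : Type u) [NonUnitalCStarAlgebra B] (f g : UnivAlg.{u} →⋆ₙₐ[ℂ] B),
      (∀ j < m, ‖f (univGen j) - g (univGen j)‖ < δ) → ‖f y - g y‖ < ε := by
  induction y using univAlg_induction with
  | gen n => exact fun ε hε => ⟨n + 1, ε, hε, fun B _ f g h => h n n.lt_succ_self⟩
  | zero => exact fun ε hε => ⟨0, 1, one_pos, fun B _ f g _ => by simpa using hε⟩
  | add x y hx hy =>
    intro ε hε
    obtain ⟨m, δ, hδ, hm⟩ := hx (ε / 2) (half_pos hε)
    obtain ⟨n, η, hη, hn⟩ := hy (ε / 2) (half_pos hε)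
    refine ⟨max m n, min δ η, lt_min hδ hη, fun B _ f g h => ?_⟩
    have h1 := hm B f g fun j hj => (h j (lt_max_of_lt_left hj)).trans_le (min_le_left _ _)
    have h2 := hn B f g fun j hj => (h j (lt_max_of_lt_right hj)).trans_le (min_le_right _ _)
    calc ‖f (x + y) - g (x + y)‖ = ‖(f x - g x) + (f y - g y)‖ := by
          rw [map_add, map_add]; congr 1; abel
      _ ≤ ‖f x - g x‖ + ‖f y - g y‖ := norm_add_le _ _
      _ < ε := by linarith
  | mul x y hx hy =>
    intro ε hε
    have hK : 0 < ‖x‖ + ‖y‖ + 1 := by positivity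
    obtain ⟨m, δ, hδ, hm⟩ := hx (ε / (‖x‖ + ‖y‖ + 1)) (div_pos hε hK)
    obtain ⟨n, η, hη, hn⟩ := hy (ε / (‖x‖ + ‖y‖ + 1)) (div_pos hε hK)
    refine ⟨max m n, min δ η, lt_min hδ hη, fun B _ f g h => ?_⟩
    have h1 := hm B f g fun j hj => (h j (lt_max_of_lt_left hj)).trans_le (min_le_left _ _)
    have h2 := hn B f g fun j hj => (h j (lt_max_of_lt_right hj)).trans_le (min_le_right _ _)
    calc ‖f (x * y) - g (x * y)‖ = ‖(f x - g x) * f y + g x * (f y - g y)‖ := by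
          rw [map_mul, map_mul, sub_mul, mul_sub]; congr 1; abel
      _ ≤ ‖f x - g x‖ * ‖f y‖ + ‖g x‖ * ‖f y - g y‖ :=
          (norm_add_le _ _).trans (add_le_add (norm_mul_le _ _) (norm_mul_le _ _))
      _ ≤ ε / (‖x‖ + ‖y‖ + 1) * ‖y‖ + ‖x‖ * (ε / (‖x‖ + ‖y‖ + 1)) := by
          gcongr
          · exact NonUnitalStarAlgHom.norm_apply_le f y
          · exact NonUnitalStarAlgHom.norm_apply_le g x
      _ < ε / (‖x‖ + ‖y‖ + 1) * (‖x‖ + ‖y‖ + 1) := by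
          have := div_pos hε hK
          linarith
      _ = ε := div_mul_cancel₀ _ hK.ne'
  | smul c x hx =>
    intro ε hε
    have hK : 0 < ‖c‖ + 1 := by positivity
    obtain ⟨m, δ, hδ, hm⟩ := hx (ε / (‖c‖ + 1)) (div_pos hε hK)
    refine ⟨m, δ, hδ, fun B _ f g h => ?_⟩
    have h1 := hm B f g h
    rw [map_smul, map_smul, ← smul_sub, norm_smul]
    calc ‖c‖ * ‖f x - g x‖ ≤ ‖c‖ * (ε / (‖c‖ + 1)) := by gcongr
      _ < (‖c‖ + 1) * (ε / (‖c‖ + 1)) := by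
          have := div_pos hε hK
          linarith
      _ = ε := mul_div_cancel₀ _ hK.ne'
  | star x hx =>
    intro ε hε
    obtain ⟨m, δ, hδ, hm⟩ := hx ε hε
    refine ⟨m, δ, hδ, fun B _ f g h => ?_⟩
    rw [map_star, map_star, ← star_sub, norm_star]
    exact hm B f g h
  | closed =>
    refine isClosed_of_closure_subset fun x hx ε hε => ?_
    obtain ⟨z, hz, hd⟩ := Metric.mem_closure_iff.1 hx (ε / 3) (by positivity)
    obtain ⟨m, δ, hδ, hm⟩ := hz (ε / 3) (by positivity)
    refine ⟨m, δ, hδ, fun B _ f g h => ?_⟩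
    have h1 := hm B f g h
    rw [dist_eq_norm] at hd
    have h2 := (NonUnitalStarAlgHom.norm_apply_le f (x - z)).trans_lt hd
    have h3 := (NonUnitalStarAlgHom.norm_apply_le g (x - z)).trans_lt hd
    calc ‖f x - g x‖ = ‖f (x - z) + (f z - g z) - g (x - z)‖ := by
          rw [map_sub, map_sub]; congr 1; abel
      _ ≤ ‖f (x - z)‖ + ‖f z - g z‖ + ‖g (x - z)‖ :=
          (norm_sub_le _ _).trans (by gcongr; exact norm_add_le _ _)
      _ < ε := by linarith

lemma exists_modulus_of_finite {s : Set UnivAlg.{u}} (hs : s.Finite) {ε : ℝ} (hε : 0 < ε) :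
    ∃ m : ℕ, ∃ δ > 0, ∀ (B : Type u) [NonUnitalCStarAlgebra B] (f g : UnivAlg.{u} →⋆ₙₐ[ℂ] B),
      (∀ j < m, ‖f (univGen j) - g (univGen j)‖ < δ) → ∀ y ∈ s, ‖f y - g y‖ < ε := by
  induction s, hs using Set.Finite.induction_on with
  | empty => exact ⟨0, 1, one_pos, by simp⟩
  | insert _ _ ih =>
    rename_i y s _ _
    obtain ⟨m, δ, hδ, hm⟩ := ih
    obtain ⟨n, η, hη, hn⟩ := exists_modulus y ε hε
    refine ⟨max m n, min δ η, lt_min hδ hη, fun B _ f g h z hz => ?_⟩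
    rcases hz with rfl | hz
    · exact hn B f g fun j hj => (h j (lt_max_of_lt_right hj)).trans_le (min_le_right _ _)
    · exact hm B f g (fun j hj => (h j (lt_max_of_lt_left hj)).trans_le (min_le_left _ _)) z hz

/-- The straight line on generators between homomorphisms on the universal algebra. -/
lemma exists_linear_path (f g : UnivAlg.{u} →⋆ₙₐ[ℂ] B) :
    ∃ ψ : UnivAlg.{u} →⋆ₙₐ[ℂ] C(unitInterval, B),
      (evalHom B 0).comp ψ = f ∧ (evalHom B 1).comp ψ = g ∧
      ∀ t n, ‖ψ (univGen n) t - f (univGen n)‖ ≤ ‖g (univGen n) - f (univGen n)‖ := by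
  let x (n : ℕ) : C(unitInterval, B) :=
    ⟨fun t => (1 - (t : ℝ)) • f (univGen n) + (t : ℝ) • g (univGen n), by fun_prop⟩
  have hf := isContractionSeq_univGen.map f
  have hg := isContractionSeq_univGen.map g
  have hx : IsContractionSeq x := by
    refine fun n => ⟨?_, (ContinuousMap.norm_le _ zero_le_one).2 fun t => ?_⟩
    · ext t
      change star ((1 - (t : ℝ)) • f (univGen n) + (t : ℝ) • g (univGen n)) = _
      rw [star_add, star_smul, star_smul, (hf n).1.star_eq, (hg n).1.star_eq]
      rfl
    · have h0 := t.2.1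
      have h1 := t.2.2
      calc ‖(1 - (t : ℝ)) • f (univGen n) + (t : ℝ) • g (univGen n)‖
          ≤ (1 - (t : ℝ)) * ‖f (univGen n)‖ + t * ‖g (univGen n)‖ := by
            refine (norm_add_le _ _).trans_eq ?_
            rw [norm_smul, norm_smul, Real.norm_of_nonneg (by linarith), Real.norm_of_nonneg h0]
        _ ≤ (1 - (t : ℝ)) * 1 + t * 1 := by
            exact add_le_add (mul_le_mul_of_nonneg_left (hf n).2 (by linarith))
              (mul_le_mul_of_nonneg_left (hg n).2 h0)
        _ = 1 := by ring
  obtain ⟨ψ, hψ⟩ := exists_univAlg_hom hx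
  refine ⟨ψ, univAlg_hom_ext fun n => ?_, univAlg_hom_ext fun n => ?_, fun t n => ?_⟩
  · change ψ (univGen n) 0 = _
    rw [hψ]
    simp [x]
  · change ψ (univGen n) 1 = _
    rw [hψ]
    simp [x]
  · rw [hψ]
    have : x n t - f (univGen n) = (t : ℝ) • (g (univGen n) - f (univGen n)) := by
      change (1 - (t : ℝ)) • f (univGen n) + (t : ℝ) • g (univGen n) - _ = _
      rw [sub_smul, one_smul, smul_sub]
      abel
    rw [this, norm_smul, Real.norm_of_nonneg t.2.1]
    exact mul_le_of_le_one_left (norm_nonneg _) t.2.2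

/-- The selfadjoint contractions form a convex set. With `g = 0` this is the contractibility of the
universal algebra. -/
lemma homotopic_of_univAlg (f g : UnivAlg.{u} →⋆ₙₐ[ℂ] B) : Homotopic f g := by
  obtain ⟨ψ, rfl, rfl, -⟩ := exists_linear_path f g
  exact homotopic_of_path ψ

end Paths

/-! ### Separable algebras as limits of relaxed presentations -/

section Presentation

variable {A : Type u} [NonUnitalCStarAlgebra A]

lemma exists_univAlg_surjection [TopologicalSpace.SeparableSpace A] :
    ∃ f : UnivAlg.{u} →⋆ₙₐ[ℂ] A, Function.Surjective f := by
  let U : Set A := {a | IsSelfAdjoint a ∧ ‖a‖ ≤ 1}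
  have : Nonempty U := ⟨⟨0, IsSelfAdjoint.zero _, by simp⟩⟩
  obtain ⟨f, hf⟩ := exists_univAlg_hom
    (x := fun n => (TopologicalSpace.denseSeq U n : A)) fun n => (TopologicalSpace.denseSeq U n).2
  have h1 (a : A) (ha : IsSelfAdjoint a) (hn : ‖a‖ ≤ 1) : a ∈ Set.range f := by
    have h2 : (⟨a, ha, hn⟩ : U) ∈ closure (Set.range (TopologicalSpace.denseSeq U)) :=
      TopologicalSpace.denseRange_denseSeq U _
    have h3 : Set.range (TopologicalSpace.denseSeq U) ⊆ Subtype.val ⁻¹' Set.range f := by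
      rintro _ ⟨n, rfl⟩
      exact ⟨univGen n, hf n⟩
    exact closure_minimal h3 ((isClosed_range f).preimage continuous_subtype_val) h2
  have h4 (a : A) (ha : IsSelfAdjoint a) : a ∈ Set.range f := by
    have hK : 0 < ‖a‖ + 1 := by positivity
    obtain ⟨y, hy⟩ := h1 ((‖a‖ + 1)⁻¹ • a) ((IsSelfAdjoint.all _).smul ha) (by
      rw [norm_smul, norm_inv, Real.norm_of_nonneg hK.le, inv_mul_le_one₀ hK]
      linarith)
    refine ⟨((‖a‖ + 1 : ℝ) : ℂ) • y, ?_⟩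
    rw [map_smul, hy, Complex.coe_smul, smul_inv_smul₀ hK.ne']
  refine ⟨f, fun a => ?_⟩
  obtain ⟨y, hy⟩ := h4 _ (realPart a).2
  obtain ⟨z, hz⟩ := h4 _ (imaginaryPart a).2
  refine ⟨y + Complex.I • z, ?_⟩
  rw [map_add, map_smul, hy, hz, realPart_add_I_smul_imaginaryPart]

lemma exists_dense_ker (f : UnivAlg.{u} →⋆ₙₐ[ℂ] A) :
    ∃ r : ℕ → UnivAlg.{u}, (∀ j, f (r j) = 0) ∧
      ∀ z, f z = 0 → ∀ ε > 0, ∃ j, ‖z - r j‖ < ε := by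
  let U : Set UnivAlg.{u} := {z | f z = 0}
  have : Nonempty U := ⟨⟨0, map_zero f⟩⟩
  refine ⟨fun j => TopologicalSpace.denseSeq U j, fun j => (TopologicalSpace.denseSeq U j).2,
    fun z hz ε hε => ?_⟩
  obtain ⟨j, hj⟩ := (TopologicalSpace.denseRange_denseSeq U).exists_dist_lt ⟨z, hz⟩ hε
  exact ⟨j, by simpa [Subtype.dist_eq, dist_eq_norm] using hj⟩

variable {f : UnivAlg.{u} →⋆ₙₐ[ℂ] A} {r : ℕ → UnivAlg.{u}}

lemma norm_le_norm_stageHom (hr : ∀ j, f (r j) = 0) (k : ℕ) (y : UnivAlg.{u}) :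
    ‖f y‖ ≤ ‖stageHom r k y‖ := by
  obtain ⟨g, hg⟩ := exists_stage_hom (r := r) (k := k) f fun j _ => by
    rw [hr, norm_zero]
    positivity
  rw [← hg]
  exact NonUnitalStarAlgHom.norm_apply_le g _

/-- The element `star y * y` is within `‖f y‖ ^ 2` of the kernel of `f`, and each kernel element is
close to some `r j`, whose norm in `Stage r k` tends to zero. -/
lemma eventually_norm_stageHom_lt (hd : ∀ z, f z = 0 → ∀ ε > 0, ∃ j, ‖z - r j‖ < ε)
    (y : UnivAlg.{u}) {s : ℝ} (hs : ‖f y‖ < s) : ∀ᶠ k in atTop, ‖stageHom r k y‖ < s := by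
  obtain ⟨z, hz, hn⟩ := exists_ker_norm_sub_le f y
  have hη : 0 < s ^ 2 - ‖f y‖ ^ 2 := by
    have := norm_nonneg (f y)
    nlinarith
  obtain ⟨j, hj⟩ := hd z hz _ (half_pos hη)
  filter_upwards [eventually_ge_atTop j,
    (tendsto_one_div_add_atTop_nhds_zero_nat (𝕜 := ℝ)).eventually (gt_mem_nhds (half_pos hη))]
    with k hk hk'
  have h1 : ‖stageHom r k z‖ ≤ ‖stageHom r k (z - r j)‖ + ‖stageHom r k (r j)‖ := by
    rw [map_sub]
    exact norm_le_norm_sub_add _ _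
  have h2 := NonUnitalStarAlgHom.norm_apply_le (stageHom r k) (z - r j)
  have h3 := norm_stageHom_le (r := r) hk
  have h4 := norm_sq_le_add hn (stageHom r k)
  exact lt_of_pow_lt_pow_left₀ 2 ((norm_nonneg _).trans hs.le) (by linarith)

lemma tendsto_norm_stageHom (hr : ∀ j, f (r j) = 0)
    (hd : ∀ z, f z = 0 → ∀ ε > 0, ∃ j, ‖z - r j‖ < ε) (y : UnivAlg.{u}) :
    Tendsto (fun k => ‖stageHom r k y‖) atTop (𝓝 ‖f y‖) :=
  tendsto_order.2 ⟨fun _ hs => Eventually.of_forall fun k =>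
    hs.trans_le (norm_le_norm_stageHom hr k y), fun _ hs => eventually_norm_stageHom_lt hd y hs⟩

/-- Let `s` be an approximate section of `f`. In a late stage `s (f (univGen j))` is close to
`univGen j` for the finitely many generators that matter. The straight line between them almost
satisfies the relations and defines a homotopy on `Stage r k`, ending at a map through `UnivAlg`. -/
lemma exists_stage_nullHomotopic (hA : IsWeaklyProjective A) (hf : Function.Surjective f)
    (hr : ∀ j, f (r j) = 0) (hd : ∀ z, f z = 0 → ∀ ε > 0, ∃ j, ‖z - r j‖ < ε) (k : ℕ) :
    ∃ l > k, ∀ θ : Stage r k →⋆ₙₐ[ℂ] Stage r l,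
      (∀ y, θ (stageHom r k y) = stageHom r l y) → Homotopic θ 0 := by
  classical
  -- This is the room along the path: for `l > k` the relations have norm at most `1/(k+2)` in
  -- `Stage r l`, and `1/(k+1)` is allowed.
  have hε : 0 < 1 / ((k : ℝ) + 1) - 1 / ((k : ℝ) + 2) :=
    sub_pos.2 (one_div_lt_one_div_of_lt (by positivity) (by linarith))
  obtain ⟨m, δ, hδ, hm⟩ := exists_modulus_of_finite ((Set.finite_Iic k).image r) hε
  obtain ⟨s, hs⟩ := hA UnivAlg.{u} A (TwoSidedIdeal.ker f) f (isClosed_ker f) (isQuotientBy_ker hf)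
    (NonUnitalStarAlgHom.id ℂ A) δ ((Finset.range m).image fun j => f (univGen j)) hδ
  have hev : ∀ᶠ l in atTop, ∀ j ∈ Set.Iio m,
      ‖stageHom r l (s (f (univGen j)) - univGen j)‖ < δ := by
    refine ((Set.finite_Iio m).eventually_all).2 fun j hj => eventually_norm_stageHom_lt hd _ ?_
    rw [map_sub]
    exact hs _ (Finset.mem_image_of_mem _ (Finset.mem_range.2 hj))
  obtain ⟨l, hl, hkl⟩ := (hev.and (eventually_gt_atTop k)).exists
  refine ⟨l, hkl, fun θ hθ => ?_⟩
  obtain ⟨ψ, hψ0, hψ1, hψ⟩ := exists_linear_path (stageHom r l) (((stageHom r l).comp s).comp f)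
  have hψr (j : ℕ) (hj : j ≤ k) : ‖ψ (r j)‖ ≤ 1 / ((k : ℝ) + 1) := by
    refine (ContinuousMap.norm_le _ (by positivity)).2 fun t => ?_
    have h1 := hm _ ((evalHom _ t).comp ψ) (stageHom r l) (fun i hi => (hψ t i).trans_lt (by
      have := hl i hi
      rwa [map_sub] at this)) (r j) ⟨j, hj, rfl⟩
    have h2 : ‖stageHom r l (r j)‖ ≤ 1 / ((k : ℝ) + 2) := by
      refine (norm_stageHom_le (hj.trans hkl.le)).trans ?_
      have : (k : ℝ) + 1 ≤ l := by exact_mod_cast hkl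
      exact one_div_le_one_div_of_le (by positivity) (by linarith)
    have h3 := norm_le_norm_sub_add (((evalHom _ t).comp ψ) (r j)) (stageHom r l (r j))
    change ‖((evalHom _ t).comp ψ) (r j)‖ ≤ _
    linarith
  obtain ⟨Ψ, hΨ⟩ := exists_stage_hom ψ hψr
  obtain ⟨ι, hι⟩ := exists_stage_hom (r := r) (k := k) f fun j _ => by
    rw [hr, norm_zero]
    positivity
  have h0 : (evalHom _ 0).comp Ψ = θ := stage_hom_ext fun y => by
    rw [hθ, ← hψ0]
    change evalHom _ 0 (Ψ _) = _
    rw [hΨ]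
    rfl
  have h1 : (evalHom _ 1).comp Ψ = (stageHom r l).comp (s.comp ι) := stage_hom_ext fun y => by
    change evalHom _ 1 (Ψ _) = stageHom r l (s (ι _))
    rw [hΨ, hι]
    exact DFunLike.congr_fun hψ1 y
  have h2 := homotopic_of_path Ψ
  rw [h0, h1] at h2
  exact h2.trans ((homotopic_of_univAlg (stageHom r l) 0).comp_right (s.comp ι))

end Presentation

/-! ### Weak projectivity implies trivial shape -/

section TrivialShape

/-- The constant inductive system of the zero algebra. -/
noncomputable def zeroSystem : InductiveSystem.{u} where
  obj _ := PUnit.{u + 1}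
  map _ := 0

lemma isShapeSystem_zeroSystem : zeroSystem.{u}.IsShapeSystem PUnit.{u + 1} := by
  refine ⟨⟨fun _ => 0, fun _ => rfl, fun x => subset_closure (Set.mem_iUnion.2 ⟨0, 0, rfl⟩),
    fun k a => ?_⟩, fun k => ?_⟩
  · exact tendsto_const_nhds.congr fun n =>
      congrArg (fun x : PUnit.{u + 1} => ‖x‖) (Subsingleton.elim _ _)
  · intro C _ _ J _ _ D _ Q _ ρ π p _ _ _ σ
    refine ⟨0, 0, NonUnitalStarAlgHom.ext fun a => ?_⟩
    change p 0 0 = σ 0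
    rw [map_zero, map_zero]

/-- The inductive system of the algebras of the relaxed relations. -/
lemma exists_stage_system (r : ℕ → UnivAlg.{u}) :
    ∃ θ : ∀ k, Stage r k →⋆ₙₐ[ℂ] Stage r (k + 1),
      ∀ k y, θ k (stageHom r k y) = stageHom r (k + 1) y := by
  have h (k : ℕ) := exists_stage_hom (r := r) (k := k) (stageHom r (k + 1)) fun j hj =>
    (norm_stageHom_le (Nat.le_succ_of_le hj)).trans (by
      push_cast
      exact one_div_le_one_div_of_le (by positivity) (by linarith))
  choose θ hθ using h
  exact ⟨θ, hθ⟩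

theorem IsWeaklyProjective.hasTrivialShape {A : Type u} [NonUnitalCStarAlgebra A]
    [TopologicalSpace.SeparableSpace A] (hA : IsWeaklyProjective A) : HasTrivialShape A := by
  obtain ⟨f, hf⟩ := exists_univAlg_surjection (A := A)
  obtain ⟨r, hr, hd⟩ := exists_dense_ker f
  obtain ⟨θ, hθ⟩ := exists_stage_system r
  have hex (k : ℕ) := exists_stage_hom (r := r) (k := k) f fun j _ => by
    rw [hr, norm_zero]
    positivity
  choose ι hι using hex
  let S : InductiveSystem.{u} := { obj := Stage r, map := θ }
  have htrans {k l : ℕ} (h : k ≤ l) (y : UnivAlg.{u}) :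
      S.trans h (stageHom r k y) = stageHom r l y := by
    induction l, h using Nat.le_induction with
    | base => rw [S.trans_self]; rfl
    | succ l hl ih =>
      rw [S.trans_succ hl]
      change θ l (S.trans hl _) = _
      rw [ih, hθ]
  have hS : S.IsShapeSystem A := by
    refine ⟨⟨ι, fun k => stage_hom_ext fun y => ?_, fun a => ?_, fun k a => ?_⟩, fun k =>
      semiprojectiveHom_of_comp_stageHom (hθ k)⟩
    · change ι (k + 1) (θ k _) = _
      rw [hθ, hι, hι]
    · obtain ⟨y, rfl⟩ := hf a
      exact subset_closure (Set.mem_iUnion.2 ⟨0, stageHom r 0 y, hι 0 y⟩)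
    · obtain ⟨y, rfl⟩ := stageHom_surjective r k a
      rw [hι]
      refine ((tendsto_norm_stageHom hr hd y).comp (tendsto_add_atTop_nat k)).congr fun n => ?_
      rw [htrans, Function.comp_apply, add_comm]
  choose l hl hnull using exists_stage_nullHomotopic hA hf hr hd
  -- The connecting map from `k i` to `l (k i)` is null-homotopic, so zero maps intertwine. The
  -- extra 1 makes the interleaving strict.
  let k (i : ℕ) : ℕ := (fun m => l m + 1)^[i] 0
  have hk (i : ℕ) : k (i + 1) = l (k i) + 1 := Function.iterate_succ_apply' _ _ _
  refine ⟨S, zeroSystem, hS, isShapeSystem_zeroSystem, k, fun i => l (k i), fun i => hl (k i),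
    fun i => by rw [hk]; exact Nat.lt_succ_self _, fun _ => 0, fun _ => 0, fun i => ?_, fun i => ?_⟩
  · have h1 : k i ≤ l (k i) := (hl _).le
    have h2 : l (k i) ≤ k (i + 1) := by rw [hk]; exact Nat.le_succ _
    have h3 := (hnull (k i) (S.trans h1) (htrans h1)).comp_left (S.trans h2)
    rw [S.trans_trans h1 h2]
    have h4 : (S.trans h2).comp (0 : S.obj (k i) →⋆ₙₐ[ℂ] S.obj (l (k i))) = 0 :=
      NonUnitalStarAlgHom.ext fun _ => map_zero (S.trans h2)
    rw [h4] at h3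
    exact h3.symm
  · have h1 : ((0 : S.obj (k (i + 1)) →⋆ₙₐ[ℂ] zeroSystem.{u}.obj (l (k (i + 1)))).comp
        (0 : zeroSystem.{u}.obj (l (k i)) →⋆ₙₐ[ℂ] S.obj (k (i + 1)))) =
        zeroSystem.trans (k := l (k i)) (l := l (k (i + 1))) (((hk i).symm ▸
          Nat.le_succ (l (k i)) : l (k i) ≤ k (i + 1)).trans (hl _).le) :=
      NonUnitalStarAlgHom.ext fun _ => Subsingleton.elim (α := PUnit.{u + 1}) _ _
    rw [h1]
    exact Homotopic.refl _

end TrivialShape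

end CStarShape

theorem mainTheorem2 (A : Type u) [NonUnitalCStarAlgebra A]
    [TopologicalSpace.SeparableSpace A] :
    (CStarShape.IsProjective A ↔
      CStarShape.IsSemiprojective A ∧ CStarShape.HasTrivialShape A) ∧
    (CStarShape.IsWeaklyProjective A ↔
      CStarShape.IsWeaklySemiprojective A ∧ CStarShape.HasTrivialShape A) :=
  ⟨⟨fun h => ⟨h.isSemiprojective, h.isWeaklyProjective.hasTrivialShape⟩, fun h =>
      (h.1.isWeaklySemiprojective.isWeaklyProjective h.2).isProjective h.1⟩,
    ⟨fun h => ⟨h.isWeaklySemiprojective, h.hasTrivialShape⟩, fun h => h.1.isWeaklyProjective h.2⟩⟩
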